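/- **Setting.** Let $\Omega\subset\mathbb{R}^n$, $n\ge 2$, be a bounded domain with boundary $\Gamma$ of class $C^\infty$ and inward unit normal $\nu$. Consider an elliptic boundary-value problem $$Au=f\ \text{ in }\Omega,\qquad B_ju=g_j\ \text{ on }\Gamma,\quad j=1,\dots,q,\qquad q\ge1,$$ where $A=\sum_{|\mu|\le 2q}a_\mu D^\mu$ and $B_j=\sum_{|\mu|\le m_j}b_{j,\mu}D^\mu$ are linear differential operators with complex coefficients $a_\mu\in C^\infty(\overline\Omega)$, $b_{j,\mu}\in C^\infty(\Gamma)$ and $D_k=i\,\partial/\partial x_k$. Elliptic means that $A$ is properly elliptic on $\overline\Omega$ and $(B_1,\dots,B_q)$ satisfies the Lopatinskii condition with respect to $A$ on $\Gamma$. Assume $m:=\max_j m_j\ge 2q$ and put $r:=m+1$. Let $\mathcal M$ be the class of Borel functions $\varphi:[1,\infty)\to(0,\infty)$ such that $\varphi$ and $1/\varphi$ are bounded on every compact interval $[1,b]$ and $\varphi(\lambda t)/\varphi(t)\to1$ as $t\to\infty$ for every $\lambda>0$. For $s\in\mathbb{R}$ and $\varphi\in\mathcal M$, $H^{s,\varphi}(\mathbb{R}^d)$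 is the space of tempered distributions $w$ whose Fourier transform is locally integrable with $$\|w\|^2=\int_{\mathbb{R}^d}\langle\xi\rangle^{2s}\varphi^2(\langle\xi\rangle)|\widehat w(\xi)|^2\,d\xi<\infty,\qquad \langle\xi\rangle=(1+|\xi|^2)^{1/2}.$$ $H^{s,\varphi}(\Omega)$ is the space of restrictions to $\Omega$ of elements of $H^{s,\varphi}(\mathbb{R}^n)$, with the quotient norm, and $H^{s,\varphi}(\Gamma)$ is defined by a finite atlas of $\Gamma$ and a partition of unity from $H^{s,\varphi}(\mathbb{R}^{n-1})$. Let $\|u\|_{s,\varphi,(0)}$ be the norm in $H^{s,\varphi}(\Omega)$ if $s\ge0$, and $\sup\{|(u,v)_{L_2(\Omega)}|/\|v\|_{H^{-s,1/\varphi}(\Omega)}: 0\ne v\in H^{-s,1/\varphi}(\Omega)\}$ if $s<0$. For an integer $k\ge0$ put $E_k:=\{\frac12,\frac32,\dots,k-\frac12\}$. If $s\notin E_k$, $H^{s,\varphi,(k)}(\Omega)$ is the completion of $C^\infty(\overline\Omega)$ in the norm $$\Big(\|u\|_{s,\varphi,(0)}^2+\sum_{j=1}^k\|(D_\nu^{j-1}u)|_\Gamma\|^2_{H^{s-j+1/2,\varphi}(\Gamma)}\Big)^{1/2},\qquad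 D_\nu=i\,\partial/\partial\nu;$$ if $s\in E_k$, it is the Hilbert interpolation space $[H^{s-1/2,\varphi,(k)}(\Omega),H^{s+1/2,\varphi,(k)}(\Omega)]_{t^{1/2}}$, i.e. the domain of $J^{1/2}$ with norm $\|J^{1/2}\cdot\|$, where $J$ is the positive-definite self-adjoint operator in the first space whose domain is the second one and which satisfies $\|Jw\|=\|w\|_{H^{s+1/2,\varphi,(k)}(\Omega)}$. Put $H^{-\infty,(k)}(\Omega):=\bigcup_{s,\varphi}H^{s,\varphi,(k)}(\Omega)$ and $H^{k-1/2+}(\Omega):=\bigcup_{s>k-1/2,\,\varphi}H^{s,\varphi,(k)}(\Omega)$. The operator $(A,B)u=(Au,B_1u,\dots,B_qu)$ and multiplication by functions of $C^\infty(\overline\Omega)$ are extended from $C^\infty(\overline\Omega)$ by continuity to $H^{-\infty,(r)}(\Omega)$. For $u\in H^{-\infty,(r)}(\Omega)$, $u_0\in H^{-\infty,(0)}(\Omega)$ denotes its initial component, where $u\mapsto u_0$ is the extension by continuity of the identity map on $C^\infty(\overline\Omega)$. Let $V\subset\mathbb{R}^n$ be open with $\Omega_0:=\Omega\cap V\neq\emptyset$,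 and put $\Gamma_0:=\Gamma\cap V$ (possibly empty). Let $\mathcal{H}^{s-2q,\varphi,(r-2q)}_{\mathrm{loc}}(\Omega_0,\Gamma_0)$ be the set of $(f,g_1,\dots,g_q)\in H^{-\infty,(r-2q)}(\Omega)\times\mathcal D'(\Gamma)^q$ such that $\chi f\in H^{s-2q,\varphi,(r-2q)}(\Omega)$ for all $\chi\in C^\infty(\overline\Omega)$ with $\operatorname{supp}\chi\subset\Omega_0\cup\Gamma_0$, and $\chi g_j\in H^{s-m_j-1/2,\varphi}(\Gamma)$ for all $j$ and all $\chi\in C^\infty(\Gamma)$ with $\operatorname{supp}\chi\subset\Gamma_0$. For an integer $p\ge0$ and $u\in H^{-\infty,(r)}(\Omega)$, write $u\in C^p(\Omega_0\cup\Gamma_0)$ if, for every $\chi\in C^\infty(\overline\Omega)$ with $\operatorname{supp}\chi\subset\Omega_0\cup\Gamma_0$: $\chi u\in H^{r-1/2+}(\Omega)\cap C^p(\overline\Omega)$ in the case $\Gamma_0\ne\emptyset$; $(\chi u)_0\in H^{-1/2+}(\Omega)\cap C^p(\Omega)$ in the case $\Gamma_0=\emptyset$. **Statement.** Let $p\ge0$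 be an integer and $\varphi\in\mathcal M$. Suppose that, for every $u\in H^{-\infty,(r)}(\Omega)$, $$(A,B)u\in\mathcal H^{p+n/2-2q,\varphi,(r-2q)}_{\mathrm{loc}}(\Omega_0,\Gamma_0)\ \Longrightarrow\ u\in C^p(\Omega_0\cup\Gamma_0).$$ Then $$\int_1^\infty\frac{dt}{t\,\varphi^2(t)}<\infty .$$ -/

import Mathlib

open MeasureTheory Set Filter Topology
open scoped SchwartzMap FourierTransform ENNReal ContDiff ComplexConjugate

noncomputable section

namespace HormanderRoitberg

/-- Euclidean space `ℝᵈ`. -/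
abbrev E (d : ℕ) : Type := EuclideanSpace ℝ (Fin d)

/-! ### The class `ℳ` of function parameters -/

/-- `φ ∈ ℳ`: a Borel function `[1,∞) → (0,∞)`, bounded together with `1/φ` on compact intervals,
and slowly varying at infinity. Only the values of `φ` on `[1,∞)` matter. -/
structure ClassM (φ : ℝ → ℝ) : Prop where
  pos : ∀ t, 1 ≤ t → 0 < φ t
  measurable : Measurable fun t : Ici (1 : ℝ) => φ t
  bounded : ∀ b, 1 < b → ∃ C, ∀ t ∈ Icc 1 b, φ t ≤ C ∧ (φ t)⁻¹ ≤ C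
  slowly_varying : ∀ l, 0 < l → Tendsto (fun t => φ (l * t) / φ t) atTop (𝓝 1)

/-! ### Hörmander spaces over `ℝᵈ` and over open subsets -/

/-- `⟨2πξ⟩ = (1 + |2πξ|²)^{1/2}`. Mathlib's Fourier transform has the kernel `exp(-2πi x·ξ)`, so the
frequency of the transform with the kernel `exp(-i x·η)` is `η = 2πξ`. -/
def bracket {d : ℕ} (ξ : E d) : ℝ := Real.sqrt (1 + (2 * Real.pi * ‖ξ‖) ^ 2)

/-- `w` has the Fourier transform `g`, a locally integrable function. -/
def HasFourierDensity {d : ℕ} (w : 𝓢'(E d, ℂ)) (g : E d → ℂ) : Prop :=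
  LocallyIntegrable g volume ∧ ∀ ψ : 𝓢(E d, ℂ), (𝓕 w) ψ = ∫ ξ, ψ ξ * g ξ

/-- The norm of `w` in `H^{s,φ}(ℝᵈ)`; it is `⊤` if `w` does not belong to `H^{s,φ}(ℝᵈ)`.
(The density `g` is unique almost everywhere, so the infimum is over at most one value.) -/
def hNorm {d : ℕ} (s : ℝ) (φ : ℝ → ℝ) (w : 𝓢'(E d, ℂ)) : ℝ≥0∞ :=
  ⨅ (g : E d → ℂ) (_ : HasFourierDensity w g),
    (∫⁻ ξ, ENNReal.ofReal ((bracket ξ ^ s * φ (bracket ξ)) ^ 2) * ‖g ξ‖ₑ ^ 2) ^ (1 / 2 : ℝ)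

/-- `w ∈ H^{s,φ}(ℝᵈ)`. -/
def MemH {d : ℕ} (s : ℝ) (φ : ℝ → ℝ) (w : 𝓢'(E d, ℂ)) : Prop := hNorm s φ w < ⊤

/-- The distribution `w` equals the function `f` in the open set `U`. -/
def AgreesOn {d : ℕ} (U : Set (E d)) (w : 𝓢'(E d, ℂ)) (f : E d → ℂ) : Prop :=
  ∀ ψ : 𝓢(E d, ℂ), tsupport ψ ⊆ U → w ψ = ∫ x in U, ψ x * f x

/-- The norm in `H^{s,φ}(U)` of (the distribution given by) a function `f` on `U`: the infimum of
`‖w‖` over all `w ∈ H^{s,φ}(ℝᵈ)` with `w = f` in `U`; `⊤` if there are none. For `U = ℝᵈ` it is the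
norm of `f` in `H^{s,φ}(ℝᵈ)`. -/
def hNormOn {d : ℕ} (U : Set (E d)) (s : ℝ) (φ : ℝ → ℝ) (f : E d → ℂ) : ℝ≥0∞ :=
  ⨅ (w : 𝓢'(E d, ℂ)) (_ : AgreesOn U w f), hNorm s φ w

/-! ### Smooth bounded domains, their boundaries and normals -/

/-- `ρ` is a smooth function that defines `Ω` as `{ρ > 0}` and `∂Ω` as `{ρ = 0}` near `x`, with
nonzero gradient at `x`. -/
def IsLocalDefiningFunction {n : ℕ} (Ω : Set (E n)) (x : E n) (ρ : E n → ℝ) : Prop :=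
  ContDiff ℝ ∞ ρ ∧ gradient ρ x ≠ 0 ∧
    ∀ᶠ y in 𝓝 x, (y ∈ Ω ↔ 0 < ρ y) ∧ (y ∈ frontier Ω ↔ ρ y = 0)

/-- A bounded domain of `ℝⁿ` with boundary of class `C^∞`. -/
structure SmoothDomain (n : ℕ) where
  carrier : Set (E n)
  isOpen : IsOpen carrier
  isBounded : Bornology.IsBounded carrier
  isConnected : IsConnected carrier
  smooth_boundary : ∀ x ∈ frontier carrier, ∃ ρ : E n → ℝ, IsLocalDefiningFunction carrier x ρ

/-- The boundary `Γ = ∂Ω`. -/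
def SmoothDomain.bdry {n : ℕ} (Ω : SmoothDomain n) : Set (E n) := frontier Ω.carrier

open Classical in
/-- The unit vector of the inward normal to `Γ` at `x ∈ Γ` (and `0` off `Γ`); it does not depend on
the choice of the local defining function. -/
def SmoothDomain.normal {n : ℕ} (Ω : SmoothDomain n) (x : E n) : E n :=
  if h : x ∈ frontier Ω.carrier then
    ‖gradient (Ω.smooth_boundary x h).choose x‖⁻¹ • gradient (Ω.smooth_boundary x h).choose x
  else 0

/-- A finite atlas of `Γ` by local charts `α_j : ℝ^{n-1} ↔ Γ_j`, `Γ_j` open in `Γ`, together with a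
smooth partition of unity `χ_j` on `Γ` subordinate to the covering `Γ_j`. -/
structure BoundaryAtlas {n : ℕ} (Ω : SmoothDomain n) where
  κ : ℕ
  α : Fin κ → E (n - 1) → E n
  smooth_α : ∀ j, ContDiff ℝ ∞ (α j)
  immersion : ∀ j y, Function.Injective (fderiv ℝ (α j) y)
  embedding : ∀ j, IsEmbedding (α j)
  open_range : ∀ j, ∃ U : Set (E n), IsOpen U ∧ range (α j) = Ω.bdry ∩ U
  χ : Fin κ → E n → ℝ
  smooth_χ : ∀ j, ContDiff ℝ ∞ (χ j)
  nonneg_χ : ∀ j, ∀ x ∈ Ω.bdry, 0 ≤ χ j x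
  sum_χ : ∀ x ∈ Ω.bdry, ∑ j, χ j x = 1
  supp_χ : ∀ j, closure (Ω.bdry ∩ Function.support (χ j)) ⊆ range (α j)

variable {n : ℕ} {Ω : SmoothDomain n}

/-- `(χ_j h) ∘ α_j`, the representation in the `j`-th chart of `χ_j h`, for a function `h` on `Γ`. -/
def BoundaryAtlas.localRep (𝒜 : BoundaryAtlas Ω) (j : Fin 𝒜.κ) (h : E n → ℂ) : E (n - 1) → ℂ :=
  fun y => (𝒜.χ j (𝒜.α j y) : ℂ) * h (𝒜.α j y)

/-- The norm of a function `h` on `Γ` in `H^{s,φ}(Γ)`. -/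
def bdryNorm (𝒜 : BoundaryAtlas Ω) (s : ℝ) (φ : ℝ → ℝ) (h : E n → ℂ) : ℝ≥0∞ :=
  (∑ j, hNormOn univ s φ (𝒜.localRep j h) ^ 2) ^ (1 / 2 : ℝ)

/-- `D_ν^k u` on `Γ`, where `D_ν = i ∂/∂ν`. -/
def normalDeriv (Ω : SmoothDomain n) (k : ℕ) (u : E n → ℂ) : E n → ℂ :=
  fun x => Complex.I ^ k * iteratedFDeriv ℝ k u x fun _ => Ω.normal x

/-! ### The modified norms on `C^∞(closure Ω)`

An element of `C^∞(closure Ω)` is the restriction to `closure Ω` of a smooth function on `ℝⁿ`, and is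
represented by such a function; similarly for `C^∞(Γ)`. The norms below depend only on the
restrictions. -/

open Classical in
/-- The norm of `u ∈ C^∞(closure Ω)` in `H^{s,φ,(0)}(Ω)`: the norm in `H^{s,φ}(Ω)` if `s ≥ 0`, and the
negative norm `sup |(u,v)_Ω| / ‖v‖_{H^{-s,1/φ}(Ω)}` over nonzero `v ∈ H^{-s,1/φ}(Ω) ⊆ L₂(Ω)` if
`s < 0`. (If `v` is not in `H^{-s,1/φ}(Ω)`, the quotient is `·/⊤ = 0`; if `v = 0`, it is
`0/0 = 0`.) -/
def zeroNorm (Ω : SmoothDomain n) (s : ℝ) (φ : ℝ → ℝ) (u : E n → ℂ) : ℝ≥0∞ :=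
  if 0 ≤ s then hNormOn Ω.carrier s φ u
  else ⨆ (v : E n → ℂ) (_ : MemLp v 2 (volume.restrict Ω.carrier)),
    ‖∫ x in Ω.carrier, u x * conj (v x)‖ₑ / hNormOn Ω.carrier (-s) (fun t => (φ t)⁻¹) v

/-- The norm in `H^{s,φ,(k)}(Ω)` of `u ∈ C^∞(closure Ω)` for `s ∉ E_k`; the summand with index `j`
is the squared norm of `D_ν^j u` in `H^{s-(j+1)+1/2,φ}(Γ)`, `0 ≤ j < k`. -/
def directNorm (𝒜 : BoundaryAtlas Ω) (s : ℝ) (φ : ℝ → ℝ) (k : ℕ) (u : E n → ℂ) : ℝ≥0∞ :=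
  (zeroNorm Ω s φ u ^ 2 +
    ∑ j ∈ Finset.range k,
      bdryNorm 𝒜 (s - (j + 1) + 1 / 2) φ (normalDeriv Ω j u) ^ 2) ^ (1 / 2 : ℝ)

/-- The exceptional set `E_k = {1/2, 3/2, …, k - 1/2}`. -/
def exceptional (k : ℕ) : Set ℝ := {s | ∃ j : ℕ, 1 ≤ j ∧ j ≤ k ∧ s = j - 1 / 2}

/-- Smooth complex-valued functions on `ℝⁿ`. -/
def smoothFn (n : ℕ) : Submodule ℂ (E n → ℂ) where
  carrier := {u | ContDiff ℝ ∞ u}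
  add_mem' {u v} hu hv := by
    have h1 : ContDiff ℝ ∞ u := hu
    have h2 : ContDiff ℝ ∞ v := hv
    exact h1.add h2
  zero_mem' := (contDiff_const : ContDiff ℝ ∞ fun _ : E n => (0 : ℂ))
  smul_mem' c u hu := by
    have h1 : ContDiff ℝ ∞ u := hu
    exact (contDiff_const : ContDiff ℝ ∞ fun _ : E n => c).mul h1

/-- A Hilbert space completion (unique up to isometry) of the smooth functions with respect to a
Hilbert seminorm `N`. -/
structure HilbertCompletion (N : (E n → ℂ) → ℝ≥0∞) where
  X : Type
  [normedAddCommGroup : NormedAddCommGroup X]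
  [innerProductSpace : InnerProductSpace ℂ X]
  [completeSpace : CompleteSpace X]
  j : smoothFn n →ₗ[ℂ] X
  dense : DenseRange j
  norm_j : ∀ u : smoothFn n, ‖j u‖ₑ = N u

attribute [instance] HilbertCompletion.normedAddCommGroup HilbertCompletion.innerProductSpace
  HilbertCompletion.completeSpace

/-- `R = J⁻¹`, where `J` is the generating operator of the pair of Hilbert spaces `[X₀, X₁]` with the
embedding `ι : X₁ ↪ X₀`: the positive-definite self-adjoint operator in `X₀` with domain `X₁` such
that `‖J w‖_{X₀} = ‖w‖_{X₁}` for all `w ∈ X₁`. (As `J` is positive-definite, it is the inverse of an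
injective positive bounded operator whose range is the domain of `J`; injectivity of `R` follows
from the equality of norms.) -/
def IsInverseGeneratingOperator {X₀ X₁ : Type} [NormedAddCommGroup X₀] [InnerProductSpace ℂ X₀]
    [CompleteSpace X₀] [NormedAddCommGroup X₁] [InnerProductSpace ℂ X₁]
    (ι : X₁ →L[ℂ] X₀) (R : X₀ →L[ℂ] X₀) : Prop :=
  R.IsPositive ∧ range R = range ι ∧ ∀ (f : X₀) (w : X₁), R f = ι w → ‖f‖ = ‖w‖

/-- The norm of a smooth `u` in the interpolation space `[X₀, X₁]_{t^{1/2}}`, where `X₀` and `X₁` are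
the completions of `C^∞(closure Ω)` in the norms `N₀` and `N₁`. It equals `‖J^{1/2} u‖_{X₀}`, that
is, the norm of the `f ∈ X₀` with `Q f = u`, where `Q = J^{-1/2}` is the positive square root of
`J⁻¹`. -/
def halfInterpNorm (N₀ N₁ : (E n → ℂ) → ℝ≥0∞) (u : E n → ℂ) : ℝ≥0∞ :=
  sInf {c | ∃ (X₀ : HilbertCompletion N₀) (X₁ : HilbertCompletion N₁)
      (ι : X₁.X →L[ℂ] X₀.X) (Q : X₀.X →L[ℂ] X₀.X),
    (∀ v, ι (X₁.j v) = X₀.j v) ∧ Q.IsPositive ∧ IsInverseGeneratingOperator ι (Q ∘L Q) ∧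
      ∃ (hu : u ∈ smoothFn n) (f : X₀.X), Q f = X₀.j ⟨u, hu⟩ ∧ c = ‖f‖ₑ}

open Classical in
/-- The norm in `H^{s,φ,(k)}(Ω)` of `u ∈ C^∞(closure Ω)`. -/
def roitbergNorm (𝒜 : BoundaryAtlas Ω) (s : ℝ) (φ : ℝ → ℝ) (k : ℕ) (u : E n → ℂ) : ℝ≥0∞ :=
  if s ∈ exceptional k then
    halfInterpNorm (directNorm 𝒜 (s - 1 / 2) φ k) (directNorm 𝒜 (s + 1 / 2) φ k) u
  else directNorm 𝒜 s φ k u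

/-! ### The spaces `H^{s,φ,(k)}(Ω)` and `H^{-∞,(k)}(Ω)`

`H^{s,φ,(k)}(Ω)` is the completion of `C^∞(closure Ω)` in the norm above. An element of a completion is
given by a Cauchy sequence `u = (u_m)` in `C^∞(closure Ω)`; the union `H^{-∞,(k)}(Ω)` consists of the
sequences that are Cauchy in one of the norms, two sequences giving the same element if their
difference tends to zero in one of the norms (this is the inductive limit along the embeddings of
the scale). Operators that are extended by continuity from `C^∞(closure Ω)`, such as multiplication by
a smooth function and differential operators, act on sequences term by term. -/

/-- `u` is a Cauchy sequence of elements of `C^∞(closure Ω)` in the norm of `H^{s,φ,(k)}(Ω)`. -/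
def IsRoitbergCauchy (𝒜 : BoundaryAtlas Ω) (s : ℝ) (φ : ℝ → ℝ) (k : ℕ) (u : ℕ → E n → ℂ) : Prop :=
  (∀ m, ContDiff ℝ ∞ (u m)) ∧
    ∀ ε : ℝ≥0∞, 0 < ε → ∃ M, ∀ m l, M ≤ m → M ≤ l → roitbergNorm 𝒜 s φ k (u m - u l) < ε

/-- `u ∈ H^{-∞,(k)}(Ω)`. -/
def MemNegInfty (𝒜 : BoundaryAtlas Ω) (k : ℕ) (u : ℕ → E n → ℂ) : Prop :=
  ∃ s φ, ClassM φ ∧ IsRoitbergCauchy 𝒜 s φ k u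

/-- The sequences `u` and `v` give the same element of `H^{-∞,(k)}(Ω)`. -/
def SameElement (𝒜 : BoundaryAtlas Ω) (k : ℕ) (u v : ℕ → E n → ℂ) : Prop :=
  ∃ s φ, ClassM φ ∧ Tendsto (fun m => roitbergNorm 𝒜 s φ k (u m - v m)) atTop (𝓝 0)

/-- The element of `H^{-∞,(k)}(Ω)` given by `u` belongs to `H^{s,φ,(k)}(Ω)`. -/
def MemRoitberg (𝒜 : BoundaryAtlas Ω) (s : ℝ) (φ : ℝ → ℝ) (k : ℕ) (u : ℕ → E n → ℂ) : Prop :=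
  ∃ v, IsRoitbergCauchy 𝒜 s φ k v ∧ SameElement 𝒜 k u v

/-- The element of `H^{-∞,(k)}(Ω)` given by `u` belongs to `H^{k-1/2+}(Ω)`, the union of
`H^{s,φ,(k)}(Ω)` over `s > k - 1/2`, `φ ∈ ℳ`. -/
def MemRoitbergPlus (𝒜 : BoundaryAtlas Ω) (k : ℕ) (u : ℕ → E n → ℂ) : Prop :=
  ∃ s φ, (k : ℝ) - 1 / 2 < s ∧ ClassM φ ∧ MemRoitberg 𝒜 s φ k u

/-- The distribution on `Γ` that is the limit of the sequence `h` in `C^∞(Γ)` belongs to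
`H^{s,φ}(Γ)`: its representation `lim (χ_j h_m) ∘ α_j` in each chart belongs to
`H^{s,φ}(ℝ^{n-1})`. -/
def MemBdry (𝒜 : BoundaryAtlas Ω) (s : ℝ) (φ : ℝ → ℝ) (h : ℕ → E n → ℂ) : Prop :=
  ∀ j, ∃ w : 𝓢'(E (n - 1), ℂ), MemH s φ w ∧
    ∀ ψ : 𝓢(E (n - 1), ℂ),
      Tendsto (fun m => ∫ y, ψ y * 𝒜.localRep j (h m) y) atTop (𝓝 (w ψ))

/-! ### Local spaces -/

/-- `χ ∈ C^∞(closure Ω)` with support in `Ω₀ ∪ Γ₀`, where `Ω₀ = Ω ∩ V`, `Γ₀ = Γ ∩ V`. -/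
def IsCutoff (Ω : SmoothDomain n) (V : Set (E n)) (χ : E n → ℂ) : Prop :=
  ContDiff ℝ ∞ χ ∧
    closure (closure Ω.carrier ∩ Function.support χ) ⊆ (Ω.carrier ∩ V) ∪ (Ω.bdry ∩ V)

/-- `χ ∈ C^∞(Γ)` with support in `Γ₀ = Γ ∩ V`. -/
def IsBdryCutoff (Ω : SmoothDomain n) (V : Set (E n)) (χ : E n → ℂ) : Prop :=
  ContDiff ℝ ∞ χ ∧ closure (Ω.bdry ∩ Function.support χ) ⊆ Ω.bdry ∩ V

/-- The product `χ u`. -/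
def cutoffMul (χ : E n → ℂ) (u : ℕ → E n → ℂ) : ℕ → E n → ℂ := fun m x => χ x * u m x

/-- `u ∈ H^{s,φ,(k)}_loc(Ω₀, Γ₀)`. -/
def MemRoitbergLoc (𝒜 : BoundaryAtlas Ω) (V : Set (E n)) (s : ℝ) (φ : ℝ → ℝ) (k : ℕ)
    (u : ℕ → E n → ℂ) : Prop :=
  ∀ χ, IsCutoff Ω V χ → MemRoitberg 𝒜 s φ k (cutoffMul χ u)

/-- `h ∈ H^{s,φ}_loc(Γ₀)`. -/
def MemBdryLoc (𝒜 : BoundaryAtlas Ω) (V : Set (E n)) (s : ℝ) (φ : ℝ → ℝ)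
    (h : ℕ → E n → ℂ) : Prop :=
  ∀ χ, IsBdryCutoff Ω V χ → MemBdry 𝒜 s φ (cutoffMul χ h)

/-! ### Classical smoothness -/

/-- The function `f` on `Ω` belongs to `C^p(closure Ω)`: `f ∈ C^p(Ω)` and its derivatives up to
order `p` extend continuously to `closure Ω`. -/
def IsCpClosure (Ω : SmoothDomain n) (p : ℕ) (f : E n → ℂ) : Prop :=
  ContDiffOn ℝ p f Ω.carrier ∧
    ∀ k ≤ p, ∃ g : E n → ContinuousMultilinearMap ℝ (fun _ : Fin k => E n) ℂ,
      ContinuousOn g (closure Ω.carrier) ∧ EqOn g (iteratedFDeriv ℝ k f) Ω.carrier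

/-- In `𝓓'(Ω)`, the distribution that is the limit of the sequence `u` is the function `f`. -/
def IsDistribLimit (Ω : SmoothDomain n) (u : ℕ → E n → ℂ) (f : E n → ℂ) : Prop :=
  ∀ ψ : 𝓢(E n, ℂ), tsupport ψ ⊆ Ω.carrier →
    Tendsto (fun m => ∫ x in Ω.carrier, ψ x * u m x) atTop (𝓝 (∫ x in Ω.carrier, ψ x * f x))

open Classical in
/-- `u ∈ C^p(Ω₀ ∪ Γ₀)` for `u ∈ H^{-∞,(r)}(Ω)`. If `Γ₀ ≠ ∅`, this means that
`χu ∈ H^{r-1/2+}(Ω) ∩ C^p(closure Ω)` for all cut-off functions `χ` with support in `Ω₀ ∪ Γ₀`; if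
`Γ₀ = ∅`, that the initial component `(χu)₀ ∈ H^{-∞,(0)}(Ω)` of `χu` is in `H^{-1/2+}(Ω) ∩ C^p(Ω)`
for all `χ` with support in `Ω₀`. -/
def MemCp (𝒜 : BoundaryAtlas Ω) (V : Set (E n)) (r p : ℕ) (u : ℕ → E n → ℂ) : Prop :=
  if (Ω.bdry ∩ V).Nonempty then
    ∀ χ, IsCutoff Ω V χ → MemRoitbergPlus 𝒜 r (cutoffMul χ u) ∧
      ∃ f, IsCpClosure Ω p f ∧ IsDistribLimit Ω (cutoffMul χ u) f
  else
    ∀ χ, IsCutoff Ω V χ → MemRoitbergPlus 𝒜 0 (cutoffMul χ u) ∧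
      ∃ f, ContDiffOn ℝ p f Ω.carrier ∧ IsDistribLimit Ω (cutoffMul χ u) f

/-! ### Differential operators and elliptic boundary-value problems -/

/-- `∂u/∂x_k`. -/
def partialDeriv (k : Fin n) (u : E n → ℂ) : E n → ℂ :=
  fun x => fderiv ℝ u x (EuclideanSpace.single k 1)

/-- `D^μ u = D_1^{μ_1} ⋯ D_n^{μ_n} u`, where `D_k = i ∂/∂x_k`. -/
def multiD (μ : Fin n → ℕ) (u : E n → ℂ) : E n → ℂ :=
  (List.finRange n).foldr (fun k v => (fun f x => Complex.I * partialDeriv k f x)^[μ k] v) u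

/-- `∑_{|μ| ≤ d} c_μ(x) D^μ u`. -/
def diffOp (d : ℕ) (c : (Fin n → ℕ) → E n → ℂ) (u : E n → ℂ) : E n → ℂ :=
  fun x => ∑ l ∈ Finset.range (d + 1), ∑ μ ∈ Finset.piAntidiag Finset.univ l, c μ x * multiD μ u x

/-- The principal symbol `∑_{|μ| = d} c_μ(x) (ξ + τη)^μ` as a polynomial in `τ`. -/
def symbolPoly (d : ℕ) (c : (Fin n → ℕ) → E n → ℂ) (x ξ η : E n) : Polynomial ℂ :=
  ∑ μ ∈ Finset.piAntidiag Finset.univ d, Polynomial.C (c μ x) *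
    ∏ k, (Polynomial.C (ξ k : ℂ) + Polynomial.C (η k : ℂ) * Polynomial.X) ^ μ k

open Classical in
/-- The roots (with multiplicities) with positive imaginary part. -/
def upperRoots (P : Polynomial ℂ) : Multiset ℂ := P.roots.filter fun z => 0 < z.im

open Classical in
/-- The roots (with multiplicities) with negative imaginary part. -/
def lowerRoots (P : Polynomial ℂ) : Multiset ℂ := P.roots.filter fun z => z.im < 0

/-- The data of a boundary-value problem `Au = f` in `Ω`, `B_j u = g_j` on `Γ`, `j = 1, …, q`, with
`A` of order `2q` and `B_j` of order `m_j`; the coefficients of `A` are in `C^∞(closure Ω)`, and those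
of `B_j` are in `C^∞(Γ)`. -/
structure BoundaryProblem (n q : ℕ) where
  a : (Fin n → ℕ) → E n → ℂ
  smooth_a : ∀ μ, ContDiff ℝ ∞ (a μ)
  ord : Fin q → ℕ
  b : Fin q → (Fin n → ℕ) → E n → ℂ
  smooth_b : ∀ j μ, ContDiff ℝ ∞ (b j μ)

namespace BoundaryProblem

variable {q : ℕ} (P : BoundaryProblem n q)

/-- The operator `A`. -/
def opA (u : E n → ℂ) : E n → ℂ := diffOp (2 * q) P.a u

/-- The boundary operator `B_j`. -/
def opB (j : Fin q) (u : E n → ℂ) : E n → ℂ := diffOp (P.ord j) (P.b j) u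

/-- `m = max {m_1, …, m_q}`. -/
def m : ℕ := Finset.univ.sup P.ord

/-- `r = m + 1`. -/
def r : ℕ := P.m + 1

/-- `A` is properly elliptic on `closure Ω`: it is elliptic, and for all linearly independent real
vectors `ξ`, `η` the principal symbol at `ξ + τη` has `q` roots `τ` with positive and `q` roots with
negative imaginary part. -/
def ProperlyElliptic (Ω : SmoothDomain n) : Prop :=
  ∀ x ∈ closure Ω.carrier,
    (∀ ξ : E n, ξ ≠ 0 → (symbolPoly (2 * q) P.a x ξ 0).eval 0 ≠ 0) ∧
    ∀ ξ η : E n, LinearIndependent ℝ ![ξ, η] →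
      (upperRoots (symbolPoly (2 * q) P.a x ξ η)).card = q ∧
      (lowerRoots (symbolPoly (2 * q) P.a x ξ η)).card = q

/-- The Lopatinskii condition: for every `x ∈ Γ` and every nonzero `ξ` tangent to `Γ` at `x`, the
principal symbols of `B_1, …, B_q` at `ξ + τν(x)` are linearly independent, as polynomials in `τ`,
modulo `∏ (τ - τ_j⁺)`, where `τ_j⁺` are the roots with positive imaginary part of the principal
symbol of `A` at `ξ + τν(x)`. -/
def Lopatinskii (Ω : SmoothDomain n) : Prop :=
  ∀ x ∈ Ω.bdry, ∀ ξ : E n, ξ ≠ 0 → inner ℝ ξ (Ω.normal x) = 0 →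
    ∀ c : Fin q → ℂ,
      ((upperRoots (symbolPoly (2 * q) P.a x ξ (Ω.normal x))).map
          fun z => Polynomial.X - Polynomial.C z).prod ∣
        ∑ j, Polynomial.C (c j) * symbolPoly (P.ord j) (P.b j) x ξ (Ω.normal x) →
      c = 0

/-- The boundary-value problem is elliptic in `Ω`. -/
def IsElliptic (Ω : SmoothDomain n) : Prop := P.ProperlyElliptic Ω ∧ P.Lopatinskii Ω

/-- `(A,B)u ∈ 𝓗^{s-2q,φ,(r-2q)}_loc(Ω₀, Γ₀)`. -/
def MemDataLoc (𝒜 : BoundaryAtlas Ω) (V : Set (E n)) (s : ℝ) (φ : ℝ → ℝ)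
    (u : ℕ → E n → ℂ) : Prop :=
  MemRoitbergLoc 𝒜 V (s - 2 * q) φ (P.r - 2 * q) (fun l => P.opA (u l)) ∧
    ∀ j, MemBdryLoc 𝒜 V (s - P.ord j - 1 / 2) φ (fun l => P.opB j (u l))

end BoundaryProblem

end HormanderRoitberg

end

open HormanderRoitberg

open MeasureTheory Set Filter Topology
open scoped SchwartzMap FourierTransform ENNReal ContDiff ComplexConjugate

noncomputable section

namespace HormanderRoitberg

/-! ### Functions of slow variation -/

/-! The regularity implication is tested only on functions supported well inside Ω₀, where boundary
traces and boundary data vanish. Put s = p + n/2, let w(ξ) = ⟨2πξ⟩^s φ(⟨2πξ⟩), and choose a ball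
whose closure lies in Ω₀, with a cut-off η supported in Ω₀ and equal to 1 on the ball. Any element G
of H^{s,φ}(ℝⁿ) is a limit of Schwartz functions f_m. The sequence η f_m is then Cauchy in
H^{s,φ,(r)}(Ω), A(η f_m) has interior data of order s - 2q, and all boundary data are zero. The
implication therefore makes η G, hence G, a C^p function in the ball (`memDataLoc_mul`,
`exists_contDiffOn_pairing`).

So every element of H^{s,φ}(ℝⁿ) is C^p in one fixed ball. This inclusion is made quantitative by
Banach–Steinhaus (`lintegral_inner_pow_lt_top`). Let ρ_k approximate the delta function at the
centre of the ball. The functionals G ↦ ⟨G, ∂_e^p ρ_k⟩ are bounded in k for each G, because p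
integrations by parts put the derivatives on a C^p function. Hence their norms are bounded in k. By
duality these norms are the L₂ norms of |2πξ·e|^p |𝓕⁻ρ_k| / w, and Fatou's lemma yields ∫ |ξ·e|^{2p}
w^{-2} dξ < ∞. Summing over coordinate directions gives ∫ |ξ|^{2p} w^{-2} dξ < ∞. In polar
coordinates, with t = ⟨2πξ⟩, this is comparable at infinity with ∫ dt/(t φ²(t)); the remaining
bounded range is harmless, since 1/φ is bounded on compact intervals
(`integrableOn_of_lintegral_norm_pow_lt_top`).

Two analytic facts support the reduction. First, slow variation makes the weight temperate
(`weight_temperate`), so that multiplication by test functions and cut-off differential operators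
act in the scale H^{s,φ}(ℝⁿ) (`hasOrder_mul`, `exists_hasOrder_diffOp`).

Second, multiplication by a test function of Ω must be bounded from H^{s,φ}(ℝⁿ) into H^{s,φ,(k)}(Ω)
(`exists_roitbergNorm_mul_le`). For s outside E_k this is direct: the Schwartz function is its own
extension, or duality is used when s < 0. For s in E_k the norm comes from Hilbert interpolation.
There the two neighbouring spaces are realized as concrete Hilbert spaces, by orthogonal projections
on the frequency side, and the bound follows from an operator interpolation inequality with
parameter 1/2 derived from Reid's inequality (`norm_sqrt_apply_sq_le`). -/

/-- A measurable function on `ℝ` whose increments tend to zero at infinity has increments that are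
bounded near infinity, uniformly for steps in `[0,1]`. -/
theorem eventually_abs_increment_le {h : ℝ → ℝ} (hm : Measurable h)
    (hh : ∀ u, Tendsto (fun x => h (x + u) - h x) atTop (𝓝 0)) :
    ∃ X : ℝ, ∀ x, X ≤ x → ∀ u ∈ Icc (0 : ℝ) 1, |h (x + u) - h x| ≤ 2 := by
  -- Otherwise there are x_n → ∞ and u_n ∈ [0,1] with increment above 2. Pointwise convergence
  -- implies convergence in measure on [0,3], from the base points x_n and from x_n + u_n. For large
  -- n the two bad sets, the second shifted by u_n, have total measure below 1 and cannot cover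
  -- [1,3]. A point x_n + l outside both is within 1 of both values of h, which contradicts the
  -- increment.
  by_contra! hcon
  choose x hx u hu hxu using fun n : ℕ => hcon n
  have hxt : Tendsto x atTop atTop := tendsto_atTop_mono hx tendsto_natCast_atTop_atTop
  have hyt : Tendsto (fun n => x n + u n) atTop atTop :=
    tendsto_atTop_mono (fun n => by have := (hu n).1; linarith) hxt
  have key : ∀ y : ℕ → ℝ, Tendsto y atTop atTop →
      ∀ᶠ n in atTop, volume.restrict (Icc (0 : ℝ) 3) {l | 1 ≤ |h (y n + l) - h (y n)|} < 1 / 2 := by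
    intro y hy
    have h1 : TendstoInMeasure (volume.restrict (Icc (0 : ℝ) 3))
        (fun n l => h (y n + l) - h (y n)) atTop (fun _ => (0 : ℝ)) := by
      refine tendstoInMeasure_of_tendsto_ae (fun n => ?_) ?_
      · exact ((hm.comp (measurable_const_add _)).sub_const _).aestronglyMeasurable
      · exact Eventually.of_forall fun l => (hh l).comp hy
    have h2 := h1 1 one_pos
    have h3 := h2.eventually (gt_mem_nhds (show (0 : ℝ≥0∞) < 1 / 2 by simp))
    filter_upwards [h3] with n hn
    refine lt_of_le_of_lt (measure_mono fun l hl => ?_) hn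
    simpa [edist_dist, Real.dist_eq] using hl
  obtain ⟨n, hA, hB⟩ := ((key x hxt).and (key _ hyt)).exists
  set A : Set ℝ := {l | 1 ≤ |h (x n + l) - h (x n)|} with hAdef
  set B : Set ℝ := {l | 1 ≤ |h (x n + u n + l) - h (x n + u n)|} with hBdef
  have hAm : MeasurableSet A :=
    measurableSet_le measurable_const ((hm.comp (measurable_const_add _)).sub_const _).abs
  have hBm : MeasurableSet B :=
    measurableSet_le measurable_const ((hm.comp (measurable_const_add _)).sub_const _).abs
  rw [Measure.restrict_apply hAm] at hA
  rw [Measure.restrict_apply hBm] at hB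
  have hB' : volume ((fun l => l + -u n) ⁻¹' (B ∩ Icc 0 3)) < 1 / 2 := by
    rwa [measure_preimage_add_right]
  have hlt : volume ((A ∩ Icc 0 3) ∪ ((fun l => l + -u n) ⁻¹' (B ∩ Icc 0 3)))
      < volume (Icc (1 : ℝ) 3) := by
    refine lt_of_le_of_lt (measure_union_le _ _) (lt_of_lt_of_le (ENNReal.add_lt_add hA hB') ?_)
    rw [Real.volume_Icc, ENNReal.add_halves]
    norm_num
  obtain ⟨l, hl, hl'⟩ : ∃ l ∈ Icc (1 : ℝ) 3,
      l ∉ (A ∩ Icc 0 3) ∪ ((fun l => l + -u n) ⁻¹' (B ∩ Icc 0 3)) := by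
    by_contra! hsub
    exact absurd (measure_mono hsub) (not_le.2 hlt)
  have hun := hu n
  have h1 : |h (x n + l) - h (x n)| < 1 := by
    by_contra! hc
    exact hl' (Or.inl ⟨hc, by constructor <;> linarith [hl.1, hl.2]⟩)
  have h2 : |h (x n + l) - h (x n + u n)| < 1 := by
    by_contra! hc
    refine hl' (Or.inr ⟨?_, by constructor <;> linarith [hl.1, hl.2, hun.1, hun.2]⟩)
    have : x n + u n + (l + -u n) = x n + l := by ring
    rw [hBdef, mem_ofPred_eq, this]
    exact hc
  have h3 := hxu n
  rw [abs_lt] at h1 h2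
  rw [lt_abs] at h3
  rcases h3 with h3 | h3 <;> linarith

/-- Cut [x, y] into unit steps and a remainder. Each unit step costs at most 2 and the remainder at
most 2; the induction is on a bound N for the number of steps. -/
theorem abs_sub_le_of_increment_le {h : ℝ → ℝ} {X : ℝ}
    (hX : ∀ x, X ≤ x → ∀ u ∈ Icc (0 : ℝ) 1, |h (x + u) - h x| ≤ 2) :
    ∀ x y, X ≤ x → x ≤ y → |h y - h x| ≤ 2 * (y - x) + 2 := by
  have key : ∀ N : ℕ, ∀ x y, X ≤ x → x ≤ y → y ≤ x + N → |h y - h x| ≤ 2 * (y - x) + 2 := by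
    intro N
    induction N with
    | zero =>
      intro x y _ hxy hyx
      have : y = x := by simp at hyx; linarith
      subst this
      simp
    | succ N ih =>
      intro x y hx hxy hyx
      push_cast at hyx
      rcases le_or_gt y (x + 1) with h1 | h1
      · have := hX x hx (y - x) ⟨by linarith, by linarith⟩
        rw [add_sub_cancel] at this
        linarith
      · have h2 := ih (x + 1) y (by linarith) h1.le (by linarith)
        have h3 := hX x hx 1 (by simp)
        rw [abs_le] at *
        constructor <;> linarith [h2.1, h2.2, h3.1, h3.2]
  intro x y hx hxy
  obtain ⟨N, hN⟩ := exists_nat_ge (y - x)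
  exact key N x y hx hxy (by linarith)

/-- The logarithm of `φ ∈ ℳ` in the logarithmic variable is a quasi-Lipschitz function. -/
theorem ClassM.abs_log_sub_log_le {φ : ℝ → ℝ} (hφ : ClassM φ) :
    ∃ C, 0 ≤ C ∧ ∀ x y : ℝ, 0 ≤ x → 0 ≤ y →
      |Real.log (φ (Real.exp x)) - Real.log (φ (Real.exp y))| ≤ C + 2 * |x - y| := by
  have hexp : ∀ x : ℝ, 0 ≤ x → 1 ≤ Real.exp x := fun x hx => Real.one_le_exp hx
  -- The truncation at 0 keeps the argument of φ in [1,∞), the only place where φ is known to be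
  -- measurable, and gives a measurable function on the whole line.
  set h : ℝ → ℝ := fun x => Real.log (φ (Real.exp (max x 0))) with hdef
  have hm : Measurable h := by
    have h1 : Measurable fun x : ℝ =>
        (⟨Real.exp (max x 0), hexp _ (le_max_right _ _)⟩ : Ici (1 : ℝ)) :=
      Measurable.subtype_mk (by fun_prop)
    exact Real.measurable_log.comp (hφ.measurable.comp h1)
  have hh : ∀ u, Tendsto (fun x => h (x + u) - h x) atTop (𝓝 0) := by
    intro u
    have h1 := ((hφ.slowly_varying (Real.exp u) (Real.exp_pos u)).comp
      Real.tendsto_exp_atTop).log one_ne_zero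
    rw [Real.log_one] at h1
    refine h1.congr' ?_
    filter_upwards [eventually_ge_atTop 0, eventually_ge_atTop (-u)] with x hx hxu
    have h2 : 0 ≤ x + u := by linarith
    simp only [hdef, Function.comp, max_eq_left hx, max_eq_left h2, ← Real.exp_add]
    rw [add_comm u x, Real.log_div (hφ.pos _ (hexp _ h2)).ne' (hφ.pos _ (hexp _ hx)).ne']
  obtain ⟨X, hX⟩ := eventually_abs_increment_le hm hh
  have hX' := abs_sub_le_of_increment_le (X := max X 0)
    (fun x hx => hX x ((le_max_left _ _).trans hx))
  set X' := max X 0 with hX'def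
  have hX0 : 0 ≤ X' := le_max_right _ _
  obtain ⟨K, hK⟩ := hφ.bounded (Real.exp (X' + 1)) (by
    rw [Real.one_lt_exp_iff]; linarith)
  have hKb : ∀ x, 0 ≤ x → x ≤ X' → |h x| ≤ |Real.log K| := by
    intro x hx hxX
    have hp := hφ.pos _ (hexp x hx)
    have h1 := hK (Real.exp x) ⟨hexp x hx, Real.exp_le_exp.2 (by linarith)⟩
    have h2 : h x = Real.log (φ (Real.exp x)) := by simp [hdef, max_eq_left hx]
    have h3 := Real.log_le_log hp h1.1
    have h4 := Real.log_le_log (inv_pos.2 hp) h1.2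
    rw [Real.log_inv] at h4
    rw [h2, abs_le]
    constructor <;> linarith [le_abs_self (Real.log K), neg_abs_le (Real.log K)]
  -- Moving a point of [0, X'] to X' costs at most 2|log K|, by boundedness on compact intervals.
  -- Doing this at both ends reduces the estimate to [X', ∞) and produces the constant 4|log K| + 2.
  have hmax : ∀ x, 0 ≤ x → |h x - h (max x X')| ≤ 2 * |Real.log K| := by
    intro x hx
    rcases le_total x X' with h1 | h1
    · rw [max_eq_right h1]
      have h2 := hKb x hx h1
      have h3 := hKb X' hX0 le_rfl
      have := abs_sub (h x) (h X')
      linarith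
    · rw [max_eq_left h1]; simp
  have hfin : ∀ x y : ℝ, 0 ≤ x → x ≤ y → |h x - h y| ≤ (4 * |Real.log K| + 2) + 2 * |x - y| := by
    intro x y hx hxy
    have h1 := hmax x hx
    have h2 := hmax y (hx.trans hxy)
    have h3 := hX' (max x X') (max y X') (le_max_right _ _) (max_le_max_right _ hxy)
    have h4 : max y X' - max x X' ≤ y - x := by
      rcases le_total y X' with a | a <;> rcases le_total x X' with b | b <;>
        simp only [max_eq_left, max_eq_right, a, b] <;> linarith
    have h5 : |x - y| = y - x := by rw [abs_sub_comm]; exact abs_of_nonneg (by linarith)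
    rw [abs_le] at h1 h2 h3
    rw [h5, abs_le]
    constructor <;> linarith [h1.1, h1.2, h2.1, h2.2, h3.1, h3.2]
  have heq : ∀ x, 0 ≤ x → Real.log (φ (Real.exp x)) = h x := fun x hx => by
    simp [hdef, max_eq_left hx]
  refine ⟨4 * |Real.log K| + 2, by positivity, fun x y hx hy => ?_⟩
  rw [heq x hx, heq y hy]
  rcases le_total x y with hxy | hxy
  · exact hfin x y hx hxy
  · rw [abs_sub_comm, abs_sub_comm x y]
    exact hfin y x hy hxy

/-! ### The weights -/

section Weight

variable {d : ℕ}

theorem one_le_bracket (ξ : E d) : 1 ≤ bracket ξ := by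
  rw [bracket, Real.one_le_sqrt]
  nlinarith [sq_nonneg (2 * Real.pi * ‖ξ‖)]

theorem bracket_pos (ξ : E d) : 0 < bracket ξ := zero_lt_one.trans_le (one_le_bracket ξ)

theorem continuous_bracket : Continuous (bracket : E d → ℝ) := by
  unfold bracket
  fun_prop

/-- Peetre's inequality. With a = 2π|ζ| ≤ b = ⟨2πζ⟩ and c = 2π|ξ - ζ|, one has 1 + (a + c)² = b² +
2ac + c² ≤ b²(1 + c)², because b ≥ 1. -/
theorem bracket_le_mul (ξ ζ : E d) :
    bracket ξ ≤ bracket ζ * (1 + 2 * Real.pi * ‖ξ - ζ‖) := by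
  have h1 : ‖ξ‖ ≤ ‖ζ‖ + ‖ξ - ζ‖ := by
    simpa using norm_add_le ζ (ξ - ζ)
  have hb := one_le_bracket ζ
  have hbs : bracket ζ ^ 2 = 1 + (2 * Real.pi * ‖ζ‖) ^ 2 := by
    rw [bracket, Real.sq_sqrt (by positivity)]
  have h2 : 2 * Real.pi * ‖ζ‖ ≤ bracket ζ := by
    refine le_of_sq_le_sq ?_ (by positivity)
    rw [hbs]; linarith
  set c := 2 * Real.pi * ‖ξ - ζ‖ with hc
  have hc0 : 0 ≤ c := by positivity
  have hx : 2 * Real.pi * ‖ξ‖ ≤ 2 * Real.pi * ‖ζ‖ + c := by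
    rw [hc, ← mul_add]
    exact mul_le_mul_of_nonneg_left h1 (by positivity)
  have hx0 : 0 ≤ 2 * Real.pi * ‖ξ‖ := by positivity
  rw [bracket]
  refine Real.sqrt_le_iff.2 ⟨by positivity, ?_⟩
  have h3 : (2 * Real.pi * ‖ξ‖) ^ 2 ≤ (2 * Real.pi * ‖ζ‖ + c) ^ 2 := pow_le_pow_left₀ hx0 hx 2
  have h4 : (2 * Real.pi * ‖ζ‖) * c ≤ bracket ζ * bracket ζ * c := by
    refine mul_le_mul_of_nonneg_right (h2.trans ?_) hc0
    nlinarith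
  have h5 : 1 * c ^ 2 ≤ bracket ζ ^ 2 * c ^ 2 :=
    mul_le_mul_of_nonneg_right (by nlinarith) (sq_nonneg _)
  nlinarith

/-- The weight `⟨2πξ⟩^s φ(⟨2πξ⟩)` of the space `H^{s,φ}(ℝᵈ)`. -/
def weight (s : ℝ) (φ : ℝ → ℝ) (ξ : E d) : ℝ := bracket ξ ^ s * φ (bracket ξ)

variable {φ : ℝ → ℝ}

theorem ClassM.inv (hφ : ClassM φ) : ClassM fun t => (φ t)⁻¹ where
  pos t ht := inv_pos.2 (hφ.pos t ht)
  measurable := hφ.measurable.inv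
  bounded b hb := by
    obtain ⟨C, hC⟩ := hφ.bounded b hb
    exact ⟨C, fun t ht => ⟨(hC t ht).2, by simpa using (hC t ht).1⟩⟩
  slowly_varying l hl := by
    have h1 := (hφ.slowly_varying l hl).inv₀ one_ne_zero
    rw [inv_one] at h1
    refine h1.congr fun t => ?_
    rw [inv_div, inv_div_inv]

theorem weight_pos (hφ : ClassM φ) (s : ℝ) (ξ : E d) : 0 < weight s φ ξ :=
  mul_pos (Real.rpow_pos_of_pos (bracket_pos ξ) s) (hφ.pos _ (one_le_bracket ξ))

theorem weight_neg_inv (s : ℝ) (φ : ℝ → ℝ) (ξ : E d) :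
    weight (-s) (fun t => (φ t)⁻¹) ξ = (weight s φ ξ)⁻¹ := by
  rw [weight, weight, mul_inv, Real.rpow_neg (bracket_pos ξ).le]

theorem weight_add (s t : ℝ) (φ : ℝ → ℝ) (ξ : E d) :
    weight (s + t) φ ξ = bracket ξ ^ t * weight s φ ξ := by
  rw [weight, weight, Real.rpow_add (bracket_pos ξ)]
  ring

theorem weight_mono (hφ : ClassM φ) {s t : ℝ} (hst : s ≤ t) (ξ : E d) :
    weight s φ ξ ≤ weight t φ ξ :=
  mul_le_mul_of_nonneg_right (Real.rpow_le_rpow_of_exponent_le (one_le_bracket ξ) hst)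
    (hφ.pos _ (one_le_bracket ξ)).le

theorem measurable_weight (hφ : ClassM φ) (s : ℝ) : Measurable (weight s φ : E d → ℝ) := by
  have h1 : Measurable fun ξ : E d => (⟨bracket ξ, one_le_bracket ξ⟩ : Ici (1 : ℝ)) :=
    continuous_bracket.measurable.subtype_mk
  exact (continuous_bracket.measurable.pow_const s).mul (hφ.measurable.comp h1)

/-- The weight is temperate. -/
theorem weight_temperate (hφ : ClassM φ) (s : ℝ) :
    ∃ C : ℝ, ∃ N : ℕ, 0 < C ∧ ∀ ξ ζ : E d,
      weight s φ ξ ≤ C * (1 + ‖ξ - ζ‖) ^ N * weight s φ ζ := by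
  obtain ⟨C, hC0, hC⟩ := hφ.abs_log_sub_log_le
  -- The summand |s| pays for the power of the bracket. The summand 2 is the slope of log φ in the
  -- logarithmic variable, and Peetre's inequality bounds the logarithmic distance of the brackets
  -- by log ρ.
  obtain ⟨N, hN⟩ := exists_nat_ge (|s| + 2)
  have hπ : (1 : ℝ) ≤ 1 + 2 * Real.pi := by linarith [Real.pi_pos]
  refine ⟨Real.exp C * (1 + 2 * Real.pi) ^ N, N, by positivity, fun ξ ζ => ?_⟩
  set ρ := 1 + 2 * Real.pi * ‖ξ - ζ‖ with hρ
  have hρ1 : 1 ≤ ρ := by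
    have : 0 ≤ 2 * Real.pi * ‖ξ - ζ‖ := by positivity
    linarith
  have hb := one_le_bracket ξ
  have hb' := one_le_bracket ζ
  have hlog : |Real.log (bracket ξ) - Real.log (bracket ζ)| ≤ Real.log ρ := by
    have h1 := Real.log_le_log (bracket_pos ξ) (bracket_le_mul ξ ζ)
    have h2 := Real.log_le_log (bracket_pos ζ) (bracket_le_mul ζ ξ)
    rw [norm_sub_rev ζ ξ] at h2
    rw [← hρ, Real.log_mul (bracket_pos _).ne' (by linarith)] at h1 h2
    rw [abs_le]
    constructor <;> linarith
  have hφl := hC _ _ (Real.log_nonneg hb) (Real.log_nonneg hb')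
  rw [Real.exp_log (bracket_pos ξ), Real.exp_log (bracket_pos ζ)] at hφl
  have hlw : ∀ η : E d, Real.log (weight s φ η) =
      s * Real.log (bracket η) + Real.log (φ (bracket η)) := fun η => by
    rw [weight, Real.log_mul (Real.rpow_pos_of_pos (bracket_pos η) s).ne'
      (hφ.pos _ (one_le_bracket η)).ne', Real.log_rpow (bracket_pos η)]
  have hlogw : Real.log (weight s φ ξ) ≤ C + N * Real.log ρ + Real.log (weight s φ ζ) := by
    rw [hlw, hlw]
    have h3 : s * (Real.log (bracket ξ) - Real.log (bracket ζ)) ≤ |s| * Real.log ρ := by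
      refine (le_abs_self _).trans ?_
      rw [abs_mul]
      exact mul_le_mul_of_nonneg_left hlog (abs_nonneg s)
    have h4 := (le_abs_self _).trans hφl
    have h5 : (|s| + 2) * Real.log ρ ≤ N * Real.log ρ :=
      mul_le_mul_of_nonneg_right hN (Real.log_nonneg hρ1)
    nlinarith
  have h6 := Real.exp_le_exp.2 hlogw
  rw [Real.exp_log (weight_pos hφ s ξ), Real.exp_add, Real.exp_add,
    Real.exp_log (weight_pos hφ s ζ), Real.exp_nat_mul, Real.exp_log (by linarith)] at h6
  refine h6.trans (mul_le_mul_of_nonneg_right ?_ (weight_pos hφ s ζ).le)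
  rw [mul_assoc, ← mul_pow]
  refine mul_le_mul_of_nonneg_left (pow_le_pow_left₀ (by linarith) ?_ _) (Real.exp_pos _).le
  have : 0 ≤ ‖ξ - ζ‖ := norm_nonneg _
  nlinarith [Real.pi_pos]

theorem weight_le_pow (hφ : ClassM φ) (s : ℝ) :
    ∃ C : ℝ, ∃ N : ℕ, 0 < C ∧ ∀ ξ : E d, weight s φ ξ ≤ C * (1 + ‖ξ‖) ^ N := by
  obtain ⟨C, N, hC, h⟩ := weight_temperate (d := d) hφ s
  refine ⟨C * weight s φ (0 : E d), N, mul_pos hC (weight_pos hφ s 0), fun ξ => ?_⟩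
  have := h ξ 0
  rw [sub_zero] at this
  linarith

end Weight

/-! ### Weighted `L₂` norms on the frequency side -/

section WeightedNorm

variable {d : ℕ} {φ : ℝ → ℝ}

/-- The weighted `L₂` norm that defines the norm in `H^{s,φ}(ℝᵈ)`. -/
def freqNorm (s : ℝ) (φ : ℝ → ℝ) (g : E d → ℂ) : ℝ≥0∞ :=
  (∫⁻ ξ, ENNReal.ofReal (weight s φ ξ ^ 2) * ‖g ξ‖ₑ ^ 2) ^ (1 / 2 : ℝ)

/-- The measure `w(ξ)² dξ`, `w` the weight. -/
def freqMeasure (d : ℕ) (s : ℝ) (φ : ℝ → ℝ) : Measure (E d) :=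
  volume.withDensity fun ξ => ENNReal.ofReal (weight s φ ξ ^ 2)

theorem measurable_weight_sq (hφ : ClassM φ) (s : ℝ) :
    Measurable fun ξ : E d => ENNReal.ofReal (weight s φ ξ ^ 2) :=
  ((measurable_weight hφ s).pow_const 2).ennreal_ofReal

theorem freqNorm_eq_eLpNorm (hφ : ClassM φ) (s : ℝ) (g : E d → ℂ) :
    freqNorm s φ g = eLpNorm g 2 (freqMeasure d s φ) := by
  rw [eLpNorm_eq_lintegral_rpow_enorm_toReal two_ne_zero ENNReal.ofNat_ne_top, freqNorm,
    freqMeasure, lintegral_withDensity_eq_lintegral_mul_non_measurable _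
      (measurable_weight_sq hφ s) (Eventually.of_forall fun _ => ENNReal.ofReal_lt_top)]
  simp

theorem freqNorm_sq (s : ℝ) (φ : ℝ → ℝ) (g : E d → ℂ) :
    freqNorm s φ g ^ 2 = ∫⁻ ξ, ENNReal.ofReal (weight s φ ξ ^ 2) * ‖g ξ‖ₑ ^ 2 := by
  rw [freqNorm, ← ENNReal.rpow_natCast, ← ENNReal.rpow_mul]
  simp

theorem sq_le_sq_iff_ennreal {a b : ℝ≥0∞} : a ^ 2 ≤ b ^ 2 ↔ a ≤ b :=
  (ENNReal.pow_right_strictMono two_ne_zero).le_iff_le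

theorem freqNorm_le_mul {s t : ℝ} {φ' : ℝ → ℝ} {g h : E d → ℂ} (C : NNReal)
    (hgh : ∀ ξ, |weight s φ ξ| * ‖g ξ‖ ≤ C * (|weight t φ' ξ| * ‖h ξ‖)) :
    freqNorm s φ g ≤ C * freqNorm t φ' h := by
  rw [← sq_le_sq_iff_ennreal, mul_pow, freqNorm_sq, freqNorm_sq,
    ← lintegral_const_mul' _ _ (by simp)]
  refine lintegral_mono fun ξ => ?_
  have h1 := pow_le_pow_left₀ (by positivity) (hgh ξ) 2
  have h2 : ∀ (w : ℝ) (z : ℂ), ENNReal.ofReal (w ^ 2) * ‖z‖ₑ ^ 2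
      = ENNReal.ofReal ((|w| * ‖z‖) ^ 2) := fun w z => by
    rw [mul_pow, ENNReal.ofReal_mul (by positivity), sq_abs, ENNReal.ofReal_pow (norm_nonneg z),
      ofReal_norm]
  have h3 : (C : ℝ≥0∞) ^ 2 = ENNReal.ofReal ((C : ℝ) ^ 2) := by
    rw [ENNReal.ofReal_pow C.coe_nonneg, ENNReal.ofReal_coe_nnreal]
  rw [h2, h2, h3, ← ENNReal.ofReal_mul (by positivity), ← mul_pow]
  exact ENNReal.ofReal_le_ofReal h1

theorem freqNorm_mono (hφ : ClassM φ) {s t : ℝ} (hst : s ≤ t) (g : E d → ℂ) :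
    freqNorm s φ g ≤ freqNorm t φ g := by
  have h := freqNorm_le_mul (s := s) (t := t) (φ := φ) (φ' := φ) (g := g) (h := g) 1 (fun ξ => by
    rw [NNReal.coe_one, one_mul, abs_of_pos (weight_pos hφ s ξ), abs_of_pos (weight_pos hφ t ξ)]
    exact mul_le_mul_of_nonneg_right (weight_mono hφ hst ξ) (norm_nonneg _))
  simpa using h

/-- This is what embeds the Schwartz space continuously into the weighted L₂ space. Of the exponent
2N + (d + 1), the part 2N absorbs the squared weight and the part d + 1 gives integrability. -/
theorem freqMeasure_hasTemperateGrowth (hφ : ClassM φ) (s : ℝ) :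
    (freqMeasure d s φ).HasTemperateGrowth := by
  obtain ⟨C, N, hC, hN⟩ := weight_le_pow (d := d) hφ s
  refine ⟨⟨2 * N + (d + 1), ?_⟩⟩
  rw [freqMeasure, integrable_withDensity_iff (measurable_weight_sq hφ s)
    (Eventually.of_forall fun _ => ENNReal.ofReal_lt_top)]
  have h1 : Integrable fun ξ : E d => C ^ 2 * (1 + ‖ξ‖) ^ (-((d : ℝ) + 1)) :=
    (integrable_one_add_norm (by simp)).const_mul _
  refine h1.mono' ?_ (Eventually.of_forall fun ξ => ?_)
  · exact ((by fun_prop : Measurable fun ξ : E d =>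
      (1 + ‖ξ‖) ^ (-((2 * N + (d + 1) : ℕ) : ℝ))).mul
        (measurable_weight_sq hφ s).ennreal_toReal).aestronglyMeasurable
  · have hp : (0 : ℝ) < 1 + ‖ξ‖ := by positivity
    rw [ENNReal.toReal_ofReal (by positivity), Real.norm_of_nonneg (by positivity)]
    have h2 := pow_le_pow_left₀ (weight_pos hφ s ξ).le (hN ξ) 2
    calc (1 + ‖ξ‖) ^ (-((2 * N + (d + 1) : ℕ) : ℝ)) * weight s φ ξ ^ 2
        ≤ (1 + ‖ξ‖) ^ (-((2 * N + (d + 1) : ℕ) : ℝ)) * (C * (1 + ‖ξ‖) ^ N) ^ 2 := by gcongr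
      _ = C ^ 2 * (1 + ‖ξ‖) ^ (-((d : ℝ) + 1)) := by
        have h3 : ((C * (1 + ‖ξ‖) ^ N) ^ 2) = C ^ 2 * (1 + ‖ξ‖) ^ ((2 * N : ℕ) : ℝ) := by
          rw [Real.rpow_natCast]; ring
        rw [h3, mul_left_comm, ← Real.rpow_add hp]
        congr 2
        push_cast
        ring

/-- Finiteness on compact sets is needed for the density of Schwartz functions in the weighted L₂
space. -/
theorem freqMeasure_lt_top_of_isCompact (hφ : ClassM φ) (s : ℝ) :
    IsFiniteMeasureOnCompacts (freqMeasure d s φ) := by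
  obtain ⟨C, N, hC, hN⟩ := weight_le_pow (d := d) hφ s
  refine ⟨fun K hK => ?_⟩
  rw [freqMeasure, withDensity_apply _ hK.measurableSet]
  obtain ⟨B, hB⟩ := hK.isBounded.exists_norm_le
  refine setLIntegral_lt_top_of_le_nnreal hK.measure_lt_top.ne
    ⟨((C * (1 + B) ^ N) ^ 2).toNNReal, fun ξ hξ => ?_⟩
  refine ENNReal.ofReal_le_ofReal ?_
  have h1 : (1 + ‖ξ‖) ≤ 1 + B := by linarith [hB ξ hξ]
  refine pow_le_pow_left₀ (weight_pos hφ s ξ).le ((hN ξ).trans ?_) 2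
  gcongr

/-- The norm of a Schwartz function in `H^{s,φ}(ℝᵈ)`. -/
def schwartzNorm (s : ℝ) (φ : ℝ → ℝ) (f : 𝓢(E d, ℂ)) : ℝ≥0∞ := freqNorm s φ (𝓕 f : 𝓢(E d, ℂ))

theorem schwartzNorm_add_le (hφ : ClassM φ) (s : ℝ) (f g : 𝓢(E d, ℂ)) :
    schwartzNorm s φ (f + g) ≤ schwartzNorm s φ f + schwartzNorm s φ g := by
  simp only [schwartzNorm, freqNorm_eq_eLpNorm hφ, FourierTransform.fourier_add]
  exact eLpNorm_add_le (𝓕 f).continuous.aestronglyMeasurable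
    (𝓕 g).continuous.aestronglyMeasurable one_le_two

theorem schwartzNorm_mono (hφ : ClassM φ) {s t : ℝ} (hst : s ≤ t) (f : 𝓢(E d, ℂ)) :
    schwartzNorm s φ f ≤ schwartzNorm t φ f := freqNorm_mono hφ hst _

end WeightedNorm

/-! ### Operators on Schwartz functions that are bounded in the scale `H^{s,φ}(ℝᵈ)` -/

section BoundedOperators

variable {d : ℕ}

/-- `T` has order at most `t` in the scale of the spaces `H^{s,φ}(ℝᵈ)`. -/
def HasOrder (t : ℝ) (T : 𝓢(E d, ℂ) →ₗ[ℂ] 𝓢(E d, ℂ)) : Prop :=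
  ∀ (s : ℝ) (φ : ℝ → ℝ), ClassM φ →
    ∃ C : NNReal, ∀ f, schwartzNorm (s - t) φ (T f) ≤ C * schwartzNorm s φ f

theorem HasOrder.mono {t t' : ℝ} (htt : t ≤ t') {T : 𝓢(E d, ℂ) →ₗ[ℂ] 𝓢(E d, ℂ)}
    (hT : HasOrder t T) : HasOrder t' T := by
  intro s φ hφ
  obtain ⟨C, hC⟩ := hT s φ hφ
  exact ⟨C, fun f => (schwartzNorm_mono hφ (by linarith) _).trans (hC f)⟩

theorem HasOrder.comp {t t' : ℝ} {T T' : 𝓢(E d, ℂ) →ₗ[ℂ] 𝓢(E d, ℂ)}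
    (hT : HasOrder t T) (hT' : HasOrder t' T') : HasOrder (t + t') (T ∘ₗ T') := by
  intro s φ hφ
  obtain ⟨C', hC'⟩ := hT' s φ hφ
  obtain ⟨C, hC⟩ := hT (s - t') φ hφ
  refine ⟨C * C', fun f => ?_⟩
  have h1 := hC (T' f)
  rw [sub_sub, add_comm t' t] at h1
  refine h1.trans ?_
  rw [ENNReal.coe_mul, mul_assoc]
  exact mul_le_mul_right (hC' f) _

theorem HasOrder.add {t : ℝ} {T T' : 𝓢(E d, ℂ) →ₗ[ℂ] 𝓢(E d, ℂ)}
    (hT : HasOrder t T) (hT' : HasOrder t T') : HasOrder t (T + T') := by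
  intro s φ hφ
  obtain ⟨C, hC⟩ := hT s φ hφ
  obtain ⟨C', hC'⟩ := hT' s φ hφ
  refine ⟨C + C', fun f => ?_⟩
  rw [LinearMap.add_apply, ENNReal.coe_add, add_mul]
  exact (schwartzNorm_add_le hφ _ _ _).trans (add_le_add (hC f) (hC' f))

theorem HasOrder.zero (t : ℝ) : HasOrder (d := d) t 0 := by
  intro s φ _
  refine ⟨0, fun f => ?_⟩
  have h1 : 𝓕 (0 : 𝓢(E d, ℂ)) = 0 := FourierTransform.fourier_zero ..
  rw [LinearMap.zero_apply, schwartzNorm, h1]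
  simp [freqNorm]

theorem HasOrder.sum {ι : Type*} {t : ℝ} (J : Finset ι)
    {T : ι → 𝓢(E d, ℂ) →ₗ[ℂ] 𝓢(E d, ℂ)} (hT : ∀ i ∈ J, HasOrder t (T i)) :
    HasOrder t (∑ i ∈ J, T i) :=
  Finset.sum_induction T (HasOrder t) (fun _ _ => HasOrder.add) (HasOrder.zero t) hT

theorem HasOrder.id : HasOrder (d := d) 0 LinearMap.id := by
  intro s φ _
  exact ⟨1, fun f => by simp⟩

theorem HasOrder.smul {t : ℝ} {T : 𝓢(E d, ℂ) →ₗ[ℂ] 𝓢(E d, ℂ)} (c : ℂ) (hT : HasOrder t T) :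
    HasOrder t (c • T) := by
  intro s φ hφ
  obtain ⟨C, hC⟩ := hT s φ hφ
  refine ⟨‖c‖₊ * C, fun f => ?_⟩
  have h1 : schwartzNorm (s - t) φ (c • T f) ≤ ‖c‖₊ * schwartzNorm (s - t) φ (T f) := by
    refine freqNorm_le_mul _ fun ξ => ?_
    rw [FourierTransform.fourier_smul, smul_apply, norm_smul, coe_nnnorm]
    exact le_of_eq (by ring)
  rw [ENNReal.coe_mul, mul_assoc, LinearMap.smul_apply]
  exact h1.trans (mul_le_mul_right (hC f) _)

/-- The partial derivative in the direction `e` has order one. -/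
theorem hasOrder_lineDeriv (e : E d) :
    HasOrder 1 (LineDeriv.lineDerivOpCLM ℂ 𝓢(E d, ℂ) e : 𝓢(E d, ℂ) →ₗ[ℂ] 𝓢(E d, ℂ)) := by
  intro s φ hφ
  refine ⟨‖e‖₊, fun f => freqNorm_le_mul _ fun ξ => ?_⟩
  have htg : (inner ℝ · e : E d → ℝ).HasTemperateGrowth := by fun_prop
  have h1 : (𝓕 (LineDeriv.lineDerivOp e f) : 𝓢(E d, ℂ)) ξ
      = (2 * Real.pi * Complex.I) * ((inner ℝ ξ e : ℝ) * (𝓕 f) ξ) := by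
    rw [SchwartzMap.fourier_lineDerivOp_eq]
    simp [SchwartzMap.smulLeftCLM_apply_apply htg]
  have h2 : ‖(𝓕 (LineDeriv.lineDerivOp e f) : 𝓢(E d, ℂ)) ξ‖
      ≤ ‖e‖ * (bracket ξ * ‖(𝓕 f) ξ‖) := by
    have h3 : ‖(2 * Real.pi * Complex.I : ℂ)‖ = 2 * Real.pi := by
      simp [abs_of_pos Real.pi_pos]
    have h4 : 2 * Real.pi * ‖ξ‖ ≤ bracket ξ :=
      Real.le_sqrt_of_sq_le (by linarith)
    rw [h1, norm_mul, h3, norm_mul, Complex.norm_real]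
    calc 2 * Real.pi * (‖inner ℝ ξ e‖ * ‖(𝓕 f) ξ‖)
        ≤ 2 * Real.pi * ((‖ξ‖ * ‖e‖) * ‖(𝓕 f) ξ‖) := by
          gcongr
          exact norm_inner_le_norm ξ e
      _ = ‖e‖ * ((2 * Real.pi * ‖ξ‖) * ‖(𝓕 f) ξ‖) := by ring
      _ ≤ _ := by gcongr
  have h5 : weight s φ ξ = bracket ξ * weight (s - 1) φ ξ := by
    have := weight_add (s - 1) 1 φ ξ
    rwa [Real.rpow_one, sub_add_cancel] at this
  have h6 := weight_pos hφ (s - 1) ξ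
  rw [h5, abs_of_pos h6, abs_of_pos (mul_pos (bracket_pos ξ) h6), coe_nnnorm]
  calc weight (s - 1) φ ξ * ‖(𝓕 (LineDeriv.lineDerivOp e f) : 𝓢(E d, ℂ)) ξ‖
      ≤ weight (s - 1) φ ξ * (‖e‖ * (bracket ξ * ‖(𝓕 f) ξ‖)) := by gcongr
    _ = _ := by ring

/-- Cauchy–Schwarz for the splitting h F = h^{1/2} · (h^{1/2} F). It is the step that turns a
convolution with an integrable kernel into an L₂ bound. -/
theorem lintegral_mul_sq_le {α : Type*} [MeasurableSpace α] (μ : Measure α) {h F : α → ℝ≥0∞}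
    (hh : Measurable h) (hF : Measurable F) :
    (∫⁻ t, h t * F t ∂μ) ^ 2 ≤ (∫⁻ t, h t ∂μ) * ∫⁻ t, h t * F t ^ 2 ∂μ := by
  have hpow : ∀ x : ℝ≥0∞, (x ^ (1 / 2 : ℝ)) ^ (2 : ℝ) = x := fun x => by
    rw [← ENNReal.rpow_mul]; norm_num
  have h1 := ENNReal.lintegral_mul_le_Lp_mul_Lq μ Real.HolderConjugate.two_two
    (f := fun t => h t ^ (1 / 2 : ℝ)) (g := fun t => h t ^ (1 / 2 : ℝ) * F t)
    (hh.pow_const _).aemeasurable ((hh.pow_const _).mul hF).aemeasurable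
  have h2 : ∀ t, ((fun t => h t ^ (1 / 2 : ℝ)) * fun t => h t ^ (1 / 2 : ℝ) * F t) t
      = h t * F t := fun t => by
    rw [Pi.mul_apply, ← mul_assoc, ← ENNReal.rpow_add_of_nonneg _ _ (by norm_num) (by norm_num)]
    norm_num
  simp only [h2, hpow, ENNReal.mul_rpow_of_nonneg _ _ (zero_le_two : (0 : ℝ) ≤ 2)] at h1
  have h3 := pow_le_pow_left' h1 2
  rw [mul_pow, ← ENNReal.rpow_natCast, ← ENNReal.rpow_natCast, ← ENNReal.rpow_natCast,
    Nat.cast_ofNat, hpow, hpow] at h3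
  simpa using h3

/-- The transform of a product is a convolution of transforms. Writing the product through inverse
transforms and using 𝓕g(y) = 𝓕⁻g(-y) gives the kernel 𝓕⁻θ(t) and the argument ξ + t. -/
theorem enorm_fourier_mul_le (θ f : 𝓢(E d, ℂ)) (ξ : E d) :
    ‖(𝓕 (SchwartzMap.smulLeftCLM ℂ θ f) : 𝓢(E d, ℂ)) ξ‖ₑ
      ≤ ∫⁻ t, ‖(𝓕⁻ θ : 𝓢(E d, ℂ)) t‖ₑ * ‖(𝓕 f : 𝓢(E d, ℂ)) (ξ + t)‖ₑ := by
  set B := ContinuousLinearMap.mul ℂ ℂ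
  have h1 : SchwartzMap.smulLeftCLM ℂ θ f = 𝓕 (SchwartzMap.convolution B (𝓕⁻ θ) (𝓕⁻ f)) := by
    rw [SchwartzMap.fourier_convolution]
    ext x
    rw [SchwartzMap.smulLeftCLM_apply_apply θ.hasTemperateGrowth, SchwartzMap.pairing_apply_apply]
    simp [B]
  have hinv : ∀ (g : 𝓢(E d, ℂ)) (y : E d), (𝓕 g : 𝓢(E d, ℂ)) y = (𝓕⁻ g : 𝓢(E d, ℂ)) (-y) := by
    intro g y
    rw [SchwartzMap.fourier_coe, SchwartzMap.fourierInv_coe, Real.fourierInv_eq_fourier_neg,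
      neg_neg]
  rw [hinv, h1, FourierTransform.fourierInv_fourier_eq, SchwartzMap.convolution_apply,
    MeasureTheory.convolution_def]
  refine (enorm_integral_le_lintegral_enorm _).trans (le_of_eq (lintegral_congr fun t => ?_))
  rw [hinv f, neg_add']
  simp [B, enorm_mul]

/-- Multiplication by a Schwartz function has order zero. -/
theorem hasOrder_mul (θ : 𝓢(E d, ℂ)) :
    HasOrder 0 (SchwartzMap.smulLeftCLM ℂ θ : 𝓢(E d, ℂ) →ₗ[ℂ] 𝓢(E d, ℂ)) := by
  intro s φ hφ
  obtain ⟨C, N, hC, hN⟩ := weight_temperate (d := d) hφ s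
  -- The kernel is enlarged by the factor that temperateness costs when the weight is moved from ξ
  -- to ξ + t. It remains integrable because 𝓕⁻θ is rapidly decreasing. The bound then is Young's
  -- inequality with constant ∫ h: Cauchy–Schwarz, Tonelli and translation invariance.
  set h : E d → ℝ≥0∞ := fun t => ENNReal.ofReal (C * (1 + ‖t‖) ^ N) * ‖(𝓕⁻ θ : 𝓢(E d, ℂ)) t‖ₑ
    with hdef
  have hhm : Measurable h :=
    (by fun_prop : Measurable fun t : E d => ENNReal.ofReal (C * (1 + ‖t‖) ^ N)).mul
      (𝓕⁻ θ).continuous.enorm.measurable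
  have hfin : ∫⁻ t, h t ≠ ⊤ := by
    have h1 : Integrable fun t : E d => (C * (1 + ‖t‖) ^ N) * ‖(𝓕⁻ θ : 𝓢(E d, ℂ)) t‖ := by
      have h2 : ∀ t : E d, (C * (1 + ‖t‖) ^ N) * ‖(𝓕⁻ θ : 𝓢(E d, ℂ)) t‖
          = ∑ k ∈ Finset.range (N + 1),
            (C * N.choose k) * (‖t‖ ^ k * ‖(𝓕⁻ θ : 𝓢(E d, ℂ)) t‖) := fun t => by
        rw [add_comm, add_pow, Finset.mul_sum, Finset.sum_mul]
        refine Finset.sum_congr rfl fun k _ => ?_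
        rw [one_pow]; ring
      simp only [h2]
      exact integrable_finsetSum _ fun k _ => ((𝓕⁻ θ).integrable_pow_mul volume k).const_mul _
    have h3 := h1.hasFiniteIntegral
    rw [hasFiniteIntegral_iff_enorm] at h3
    refine ne_of_lt (lt_of_le_of_lt (le_of_eq (lintegral_congr fun t => ?_)) h3)
    rw [hdef, enorm_mul, enorm_norm, Real.enorm_of_nonneg (by positivity)]
  refine ⟨(∫⁻ t, h t).toNNReal, fun f => ?_⟩
  rw [ENNReal.coe_toNNReal hfin, sub_zero, ← sq_le_sq_iff_ennreal, mul_pow, schwartzNorm,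
    schwartzNorm, freqNorm_sq, freqNorm_sq]
  set F : E d → ℝ≥0∞ := fun ξ => ENNReal.ofReal (weight s φ ξ) * ‖(𝓕 f : 𝓢(E d, ℂ)) ξ‖ₑ with hF
  have hFm : Measurable F :=
    (measurable_weight hφ s).ennreal_ofReal.mul (𝓕 f).continuous.enorm.measurable
  have hFsq : ∀ (g : 𝓢(E d, ℂ)) (ξ : E d), ENNReal.ofReal (weight s φ ξ ^ 2) * ‖g ξ‖ₑ ^ 2
      = (ENNReal.ofReal (weight s φ ξ) * ‖g ξ‖ₑ) ^ 2 := fun g ξ => by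
    rw [mul_pow, ENNReal.ofReal_pow (weight_pos hφ s ξ).le]
  have hpt : ∀ ξ, ENNReal.ofReal (weight s φ ξ) *
      ‖(𝓕 (SchwartzMap.smulLeftCLM ℂ θ f) : 𝓢(E d, ℂ)) ξ‖ₑ ≤ ∫⁻ t, h t * F (ξ + t) := by
    intro ξ
    refine (mul_le_mul_right (enorm_fourier_mul_le θ f ξ) _).trans ?_
    rw [← lintegral_const_mul' _ _ ENNReal.ofReal_ne_top]
    refine lintegral_mono fun t => ?_
    have h1 : ENNReal.ofReal (weight s φ ξ)
        ≤ ENNReal.ofReal (C * (1 + ‖t‖) ^ N) * ENNReal.ofReal (weight s φ (ξ + t)) := by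
      rw [← ENNReal.ofReal_mul (by positivity)]
      have h2 := hN ξ (ξ + t)
      rw [sub_add_cancel_left, norm_neg] at h2
      exact ENNReal.ofReal_le_ofReal h2
    calc _ ≤ (ENNReal.ofReal (C * (1 + ‖t‖) ^ N) * ENNReal.ofReal (weight s φ (ξ + t))) * _ :=
          mul_le_mul_left h1 _
      _ = h t * F (ξ + t) := by rw [hdef, hF]; ring
  simp only [hFsq]
  calc ∫⁻ ξ, (ENNReal.ofReal (weight s φ ξ) *
        ‖(𝓕 (SchwartzMap.smulLeftCLM ℂ θ f) : 𝓢(E d, ℂ)) ξ‖ₑ) ^ 2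
      ≤ ∫⁻ ξ, (∫⁻ t, h t) * ∫⁻ t, h t * F (ξ + t) ^ 2 := by
        refine lintegral_mono fun ξ => (pow_le_pow_left' (hpt ξ) 2).trans ?_
        exact lintegral_mul_sq_le _ hhm (hFm.comp (measurable_const_add ξ))
    _ = (∫⁻ t, h t) * ∫⁻ ξ, ∫⁻ t, h t * F (ξ + t) ^ 2 := lintegral_const_mul' _ _ hfin
    _ = (∫⁻ t, h t) * ∫⁻ t, ∫⁻ ξ, h t * F (ξ + t) ^ 2 := by
        rw [lintegral_lintegral_swap]
        exact ((hhm.comp measurable_snd).mul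
          ((hFm.comp (measurable_fst.add measurable_snd)).pow_const 2)).aemeasurable
    _ = (∫⁻ t, h t) * ∫⁻ t, h t * ∫⁻ ξ, F ξ ^ 2 := by
        congr 1
        refine lintegral_congr fun t => ?_
        have hFt : Measurable fun ξ => F (ξ + t) ^ 2 :=
          (hFm.comp (measurable_add_const t)).pow_const 2
        rw [lintegral_const_mul _ hFt,
          lintegral_add_right_eq_self (fun ξ => F ξ ^ 2) t]
    _ = (∫⁻ t, h t) ^ 2 * ∫⁻ ξ, F ξ ^ 2 := by
        rw [lintegral_mul_const _ hhm, sq, mul_assoc]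

end BoundedOperators

/-! ### Differential operators on Schwartz functions -/

section DifferentialOperators

variable {n : ℕ}

theorem tsupport_partialDeriv_subset (k : Fin n) (u : E n → ℂ) :
    tsupport (fun x => Complex.I * partialDeriv k u x) ⊆ tsupport u := by
  refine closure_minimal (fun x hx => ?_) (isClosed_tsupport u)
  refine support_fderiv_subset ℝ (fun h => hx ?_)
  simp [partialDeriv, h]

theorem tsupport_multiD_subset (μ : Fin n → ℕ) (u : E n → ℂ) :
    tsupport (multiD μ u) ⊆ tsupport u := by
  unfold multiD
  induction List.finRange n with
  | nil => exact subset_rfl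
  | cons k l ih =>
    rw [List.foldr_cons]
    refine subset_trans ?_ ih
    generalize List.foldr _ u l = v
    induction μ k with
    | zero => exact subset_rfl
    | succ m ihm =>
      rw [Function.iterate_succ_apply']
      exact (tsupport_partialDeriv_subset k _).trans ihm

theorem diffOp_eq_zero_of_notMem_tsupport (d : ℕ) (c : (Fin n → ℕ) → E n → ℂ) {u : E n → ℂ}
    {x : E n} (hx : x ∉ tsupport u) : diffOp d c u x = 0 := by
  refine Finset.sum_eq_zero fun l _ => Finset.sum_eq_zero fun μ _ => ?_
  rw [image_eq_zero_of_notMem_tsupport fun h => hx (tsupport_multiD_subset μ u h), mul_zero]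

theorem exists_hasOrder_multiD (μ : Fin n → ℕ) :
    ∃ T : 𝓢(E n, ℂ) →ₗ[ℂ] 𝓢(E n, ℂ), HasOrder (∑ k, μ k : ℕ) T ∧
      ∀ f, ⇑(T f) = multiD μ f := by
  -- `multiD` is a fold over the list of all coordinates; the claim for arbitrary lists is what the
  -- induction needs, with an inner induction on the exponent of one coordinate.
  have h1 : ∀ l : List (Fin n), ∃ T : 𝓢(E n, ℂ) →ₗ[ℂ] 𝓢(E n, ℂ),
      HasOrder ((l.map μ).sum : ℕ) T ∧ ∀ f, ⇑(T f) =
        l.foldr (fun k v => (fun f x => Complex.I * partialDeriv k f x)^[μ k] v) f := by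
    intro l
    induction l with
    | nil => exact ⟨LinearMap.id, by simpa using HasOrder.id, fun f => rfl⟩
    | cons k l ih =>
      obtain ⟨T, hT, hTf⟩ := ih
      have h2 : ∀ m : ℕ, ∃ T' : 𝓢(E n, ℂ) →ₗ[ℂ] 𝓢(E n, ℂ),
          HasOrder (m + (l.map μ).sum : ℕ) T' ∧ ∀ f, ⇑(T' f) =
            (fun f x => Complex.I * partialDeriv k f x)^[m] (T f) := by
        intro m
        induction m with
        | zero => exact ⟨T, by simpa using hT, fun f => rfl⟩
        | succ m ihm =>
          obtain ⟨T', hT', hTf'⟩ := ihm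
          refine ⟨(Complex.I • (LineDeriv.lineDerivOpCLM ℂ 𝓢(E n, ℂ)
            (EuclideanSpace.single k (1 : ℝ)) : 𝓢(E n, ℂ) →ₗ[ℂ] 𝓢(E n, ℂ))) ∘ₗ T', ?_, ?_⟩
          · have := ((hasOrder_lineDeriv (EuclideanSpace.single k (1 : ℝ))).smul
              Complex.I).comp hT'
            refine HasOrder.mono (le_of_eq ?_) this
            push_cast
            ring
          · intro f
            rw [Function.iterate_succ_apply', ← hTf']
            funext x
            simp [partialDeriv, SchwartzMap.lineDerivOp_apply_eq_fderiv]
      obtain ⟨T', hT', hTf'⟩ := h2 (μ k)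
      refine ⟨T', by simpa using hT', fun f => ?_⟩
      rw [hTf', hTf, List.foldr_cons]
  obtain ⟨T, hT, hTf⟩ := h1 (List.finRange n)
  refine ⟨T, ?_, hTf⟩
  have : ∑ k, μ k = ((List.finRange n).map μ).sum := by
    rw [← List.sum_ofFn, List.ofFn_eq_map]
  rwa [this]

/-- A differential operator with smooth coefficients, cut off by a test function, has the expected
order. -/
theorem exists_hasOrder_diffOp (d : ℕ) {c : (Fin n → ℕ) → E n → ℂ} (hc : ∀ μ, ContDiff ℝ ∞ (c μ))
    {θ : E n → ℂ} (hθ : ContDiff ℝ ∞ θ) (hθc : HasCompactSupport θ) :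
    ∃ T : 𝓢(E n, ℂ) →ₗ[ℂ] 𝓢(E n, ℂ), HasOrder d T ∧
      ∀ f x, T f x = θ x * diffOp d c f x := by
  choose T hT hTf using exists_hasOrder_multiD (n := n)
  have hcs : ∀ μ, HasCompactSupport (fun x => θ x * c μ x) := fun μ => hθc.mul_right
  -- The cut-off is absorbed into the coefficients: θ c_μ is smooth with compact support, so
  -- multiplication by it has order zero, while c_μ alone may grow arbitrarily.
  set M : (Fin n → ℕ) → 𝓢(E n, ℂ) := fun μ => (hcs μ).toSchwartzMap (hθ.mul (hc μ)) with hM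
  have hMx : ∀ μ x, M μ x = θ x * c μ x := fun μ x => rfl
  refine ⟨∑ l ∈ Finset.range (d + 1), ∑ μ ∈ Finset.piAntidiag Finset.univ l,
    (SchwartzMap.smulLeftCLM ℂ (M μ) : 𝓢(E n, ℂ) →ₗ[ℂ] 𝓢(E n, ℂ)) ∘ₗ T μ, ?_, ?_⟩
  · refine HasOrder.sum _ fun l hl => HasOrder.sum _ fun μ hμ => ?_
    refine HasOrder.mono ?_ ((hasOrder_mul (M μ)).comp (hT μ))
    rw [Finset.mem_piAntidiag] at hμ
    rw [Finset.mem_range] at hl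
    rw [hμ.1, zero_add]
    exact_mod_cast Nat.lt_succ_iff.1 hl
  · intro f x
    have hev : ∀ (J : Finset ℕ) (g : ℕ → 𝓢(E n, ℂ)), (∑ l ∈ J, g l) x = ∑ l ∈ J, g l x :=
      fun J g => by simp
    have hev' : ∀ (J : Finset (Fin n → ℕ)) (g : (Fin n → ℕ) → 𝓢(E n, ℂ)),
      (∑ l ∈ J, g l) x = ∑ l ∈ J, g l x := fun J g => by simp
    simp only [LinearMap.sum_apply, hev, hev', diffOp, Finset.mul_sum]
    refine Finset.sum_congr rfl fun l _ => Finset.sum_congr rfl fun μ _ => ?_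
    rw [LinearMap.comp_apply, ContinuousLinearMap.coe_coe,
      SchwartzMap.smulLeftCLM_apply_apply (M μ).hasTemperateGrowth, hMx, hTf, smul_eq_mul, mul_assoc]

end DifferentialOperators

/-! ### Norms of functions with support in the interior -/

section InteriorNorms

variable {d : ℕ} {φ : ℝ → ℝ}

theorem hasFourierDensity_coe (f : 𝓢(E d, ℂ)) :
    HasFourierDensity (f : 𝓢'(E d, ℂ)) (𝓕 f : 𝓢(E d, ℂ)) := by
  refine ⟨(𝓕 f).continuous.locallyIntegrable, fun ψ => ?_⟩
  have h1 := TemperedDistribution.fourier_toTemperedDistributionCLM_eq f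
  have h2 : 𝓕 (f : 𝓢'(E d, ℂ)) = ((𝓕 f : 𝓢(E d, ℂ)) : 𝓢'(E d, ℂ)) := h1
  rw [h2, SchwartzMap.coe_apply]
  rfl

theorem hNorm_le_freqNorm (s : ℝ) (φ : ℝ → ℝ) {w : 𝓢'(E d, ℂ)} {g : E d → ℂ}
    (h : HasFourierDensity w g) : hNorm s φ w ≤ freqNorm s φ g :=
  iInf₂_le g h

theorem hNorm_coe_le (s : ℝ) (φ : ℝ → ℝ) (f : 𝓢(E d, ℂ)) :
    hNorm s φ (f : 𝓢'(E d, ℂ)) ≤ schwartzNorm s φ f :=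
  hNorm_le_freqNorm s φ (hasFourierDensity_coe f)

theorem schwartzNorm_zero (s : ℝ) (φ : ℝ → ℝ) : schwartzNorm s φ (0 : 𝓢(E d, ℂ)) = 0 := by
  have h1 : 𝓕 (0 : 𝓢(E d, ℂ)) = 0 := FourierTransform.fourier_zero ..
  rw [schwartzNorm, h1]
  simp [freqNorm]

/-- A Schwartz function extends its restriction to an open set. -/
theorem agreesOn_coe {U : Set (E d)} (hU : MeasurableSet U) {f : 𝓢(E d, ℂ)} {g : E d → ℂ}
    (h : EqOn f g U) : AgreesOn U (f : 𝓢'(E d, ℂ)) g := by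
  intro ψ hψ
  rw [SchwartzMap.coe_apply]
  have h1 : ∀ x, x ∉ U → ψ x • f x = 0 := fun x hx => by
    rw [image_eq_zero_of_notMem_tsupport fun hx' => hx (hψ hx'), zero_smul]
  rw [← setIntegral_eq_integral_of_forall_compl_eq_zero h1]
  exact setIntegral_congr_fun hU fun x hx => by rw [smul_eq_mul, h hx]

theorem hNormOn_le_schwartzNorm {U : Set (E d)} (hU : MeasurableSet U) (s : ℝ) (φ : ℝ → ℝ)
    {f : 𝓢(E d, ℂ)} {g : E d → ℂ} (h : EqOn f g U) :
    hNormOn U s φ g ≤ schwartzNorm s φ f :=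
  le_trans (iInf₂_le (f : 𝓢'(E d, ℂ)) (agreesOn_coe hU h)) (hNorm_coe_le s φ f)

theorem hNormOn_univ_zero (s : ℝ) (φ : ℝ → ℝ) : hNormOn univ s φ (fun _ : E d => (0 : ℂ)) = 0 := by
  have h := hNormOn_le_schwartzNorm MeasurableSet.univ s φ (f := 0)
    (g := fun _ : E d => (0 : ℂ)) (fun x _ => rfl)
  rw [schwartzNorm_zero] at h
  exact le_antisymm h bot_le

/-- The complex conjugate of a Schwartz function. -/
def conjSchwartz (f : 𝓢(E d, ℂ)) : 𝓢(E d, ℂ) :=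
  f.postcompCLM (Complex.conjCLE : ℂ →L[ℝ] ℂ)

theorem conjSchwartz_apply (f : 𝓢(E d, ℂ)) (x : E d) : conjSchwartz f x = conj (f x) := rfl

theorem fourierInv_conjSchwartz (f : 𝓢(E d, ℂ)) (ξ : E d) :
    (𝓕⁻ (conjSchwartz f) : 𝓢(E d, ℂ)) ξ = conj ((𝓕 f : 𝓢(E d, ℂ)) ξ) := by
  rw [SchwartzMap.fourierInv_coe, SchwartzMap.fourier_coe, Real.fourierInv_eq', Real.fourier_eq',
    ← integral_conj]
  refine integral_congr_ae (Eventually.of_forall fun x => ?_)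
  simp only [smul_eq_mul, map_mul, conjSchwartz_apply, ← Complex.exp_conj,
    Complex.conj_ofReal, Complex.conj_I]
  congr 2
  push_cast
  ring

/-- The duality of the spaces with the weights `w` and `1/w`. -/
theorem enorm_apply_conjSchwartz_le (hφ : ClassM φ) (s : ℝ) (f : 𝓢(E d, ℂ)) (w : 𝓢'(E d, ℂ))
    {c : ℝ≥0∞} (hc : schwartzNorm s φ f ≤ c) (hc0 : c ≠ 0) (hct : c ≠ ⊤) :
    ‖w (conjSchwartz f)‖ₑ ≤ c * hNorm (-s) (fun t => (φ t)⁻¹) w := by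
  have hmain : ∀ g, HasFourierDensity w g →
      ‖w (conjSchwartz f)‖ₑ ≤ schwartzNorm s φ f * freqNorm (-s) (fun t => (φ t)⁻¹) g := by
    intro g hg
    have h1 : w (conjSchwartz f) = ∫ ξ, conj ((𝓕 f : 𝓢(E d, ℂ)) ξ) * g ξ := by
      have h2 := hg.2 (𝓕⁻ (conjSchwartz f))
      rw [TemperedDistribution.fourier_apply, FourierTransform.fourier_fourierInv_eq] at h2
      rw [h2]
      simp only [fourierInv_conjSchwartz]
    rw [h1]
    refine (enorm_integral_le_lintegral_enorm _).trans ?_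
    have hgm : AEMeasurable (fun ξ => ‖g ξ‖ₑ) :=
      hg.1.aestronglyMeasurable.enorm
    have h3 := ENNReal.lintegral_mul_le_Lp_mul_Lq volume Real.HolderConjugate.two_two
      (f := fun ξ => ENNReal.ofReal (weight s φ ξ) * ‖(𝓕 f : 𝓢(E d, ℂ)) ξ‖ₑ)
      (g := fun ξ => ENNReal.ofReal (weight s φ ξ)⁻¹ * ‖g ξ‖ₑ)
      ((measurable_weight hφ s).ennreal_ofReal.mul
        (𝓕 f).continuous.enorm.measurable).aemeasurable
      ((measurable_weight hφ s).inv.ennreal_ofReal.aemeasurable.mul hgm)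
    have h4 : ∀ ξ : E d, ((fun ξ => ENNReal.ofReal (weight s φ ξ) * ‖(𝓕 f : 𝓢(E d, ℂ)) ξ‖ₑ) *
        fun ξ => ENNReal.ofReal (weight s φ ξ)⁻¹ * ‖g ξ‖ₑ) ξ
        = ‖conj ((𝓕 f : 𝓢(E d, ℂ)) ξ) * g ξ‖ₑ := fun ξ => by
      have h5 : ENNReal.ofReal (weight s φ ξ) * ENNReal.ofReal (weight s φ ξ)⁻¹ = 1 := by
        rw [← ENNReal.ofReal_mul (weight_pos hφ s ξ).le,
          mul_inv_cancel₀ (weight_pos hφ s ξ).ne', ENNReal.ofReal_one]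
      rw [Pi.mul_apply, mul_mul_mul_comm, h5, one_mul, enorm_mul, RCLike.enorm_conj]
    simp only [h4] at h3
    refine h3.trans (le_of_eq ?_)
    rw [schwartzNorm, freqNorm, freqNorm]
    congr 2
    · refine lintegral_congr fun ξ => ?_
      rw [ENNReal.mul_rpow_of_nonneg _ _ zero_le_two, ENNReal.rpow_two, ENNReal.rpow_two,
        ENNReal.ofReal_pow (weight_pos hφ s ξ).le]
    · refine lintegral_congr fun ξ => ?_
      rw [ENNReal.mul_rpow_of_nonneg _ _ zero_le_two, ENNReal.rpow_two, ENNReal.rpow_two,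
        weight_neg_inv, ENNReal.ofReal_pow (inv_pos.2 (weight_pos hφ s ξ)).le]
  unfold hNorm
  -- A factor different from 0 and ⊤ commutes with an infimum. This is the reason for a bound c in
  -- place of the norm itself, which could vanish and meet the value ⊤.
  simp only [ENNReal.mul_iInf' (fun h => absurd h hct) (fun h => absurd h hc0)]
  exact le_iInf₂ fun g hg => (hmain g hg).trans (mul_le_mul_left hc _)

end InteriorNorms

/-! ### The modified norms of functions with support in `Ω` -/

section DirectNorm

variable {n : ℕ} {Ω : SmoothDomain n} {φ : ℝ → ℝ}

/-- For s ≥ 0 the function f is an admissible extension of its own restriction. For s < 0, since f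
is supported in Ω, its pairing with v equals, up to conjugation, the pairing of its conjugate with
any extension of v; the duality of the weights w and 1/w bounds the latter. -/
theorem zeroNorm_le_schwartzNorm (hφ : ClassM φ) (s : ℝ) {f : 𝓢(E n, ℂ)}
    (hf : tsupport f ⊆ Ω.carrier) : zeroNorm Ω s φ f ≤ schwartzNorm s φ f := by
  unfold zeroNorm
  split_ifs with hs
  · exact hNormOn_le_schwartzNorm Ω.isOpen.measurableSet s φ fun x _ => rfl
  · refine iSup₂_le fun v _ => le_of_forall_gt_imp_ge_of_dense fun c hc => ?_
    rcases eq_or_ne c ⊤ with rfl | hct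
    · exact le_top
    have hc0 : c ≠ 0 := (bot_le.trans_lt hc).ne'
    refine ENNReal.div_le_of_le_mul ?_
    unfold hNormOn
    simp only [ENNReal.mul_iInf' (fun h => absurd h hct) (fun h => absurd h hc0)]
    refine le_iInf₂ fun w hw => ?_
    have hsupp : tsupport (conjSchwartz f) ⊆ Ω.carrier := by
      refine subset_trans (closure_mono fun x hx => ?_) hf
      intro h
      exact hx (by rw [conjSchwartz_apply, h, map_zero])
    have h1 : ∫ x in Ω.carrier, f x * conj (v x) = conj (w (conjSchwartz f)) := by
      rw [hw _ hsupp, ← integral_conj]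
      refine integral_congr_ae (Eventually.of_forall fun x => ?_)
      simp [conjSchwartz_apply]
    rw [h1, RCLike.enorm_conj]
    exact enorm_apply_conjSchwartz_le hφ s f w hc.le hc0 hct

theorem bdry_subset_compl (Ω : SmoothDomain n) : Ω.bdry ⊆ Ω.carrierᶜ := fun _ hx hx' =>
  disjoint_left.1 (disjoint_frontier_iff_isOpen.2 Ω.isOpen) hx hx'

theorem mem_bdry_α (𝒜 : BoundaryAtlas Ω) (j : Fin 𝒜.κ) (y : E (n - 1)) : 𝒜.α j y ∈ Ω.bdry := by
  obtain ⟨U, _, hU⟩ := 𝒜.open_range j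
  have : 𝒜.α j y ∈ range (𝒜.α j) := mem_range_self y
  rw [hU] at this
  exact this.1

theorem localRep_eq_zero (𝒜 : BoundaryAtlas Ω) (j : Fin 𝒜.κ) {h : E n → ℂ}
    (hh : ∀ x ∈ Ω.bdry, h x = 0) : 𝒜.localRep j h = fun _ => 0 :=
  funext fun y => by rw [BoundaryAtlas.localRep, hh _ (mem_bdry_α 𝒜 j y), mul_zero]

theorem bdryNorm_eq_zero (𝒜 : BoundaryAtlas Ω) (s : ℝ) (φ : ℝ → ℝ) {h : E n → ℂ}
    (hh : ∀ x ∈ Ω.bdry, h x = 0) : bdryNorm 𝒜 s φ h = 0 := by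
  simp [bdryNorm, localRep_eq_zero 𝒜 _ hh, hNormOn_univ_zero]

theorem normalDeriv_eq_zero (Ω : SmoothDomain n) (k : ℕ) {u : E n → ℂ} {x : E n}
    (hx : x ∉ tsupport u) : normalDeriv Ω k u x = 0 := by
  rw [normalDeriv, image_eq_zero_of_notMem_tsupport fun h =>
    hx (tsupport_iteratedFDeriv_subset (𝕜 := ℝ) k h)]
  simp

/-- The support of f avoids Γ, so all normal derivatives vanish there and only the interior norm is
left. -/
theorem directNorm_le_schwartzNorm (𝒜 : BoundaryAtlas Ω) (hφ : ClassM φ) (s : ℝ) (k : ℕ)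
    {f : 𝓢(E n, ℂ)} (hf : tsupport f ⊆ Ω.carrier) :
    directNorm 𝒜 s φ k f ≤ schwartzNorm s φ f := by
  have h1 : ∀ j : ℕ, bdryNorm 𝒜 (s - (j + 1) + 1 / 2) φ (normalDeriv Ω j f) = 0 := fun j =>
    bdryNorm_eq_zero 𝒜 _ φ fun x hx =>
      normalDeriv_eq_zero Ω j fun h => bdry_subset_compl Ω hx (hf h)
  simp only [directNorm, h1]
  simp only [ne_eq, OfNat.ofNat_ne_zero, not_false_eq_true, zero_pow, Finset.sum_const_zero,
    add_zero]
  rw [← ENNReal.rpow_natCast, ← ENNReal.rpow_mul]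
  simpa using zeroNorm_le_schwartzNorm hφ s hf

end DirectNorm

/-! ### Positive square roots and interpolation with the parameter `1/2` -/

section HilbertSpace

variable {X₀ X₁ Y : Type} [NormedAddCommGroup X₀] [InnerProductSpace ℂ X₀] [CompleteSpace X₀]
  [NormedAddCommGroup X₁] [InnerProductSpace ℂ X₁] [CompleteSpace X₁]
  [NormedAddCommGroup Y] [InnerProductSpace ℂ Y] [CompleteSpace Y]

/-- A bounded operator whose adjoint is injective has dense range. -/
theorem denseRange_of_adjoint_injective (T : X₁ →L[ℂ] X₀)
    (h : ∀ x, ContinuousLinearMap.adjoint T x = 0 → x = 0) : DenseRange T := by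
  have h1 : T.rangeᗮ = ⊥ := by
    rw [ContinuousLinearMap.orthogonal_range, Submodule.eq_bot_iff]
    exact fun x hx => h x hx
  have h2 := (Submodule.topologicalClosure_eq_top_iff).2 h1
  have h3 := Submodule.dense_iff_topologicalClosure_eq_top.2 h2
  exact h3

/-- Every positive operator is the square of a positive operator. -/
theorem exists_isPositive_sqrt {T : X₀ →L[ℂ] X₀} (hT : T.IsPositive) :
    ∃ R : X₀ →L[ℂ] X₀, R.IsPositive ∧ R ∘L R = T := by
  have h0 : 0 ≤ T := (ContinuousLinearMap.nonneg_iff_isPositive T).2 hT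
  exact ⟨CFC.sqrt T, (ContinuousLinearMap.nonneg_iff_isPositive _).1 (CFC.sqrt_nonneg T),
    CFC.sqrt_mul_sqrt_self T h0⟩

/-- The inverse of the generating operator of a dense embedding of Hilbert spaces, its positive
square root and the corresponding unitary operator. -/
theorem exists_inverseGeneratingOperator (ι : X₁ →L[ℂ] X₀) (hinj : Function.Injective ι)
    (hdense : DenseRange ι) :
    ∃ (Q : X₀ →L[ℂ] X₀) (U : X₁ ≃ₗᵢ[ℂ] X₀), Q.IsPositive ∧
      IsInverseGeneratingOperator ι (Q ∘L Q) ∧ ∀ w, Q (Q (U w)) = ι w := by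
  set ιs := ContinuousLinearMap.adjoint ι with hιs
  -- The inverse generating operator is R = (ι ι*)^{1/2}, and Q is its square root. From R² = ι ι*
  -- one gets ‖R x‖ = ‖ι* x‖.
  have hpos : (ι ∘L ιs).IsPositive := ContinuousLinearMap.isPositive_self_comp_adjoint ι
  obtain ⟨R, hR, hRR⟩ := exists_isPositive_sqrt hpos
  obtain ⟨Q, hQ, hQQ⟩ := exists_isPositive_sqrt hR
  have hRsa : ContinuousLinearMap.adjoint R = R := hR.isSelfAdjoint.adjoint_eq
  have hnorm : ∀ x, ‖ιs x‖ = ‖R x‖ := by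
    intro x
    have h1 : (inner ℂ (R x) (R x) : ℂ) = inner ℂ (ιs x) (ιs x) := by
      rw [hιs, ContinuousLinearMap.adjoint_inner_left, ← hιs]
      calc (inner ℂ (R x) (R x) : ℂ) = inner ℂ (ContinuousLinearMap.adjoint R x) (R x) := by
            rw [hRsa]
        _ = inner ℂ x ((R ∘L R) x) := by
            rw [ContinuousLinearMap.adjoint_inner_left]; rfl
        _ = _ := by rw [hRR]; rfl
    rw [inner_self_eq_norm_sq_to_K, inner_self_eq_norm_sq_to_K] at h1
    have h2 : ‖R x‖ ^ 2 = ‖ιs x‖ ^ 2 := by exact_mod_cast h1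
    exact ((sq_eq_sq₀ (norm_nonneg _) (norm_nonneg _)).1 h2).symm
  have hιs0 : ∀ x, ιs x = 0 → x = 0 := by
    intro x hx
    have h1 : ∀ y ∈ range ι, (inner ℂ x y : ℂ) = 0 := by
      rintro _ ⟨w, rfl⟩
      rw [← ContinuousLinearMap.adjoint_inner_left, ← hιs, hx, inner_zero_left]
    have h2 : ∀ y, (inner ℂ x y : ℂ) = 0 := fun y =>
      hdense.induction (P := fun y => (inner ℂ x y : ℂ) = 0) (fun y hy => h1 y hy)
        (isClosed_eq (by fun_prop) continuous_const) y
    exact inner_self_eq_zero.1 (h2 x)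
  have hRd : DenseRange R := denseRange_of_adjoint_injective R fun x hx => by
    rw [hRsa] at hx
    exact hιs0 x (norm_eq_zero.1 (by rw [hnorm, hx, norm_zero]))
  have hιd : DenseRange ιs := denseRange_of_adjoint_injective ιs fun x hx => by
    rw [hιs, ContinuousLinearMap.adjoint_adjoint] at hx
    exact hinj (by rw [hx, map_zero])
  -- Polar decomposition: R x ↦ ι* x is isometric between dense subspaces and extends to a unitary
  -- V. Taking adjoints in V R = ι* gives R V⁻¹ = ι, so V⁻¹ is the required unitary.
  set V : X₀ ≃ₗᵢ[ℂ] X₁ := LinearEquiv.extendOfIsometry (LinearEquiv.refl ℂ X₀)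
    (R : X₀ →ₗ[ℂ] X₀) (ιs : X₀ →ₗ[ℂ] X₁) hRd hιd (fun x => hnorm x) with hV
  have hVR : ∀ x, V (R x) = ιs x := fun x =>
    LinearEquiv.extendOfIsometry_eq (LinearEquiv.refl ℂ X₀)
      (R : X₀ →ₗ[ℂ] X₀) (ιs : X₀ →ₗ[ℂ] X₁) hRd hιd (fun x => hnorm x) x
  have hRV : ∀ w, R (V.symm w) = ι w := by
    intro w
    refine ext_inner_right ℂ fun y => ?_
    calc (inner ℂ (R (V.symm w)) y : ℂ)
        = inner ℂ (ContinuousLinearMap.adjoint R (V.symm w)) y := by rw [hRsa]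
      _ = inner ℂ (V.symm w) (R y) := ContinuousLinearMap.adjoint_inner_left _ _ _
      _ = inner ℂ (V (V.symm w)) (V (R y)) := (V.inner_map_map _ _).symm
      _ = inner ℂ w (ιs y) := by rw [V.apply_symm_apply, hVR]
      _ = inner ℂ (ι w) y := ContinuousLinearMap.adjoint_inner_right _ _ _
  have hRU : ∀ f w, R f = ι w → f = V.symm w := by
    intro f w hfw
    rw [← hRV w] at hfw
    have h1 : R (f - V.symm w) = 0 := by rw [map_sub, hfw, sub_self]
    have h2 := hιs0 _ (norm_eq_zero.1 (by rw [hnorm, h1, norm_zero]))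
    exact sub_eq_zero.1 h2
  refine ⟨Q, V.symm, hQ, ?_, fun w => ?_⟩
  · rw [hQQ]
    refine ⟨hR, ?_, fun f w hfw => ?_⟩
    · ext y
      constructor
      · rintro ⟨f, rfl⟩
        exact ⟨V f, by rw [← hRV, V.symm_apply_apply]⟩
      · rintro ⟨w, rfl⟩
        exact ⟨V.symm w, hRV w⟩
    · rw [hRU f w hfw, LinearIsometryEquiv.norm_map]
  · rw [← hRV w, ← hQQ]
    rfl

theorem ofReal_norm_sq_eq_inner (x : X₀) : ((‖x‖ ^ 2 : ℝ) : ℂ) = inner ℂ x x := by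
  rw [Complex.ofReal_pow]
  exact (inner_self_eq_norm_sq_to_K x).symm

/-- A sequence with geometric growth that satisfies `a k ^ 2 ≤ a (2 k) a 0`. -/
theorem le_mul_of_sq_le {a : ℕ → ℝ} (ha : ∀ k, 0 ≤ a k) {C b : ℝ} (hC : 0 ≤ C) (hb : 0 ≤ b)
    (hle : ∀ k, a k ≤ C * b ^ k) (hsq : ∀ k, a k ^ 2 ≤ a (2 * k) * a 0) : a 1 ≤ b * a 0 := by
  rcases (ha 0).eq_or_lt with h0 | h0
  · have := hsq 1
    rw [← h0, mul_zero] at this ⊢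
    nlinarith [sq_nonneg (a 1)]
  by_contra! hlt
  -- The inequality is iterated along the powers of two: the normalized ratio is squared when the
  -- index doubles.
  have hpow : ∀ j : ℕ, (a 1 / a 0) ^ (2 ^ j) ≤ a (2 ^ j) / a 0 := by
    intro j
    induction j with
    | zero => simp
    | succ j ih =>
      have h1 : (a 1 / a 0) ^ (2 ^ (j + 1)) = ((a 1 / a 0) ^ (2 ^ j)) ^ 2 := by
        rw [← pow_mul, pow_succ]
      rw [h1]
      refine (pow_le_pow_left₀ (pow_nonneg (div_nonneg (ha 1) h0.le) _) ih 2).trans ?_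
      rw [div_pow, div_le_div_iff₀ (by positivity) h0]
      have h2 := hsq (2 ^ j)
      rw [show 2 ^ (j + 1) = 2 * 2 ^ j by ring]
      nlinarith
  have ha1 : 0 < a 1 := lt_of_le_of_lt (by positivity) hlt
  set r := b * a 0 / a 1 with hr
  have hr0 : 0 ≤ r := by positivity
  have hr1 : r < 1 := by rw [hr, div_lt_one ha1]; exact hlt
  -- If a 1 exceeded b · a 0, then r < 1, yet its powers r^(2^j) would stay above a 0 / C, while
  -- they tend to 0.
  have hbound : ∀ j : ℕ, a 0 / C ≤ r ^ (2 ^ j) ∨ C = 0 := by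
    intro j
    rcases hC.eq_or_lt with hC0 | hC0
    · exact Or.inr hC0.symm
    left
    have h1 := (hpow j).trans (div_le_div_of_nonneg_right (hle (2 ^ j)) h0.le)
    rw [div_pow, div_le_div_iff₀ (by positivity) h0] at h1
    rw [hr, div_pow, mul_pow, div_le_div_iff₀ hC0 (by positivity)]
    linarith
  rcases hC.eq_or_lt with hC0 | hC0
  · have := hle 1
    rw [← hC0, zero_mul] at this
    linarith
  · have h1 : Tendsto (fun j : ℕ => r ^ (2 ^ j)) atTop (𝓝 0) :=
      (tendsto_pow_atTop_nhds_zero_of_lt_one hr0 hr1).comp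
        (tendsto_pow_atTop_atTop_of_one_lt one_lt_two)
    have h2 := ge_of_tendsto' h1 fun j => (hbound j).resolve_right hC0.ne'
    exact absurd h2 (not_le.2 (div_pos h0 hC0))

/-- Reid's inequality, for the positive operator `K²`. -/
theorem norm_comp_le_of_symmetrizable (K M : Y →L[ℂ] Y) (hK : IsSelfAdjoint K)
    (hM : ∀ x y, (inner ℂ (K (K (M x))) y : ℂ) = inner ℂ (K (K x)) (M y)) (z : Y) :
    ‖K (M z)‖ ≤ ‖M‖ * ‖K z‖ := by
  have hKs : ∀ x y, (inner ℂ (K x) y : ℂ) = inner ℂ x (K y) := fun x y =>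
    (ContinuousLinearMap.isSelfAdjoint_iff_isSymmetric.1 hK) x y
  have hMk : ∀ (k : ℕ) x y, (inner ℂ (K (K ((M ^ k) x))) y : ℂ) = inner ℂ (K (K x)) ((M ^ k) y) := by
    intro k
    induction k with
    | zero => intro x y; rfl
    | succ k ih =>
      intro x y
      have h1 : (M ^ (k + 1)) x = M ((M ^ k) x) := by rw [pow_succ']; rfl
      have h2 : (M ^ (k + 1)) y = (M ^ k) (M y) := by rw [pow_succ]; rfl
      rw [h1, h2, hM, ih]
  -- With a k = ‖K Mᵏ z‖², symmetry of K² M moves k factors across the inner product, so a k = ⟨K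
  -- M²ᵏ z, K z⟩ and Cauchy–Schwarz gives a k ² ≤ a (2k) a 0. The growth bound by ‖M‖^{2k} is the
  -- trivial one; the conclusion removes its constant.
  have hkey := le_mul_of_sq_le (a := fun k => ‖K ((M ^ k) z)‖ ^ 2) (C := (‖K‖ * ‖z‖) ^ 2)
    (b := ‖M‖ ^ 2) (fun k => sq_nonneg _) (sq_nonneg _) (sq_nonneg _) (fun k => by
      rw [← pow_mul, mul_comm 2 k, pow_mul, ← mul_pow]
      refine pow_le_pow_left₀ (norm_nonneg _) ?_ 2
      calc ‖K ((M ^ k) z)‖ ≤ ‖K‖ * (‖M ^ k‖ * ‖z‖) :=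
            (K.le_opNorm _).trans (by gcongr; exact (M ^ k).le_opNorm z)
        _ ≤ ‖K‖ * (‖M‖ ^ k * ‖z‖) := by
            rcases k.eq_zero_or_pos with rfl | hk
            · gcongr
              rw [pow_zero, pow_zero]
              exact ContinuousLinearMap.norm_id_le
            · gcongr
              exact norm_pow_le' M hk
        _ = _ := by ring) (fun k => by
      have h1 : ((‖K ((M ^ k) z)‖ ^ 2 : ℝ) : ℂ) = inner ℂ (K ((M ^ (2 * k)) z)) (K z) := by
        rw [two_mul, pow_add, mul_apply_eq_comp, ← hKs, hMk, hKs, ofReal_norm_sq_eq_inner]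
      have h2 : ‖K ((M ^ k) z)‖ ^ 2 ≤ ‖K ((M ^ (2 * k)) z)‖ * ‖K z‖ := by
        have h3 := norm_inner_le_norm (𝕜 := ℂ) (K ((M ^ (2 * k)) z)) (K z)
        rw [← h1, Complex.norm_real, Real.norm_of_nonneg (sq_nonneg _)] at h3
        exact h3
      calc (‖K ((M ^ k) z)‖ ^ 2) ^ 2 ≤ (‖K ((M ^ (2 * k)) z)‖ * ‖K z‖) ^ 2 :=
            pow_le_pow_left₀ (sq_nonneg _) h2 2
        _ = _ := by rw [mul_pow, pow_zero, one_apply_eq_self])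
  simp only [pow_one, pow_zero, one_apply_eq_self, ← mul_pow] at hkey
  exact le_of_sq_le_sq hkey (by positivity)

/-- Interpolation of a bounded operator with the parameter `1/2`: the domain space is the domain of
`K⁻²`, `K` self-adjoint. -/
theorem norm_sqrt_apply_sq_le (ι : X₁ →L[ℂ] X₀) (Q : X₀ →L[ℂ] X₀) (U : X₁ ≃ₗᵢ[ℂ] X₀)
    (hQ : Q.IsPositive) (hQU : ∀ w, Q (Q (U w)) = ι w) (K : Y →L[ℂ] Y) (hK : IsSelfAdjoint K)
    (T₀ : Y →L[ℂ] X₀) (T₁ : Y →L[ℂ] X₁) (hT : ∀ z, T₀ (K (K z)) = ι (T₁ z)) (z : Y) :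
    ‖Q (U (T₁ z))‖ ^ 2 ≤ ‖T₀‖ * ‖T₁‖ * ‖K z‖ ^ 2 := by
  set B : Y →L[ℂ] X₀ := (U.toContinuousLinearEquiv : X₁ →L[ℂ] X₀) ∘L T₁ with hB
  have hBz : ∀ z, B z = U (T₁ z) := fun z => rfl
  have hQB : ∀ z, Q (Q (B z)) = T₀ (K (K z)) := fun z => by rw [hBz, hQU, hT]
  have hQs : ∀ x y, (inner ℂ (Q x) y : ℂ) = inner ℂ x (Q y) := fun x y =>
    (ContinuousLinearMap.isSelfAdjoint_iff_isSymmetric.1 hQ.isSelfAdjoint) x y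
  have hKs : ∀ x y, (inner ℂ (K x) y : ℂ) = inner ℂ x (K y) := fun x y =>
    (ContinuousLinearMap.isSelfAdjoint_iff_isSymmetric.1 hK) x y
  -- Since T₀ K² = Q² B with B = U T₁, the form ⟨K² M x, y⟩ = ⟨B x, T₀ K² y⟩ = ⟨Q B x, Q B y⟩ is
  -- symmetric, so Reid's inequality applies to M = T₀* B. The same identity gives ‖Q B z‖² = ⟨K z,
  -- K M z⟩, and ‖M‖ ≤ ‖T₀‖ ‖T₁‖.
  set M : Y →L[ℂ] Y := ContinuousLinearMap.adjoint T₀ ∘L B with hM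
  have hMz : ∀ x y, (inner ℂ x (M y) : ℂ) = inner ℂ (T₀ x) (B y) := fun x y => by
    rw [hM, ContinuousLinearMap.comp_apply, ContinuousLinearMap.adjoint_inner_right]
  have hMz' : ∀ x y, (inner ℂ (M x) y : ℂ) = inner ℂ (B x) (T₀ y) := fun x y => by
    rw [hM, ContinuousLinearMap.comp_apply, ContinuousLinearMap.adjoint_inner_left]
  have hsym : ∀ x y, (inner ℂ (K (K (M x))) y : ℂ) = inner ℂ (K (K x)) (M y) := by
    intro x y
    rw [hKs, hKs, hMz', hMz, ← hQB, ← hQB, hQs, hQs]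
  have hReid := norm_comp_le_of_symmetrizable K M hK hsym z
  have hMn : ‖M‖ ≤ ‖T₀‖ * ‖T₁‖ := by
    refine (ContinuousLinearMap.opNorm_comp_le _ _).trans ?_
    rw [LinearIsometryEquiv.norm_map]
    refine mul_le_mul_of_nonneg_left ?_ (norm_nonneg _)
    refine ContinuousLinearMap.opNorm_le_bound _ (norm_nonneg _) fun z => ?_
    rw [hBz, LinearIsometryEquiv.norm_map]
    exact T₁.le_opNorm z
  have h1 : ((‖Q (B z)‖ ^ 2 : ℝ) : ℂ) = inner ℂ (K z) (K (M z)) := by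
    rw [← hKs, hMz, ← hQB, hQs, ofReal_norm_sq_eq_inner]
  have h2 : ‖Q (B z)‖ ^ 2 ≤ ‖K z‖ * ‖K (M z)‖ := by
    have h3 := norm_inner_le_norm (𝕜 := ℂ) (K z) (K (M z))
    rw [← h1, Complex.norm_real, Real.norm_of_nonneg (sq_nonneg _)] at h3
    exact h3
  calc ‖Q (U (T₁ z))‖ ^ 2 ≤ ‖K z‖ * (‖M‖ * ‖K z‖) :=
        h2.trans (mul_le_mul_of_nonneg_left hReid (norm_nonneg _))
    _ = ‖M‖ * ‖K z‖ ^ 2 := by ring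
    _ ≤ _ := mul_le_mul_of_nonneg_right hMn (sq_nonneg _)

end HilbertSpace

/-! ### The frequency side of `H^{s,φ}(ℝᵈ)` as a Hilbert space -/

section FrequencySpace

variable {d : ℕ} {φ : ℝ → ℝ}

/-- The Hilbert space of Fourier transforms of elements of `H^{s,φ}(ℝᵈ)`. -/
abbrev FreqSpace (d : ℕ) (s : ℝ) (φ : ℝ → ℝ) : Type := Lp ℂ 2 (freqMeasure d s φ)

/-- The weight is strictly positive, so null sets of the weighted and of Lebesgue measure coincide.
Elements of frequency spaces of different orders can thus be compared almost everywhere with respect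
to one measure. -/
theorem volume_ac_freqMeasure (hφ : ClassM φ) (s : ℝ) :
    (volume : Measure (E d)) ≪ freqMeasure d s φ :=
  withDensity_absolutelyContinuous' (measurable_weight_sq hφ s).aemeasurable
    (Eventually.of_forall fun ξ => by
      rw [ne_eq, ENNReal.ofReal_eq_zero, not_le]
      exact pow_pos (weight_pos hφ s ξ) 2)

theorem freqMeasure_ac_volume (s : ℝ) (φ : ℝ → ℝ) :
    freqMeasure d s φ ≪ (volume : Measure (E d)) :=
  withDensity_absolutelyContinuous _ _

theorem freqNorm_congr {s : ℝ} {g h : E d → ℂ} (hgh : g =ᵐ[volume] h) :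
    freqNorm s φ g = freqNorm s φ h := by
  unfold freqNorm
  congr 1
  exact lintegral_congr_ae (hgh.mono fun ξ hξ => by simp only [hξ])

theorem FreqSpace.ae_volume (hφ : ClassM φ) {s : ℝ} {g h : E d → ℂ}
    (hgh : g =ᵐ[freqMeasure d s φ] h) : g =ᵐ[volume] h :=
  (volume_ac_freqMeasure hφ s).ae_le hgh

theorem FreqSpace.enorm_eq (hφ : ClassM φ) {s : ℝ} (G : FreqSpace d s φ) :
    ‖G‖ₑ = freqNorm s φ G := by
  rw [freqNorm_eq_eLpNorm hφ, Lp.enorm_def]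

theorem memLp_freqMeasure (hφ : ClassM φ) {s : ℝ} {g : E d → ℂ}
    (hg : AEStronglyMeasurable g) (hfin : freqNorm s φ g < ⊤) : MemLp g 2 (freqMeasure d s φ) :=
  ⟨hg.mono_ac (freqMeasure_ac_volume s φ), by rwa [← freqNorm_eq_eLpNorm hφ]⟩

/-- The element of the frequency space that is given by a function with finite norm. -/
def freqMk (hφ : ClassM φ) (s : ℝ) (g : E d → ℂ) (hg : AEStronglyMeasurable g)
    (hfin : freqNorm s φ g < ⊤) : FreqSpace d s φ := (memLp_freqMeasure hφ hg hfin).toLp g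

theorem coeFn_freqMk (hφ : ClassM φ) {s : ℝ} {g : E d → ℂ} (hg : AEStronglyMeasurable g)
    (hfin : freqNorm s φ g < ⊤) : freqMk hφ s g hg hfin =ᵐ[volume] g :=
  FreqSpace.ae_volume hφ (MemLp.coeFn_toLp _)

theorem FreqSpace.ext_ae {s : ℝ} {G H : FreqSpace d s φ}
    (h : (G : E d → ℂ) =ᵐ[volume] H) : G = H :=
  Lp.ext ((freqMeasure_ac_volume s φ).ae_le h)

theorem enorm_freqMk (hφ : ClassM φ) {s : ℝ} {g : E d → ℂ} (hg : AEStronglyMeasurable g)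
    (hfin : freqNorm s φ g < ⊤) : ‖freqMk hφ s g hg hfin‖ₑ = freqNorm s φ g := by
  rw [FreqSpace.enorm_eq hφ, freqNorm_congr (coeFn_freqMk hφ hg hfin)]

theorem FreqSpace.aestronglyMeasurable (hφ : ClassM φ) {s : ℝ} (G : FreqSpace d s φ) :
    AEStronglyMeasurable (G : E d → ℂ) volume :=
  (Lp.aestronglyMeasurable G).mono_ac (volume_ac_freqMeasure hφ s)

theorem freqNorm_mul_le (hφ : ClassM φ) {s t : ℝ} {a : E d → ℂ} {C : NNReal}
    (h : ∀ ξ, weight t φ ξ * ‖a ξ‖ ≤ C * weight s φ ξ) (G : E d → ℂ) :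
    freqNorm t φ (fun ξ => a ξ * G ξ) ≤ C * freqNorm s φ G :=
  freqNorm_le_mul C fun ξ => by
    rw [norm_mul, ← mul_assoc, ← mul_assoc, abs_of_pos (weight_pos hφ t ξ),
      abs_of_pos (weight_pos hφ s ξ)]
    exact mul_le_mul_of_nonneg_right (h ξ) (norm_nonneg _)

theorem freqNorm_mul_lt_top (hφ : ClassM φ) {s t : ℝ} {a : E d → ℂ} {C : NNReal}
    (h : ∀ ξ, weight t φ ξ * ‖a ξ‖ ≤ C * weight s φ ξ) (G : FreqSpace d s φ) :
    freqNorm t φ (fun ξ => a ξ * G ξ) < ⊤ :=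
  (freqNorm_mul_le hφ h G).trans_lt (ENNReal.mul_lt_top ENNReal.coe_lt_top (by
    rw [← FreqSpace.enorm_eq hφ]; exact enorm_lt_top))

/-- Multiplication by a function on the frequency side. -/
def freqMul (hφ : ClassM φ) {s t : ℝ} (a : E d → ℂ) (ha : Measurable a) (C : NNReal)
    (h : ∀ ξ, weight t φ ξ * ‖a ξ‖ ≤ C * weight s φ ξ) : FreqSpace d s φ →L[ℂ] FreqSpace d t φ :=
  have hmem := freqNorm_mul_lt_top hφ h
  have hmeas : ∀ G : FreqSpace d s φ, AEStronglyMeasurable (fun ξ => a ξ * G ξ) volume := fun G =>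
    ha.aestronglyMeasurable.mul (FreqSpace.aestronglyMeasurable hφ G)
  LinearMap.mkContinuous
    { toFun := fun G => freqMk hφ t (fun ξ => a ξ * G ξ) (hmeas G) (hmem G)
      map_add' := fun G H => by
        refine FreqSpace.ext_ae ?_
        filter_upwards [coeFn_freqMk hφ (hmeas (G + H)) (hmem (G + H)),
          coeFn_freqMk hφ (hmeas G) (hmem G), coeFn_freqMk hφ (hmeas H) (hmem H),
          FreqSpace.ae_volume hφ (Lp.coeFn_add G H),
          FreqSpace.ae_volume hφ (Lp.coeFn_add (freqMk hφ t _ (hmeas G) (hmem G))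
            (freqMk hφ t _ (hmeas H) (hmem H)))] with ξ h1 h2 h3 h4 h5
        rw [h1, h5, Pi.add_apply, h2, h3, h4, Pi.add_apply, mul_add]
      map_smul' := fun c G => by
        refine FreqSpace.ext_ae ?_
        filter_upwards [coeFn_freqMk hφ (hmeas (c • G)) (hmem (c • G)),
          coeFn_freqMk hφ (hmeas G) (hmem G),
          FreqSpace.ae_volume hφ (Lp.coeFn_smul c G),
          FreqSpace.ae_volume hφ (Lp.coeFn_smul c (freqMk hφ t _ (hmeas G) (hmem G)))]
          with ξ h1 h2 h3 h4
        rw [RingHom.id_apply, h1, h4, Pi.smul_apply, h2, h3, Pi.smul_apply, smul_eq_mul,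
          smul_eq_mul, mul_left_comm] }
    C (fun G => by
      have h1 : ‖freqMk hφ t (fun ξ => a ξ * G ξ) (hmeas G) (hmem G)‖ₑ ≤ C * ‖G‖ₑ := by
        rw [enorm_freqMk, FreqSpace.enorm_eq hφ]
        exact freqNorm_mul_le hφ h G
      rw [enorm_eq_nnnorm, enorm_eq_nnnorm] at h1
      exact_mod_cast h1)

theorem coeFn_freqMul (hφ : ClassM φ) {s t : ℝ} {a : E d → ℂ} (ha : Measurable a) {C : NNReal}
    (h : ∀ ξ, weight t φ ξ * ‖a ξ‖ ≤ C * weight s φ ξ) (G : FreqSpace d s φ) :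
    freqMul hφ a ha C h G =ᵐ[volume] fun ξ => a ξ * G ξ :=
  coeFn_freqMk hφ (ha.aestronglyMeasurable.mul (FreqSpace.aestronglyMeasurable hφ G))
    (freqNorm_mul_lt_top hφ h G)

/-- The embedding of the frequency spaces with decreasing order. -/
def freqIncl (hφ : ClassM φ) {s t : ℝ} (hst : t ≤ s) : FreqSpace d s φ →L[ℂ] FreqSpace d t φ :=
  freqMul hφ (fun _ => 1) measurable_const 1 (fun ξ => by
    simpa using weight_mono hφ hst ξ)

theorem coeFn_freqIncl (hφ : ClassM φ) {s t : ℝ} (hst : t ≤ s) (G : FreqSpace d s φ) :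
    freqIncl hφ hst G =ᵐ[volume] G :=
  (coeFn_freqMul hφ _ _ G).trans (Eventually.of_forall fun _ => one_mul _)

/-- The Fourier transform, as a map to the frequency space. -/
def freqOfSchwartz (hφ : ClassM φ) (s : ℝ) : 𝓢(E d, ℂ) →ₗ[ℂ] FreqSpace d s φ :=
  haveI := freqMeasure_hasTemperateGrowth (d := d) hφ s
  (SchwartzMap.toLpCLM ℂ ℂ 2 (freqMeasure d s φ)).toLinearMap ∘ₗ
    (FourierTransform.fourierCLM ℂ 𝓢(E d, ℂ) : 𝓢(E d, ℂ) →L[ℂ] 𝓢(E d, ℂ)).toLinearMap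

theorem coeFn_freqOfSchwartz (hφ : ClassM φ) (s : ℝ) (f : 𝓢(E d, ℂ)) :
    freqOfSchwartz hφ s f =ᵐ[volume] (𝓕 f : 𝓢(E d, ℂ)) := by
  have := freqMeasure_hasTemperateGrowth (d := d) hφ s
  exact FreqSpace.ae_volume hφ (SchwartzMap.coeFn_toLp (𝓕 f) 2 (freqMeasure d s φ))

theorem enorm_freqOfSchwartz (hφ : ClassM φ) (s : ℝ) (f : 𝓢(E d, ℂ)) :
    ‖freqOfSchwartz hφ s f‖ₑ = schwartzNorm s φ f := by
  rw [FreqSpace.enorm_eq hφ, freqNorm_congr (coeFn_freqOfSchwartz hφ s f), schwartzNorm]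

/-- The Fourier transform is a bijection of the Schwartz space, so the range is that of the plain
embedding into the weighted L₂ space, which is dense. -/
theorem denseRange_freqOfSchwartz (hφ : ClassM φ) (s : ℝ) :
    DenseRange (freqOfSchwartz (d := d) hφ s) := by
  have := freqMeasure_hasTemperateGrowth (d := d) hφ s
  have := freqMeasure_lt_top_of_isCompact (d := d) hφ s
  have h1 := SchwartzMap.denseRange_toLpCLM (F := ℂ) (μ := freqMeasure d s φ) (p := 2)
    ENNReal.ofNat_ne_top
  have h2 : range (freqOfSchwartz (d := d) hφ s)
      = range (SchwartzMap.toLpCLM ℝ ℂ 2 (freqMeasure d s φ)) := by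
    ext G
    constructor
    · rintro ⟨f, rfl⟩
      exact ⟨𝓕 f, rfl⟩
    · rintro ⟨g, rfl⟩
      refine ⟨𝓕⁻ g, ?_⟩
      change SchwartzMap.toLp (𝓕 (𝓕⁻ g)) 2 (freqMeasure d s φ) = _
      rw [FourierTransform.fourier_fourierInv_eq]
      rfl
  rw [DenseRange, h2]
  exact h1

/-! ### The pairing of the frequency space with Schwartz functions -/

/-- Division by w² passes from the Lebesgue pairing to the inner product of L₂(w² dξ), and it turns
the norm with weight w into the norm with weight 1/w. This is the Riesz representation of the dual
space. -/
theorem freqNorm_conj_div (hφ : ClassM φ) (s : ℝ) (ψ : E d → ℂ) :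
    freqNorm s φ (fun ξ => conj (ψ ξ) / (weight s φ ξ : ℂ) ^ 2)
      = freqNorm (-s) (fun t => (φ t)⁻¹) ψ := by
  unfold freqNorm
  congr 1
  refine lintegral_congr fun ξ => ?_
  have hw := weight_pos hφ s ξ
  have h1 : ∀ (w : ℝ) (z : ℂ), ENNReal.ofReal (w ^ 2) * ‖z‖ₑ ^ 2
      = ENNReal.ofReal (w ^ 2 * ‖z‖ ^ 2) := fun w z => by
    rw [ENNReal.ofReal_mul (by positivity), ENNReal.ofReal_pow (norm_nonneg z), ofReal_norm]
  rw [weight_neg_inv, h1, h1]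
  congr 1
  rw [norm_div, RCLike.norm_conj, norm_pow, Complex.norm_real, Real.norm_of_nonneg hw.le]
  field_simp

theorem freqNorm_schwartz_lt_top (hφ : ClassM φ) (s : ℝ) (ψ : 𝓢(E d, ℂ)) :
    freqNorm s φ ψ < ⊤ := by
  have := freqMeasure_hasTemperateGrowth (d := d) hφ s
  rw [freqNorm_eq_eLpNorm hφ]
  exact ψ.eLpNorm_lt_top 2 _

theorem aestronglyMeasurable_conj_div (hφ : ClassM φ) (s : ℝ) (ψ : 𝓢(E d, ℂ)) :
    AEStronglyMeasurable (fun ξ => conj (ψ ξ) / (weight s φ ξ : ℂ) ^ 2) volume :=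
  ((Complex.measurable_ofReal.comp (measurable_weight hφ s)).pow_const 2
    |> (Complex.continuous_conj.measurable.comp ψ.continuous.measurable).div).aestronglyMeasurable

/-- The element of the frequency space that represents the functional `G ↦ ∫ ψ G`. -/
def pairVec (hφ : ClassM φ) (s : ℝ) (ψ : 𝓢(E d, ℂ)) : FreqSpace d s φ :=
  freqMk hφ s (fun ξ => conj (ψ ξ) / (weight s φ ξ : ℂ) ^ 2)
    (aestronglyMeasurable_conj_div hφ s ψ)
    (by rw [freqNorm_conj_div hφ]; exact freqNorm_schwartz_lt_top hφ.inv (-s) ψ)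

theorem enorm_pairVec (hφ : ClassM φ) (s : ℝ) (ψ : 𝓢(E d, ℂ)) :
    ‖pairVec hφ s ψ‖ₑ = freqNorm (-s) (fun t => (φ t)⁻¹) ψ := by
  rw [pairVec, enorm_freqMk, freqNorm_conj_div hφ]

theorem weight_sq_smul_inner (hφ : ClassM φ) (s : ℝ) (ψ : 𝓢(E d, ℂ)) (G : FreqSpace d s φ) :
    (fun ξ => (ENNReal.ofReal (weight s φ ξ ^ 2)).toReal •
      (inner ℂ (pairVec hφ s ψ ξ) (G ξ) : ℂ)) =ᵐ[volume] fun ξ => ψ ξ * G ξ := by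
  filter_upwards [coeFn_freqMk hφ (aestronglyMeasurable_conj_div hφ s ψ)
    (by rw [freqNorm_conj_div hφ]; exact freqNorm_schwartz_lt_top hφ.inv (-s) ψ)] with ξ hξ
  have hw : (weight s φ ξ : ℂ) ≠ 0 := Complex.ofReal_ne_zero.2 (weight_pos hφ s ξ).ne'
  rw [pairVec, hξ, ENNReal.toReal_ofReal (sq_nonneg _), RCLike.inner_apply, map_div₀, map_pow,
    Complex.conj_conj, Complex.conj_ofReal, Complex.real_smul]
  push_cast
  field_simp

theorem integrable_mul_freq (hφ : ClassM φ) (s : ℝ) (ψ : 𝓢(E d, ℂ)) (G : FreqSpace d s φ) :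
    Integrable fun ξ => ψ ξ * G ξ := by
  have h1 := L2.integrable_inner (𝕜 := ℂ) (pairVec hφ s ψ) G
  exact ((integrable_withDensity_iff_integrable_smul' (measurable_weight_sq hφ s)
    (Eventually.of_forall fun _ => ENNReal.ofReal_lt_top)).1 h1).congr
      (weight_sq_smul_inner hφ s ψ G)

theorem inner_pairVec (hφ : ClassM φ) (s : ℝ) (ψ : 𝓢(E d, ℂ)) (G : FreqSpace d s φ) :
    (inner ℂ (pairVec hφ s ψ) G : ℂ) = ∫ ξ, ψ ξ * G ξ := by
  rw [L2.inner_def]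
  exact (integral_withDensity_eq_integral_toReal_smul (measurable_weight_sq hφ s)
    (Eventually.of_forall fun _ => ENNReal.ofReal_lt_top) _).trans
      (integral_congr_ae (weight_sq_smul_inner hφ s ψ G))

/-- Pair with a bump function that is 1 on the unit ball about the point; such products are
integrable by Cauchy–Schwarz. -/
theorem locallyIntegrable_freq (hφ : ClassM φ) {s : ℝ} (G : FreqSpace d s φ) :
    LocallyIntegrable (G : E d → ℂ) volume := by
  intro x
  let b : ContDiffBump x := ⟨1, 2, one_pos, one_lt_two⟩
  have hbs : ContDiff ℝ ∞ fun y => (b y : ℂ) := Complex.ofRealCLM.contDiff.comp b.contDiff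
  have hbc : HasCompactSupport fun y => (b y : ℂ) :=
    b.hasCompactSupport.comp_left (g := fun t : ℝ => (t : ℂ)) Complex.ofReal_zero
  refine ⟨Metric.closedBall x 1, Metric.closedBall_mem_nhds x one_pos, ?_⟩
  have h1 := (integrable_mul_freq hφ s (hbc.toSchwartzMap hbs) G).integrableOn
    (s := Metric.closedBall x 1)
  refine h1.congr_fun (fun y hy => ?_) Metric.isClosed_closedBall.measurableSet
  change (b y : ℂ) * G y = G y
  rw [b.one_of_mem_closedBall hy, Complex.ofReal_one, one_mul]

/-- Cauchy–Schwarz bounds the pairing by the norm of ψ in the L₂ space with weight 1/w, into which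
the Schwartz space embeds continuously. By linearity, continuity at 0 suffices. -/
theorem continuous_integral_mul_freq (hφ : ClassM φ) {s : ℝ} (G : FreqSpace d s φ) :
    Continuous fun ψ : 𝓢(E d, ℂ) => ∫ ξ, ψ ξ * G ξ := by
  have := freqMeasure_hasTemperateGrowth (d := d) hφ.inv (-s)
  set T := SchwartzMap.toLpCLM ℂ ℂ 2 (freqMeasure d (-s) fun t => (φ t)⁻¹)
  let Φ : 𝓢(E d, ℂ) →ₗ[ℂ] ℂ :=
    { toFun := fun ψ => ∫ ξ, ψ ξ * G ξ
      map_add' := fun ψ ψ' => by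
        rw [← integral_add (integrable_mul_freq hφ s ψ G) (integrable_mul_freq hφ s ψ' G)]
        refine integral_congr_ae (Eventually.of_forall fun ξ => ?_)
        simp [add_mul]
      map_smul' := fun c ψ => by
        rw [RingHom.id_apply, smul_eq_mul, ← integral_const_mul]
        refine integral_congr_ae (Eventually.of_forall fun ξ => ?_)
        simp [mul_assoc] }
  have hle : ∀ ψ, ‖Φ ψ‖ ≤ ‖T ψ‖ * ‖G‖ := fun ψ => by
    have h1 : Φ ψ = inner ℂ (pairVec hφ s ψ) G := (inner_pairVec hφ s ψ G).symm
    have h2 : ‖pairVec hφ s ψ‖ = ‖T ψ‖ := by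
      have h3 : ‖pairVec hφ s ψ‖ₑ = ‖T ψ‖ₑ := by
        rw [enorm_pairVec, FreqSpace.enorm_eq hφ.inv]
        exact (freqNorm_congr (FreqSpace.ae_volume hφ.inv (SchwartzMap.coeFn_toLp ψ 2 _))).symm
      rw [enorm_eq_nnnorm, enorm_eq_nnnorm, ENNReal.coe_inj] at h3
      exact congrArg NNReal.toReal h3
    rw [h1, ← h2]
    exact norm_inner_le_norm _ _
  have h0 : ContinuousAt Φ 0 := by
    rw [ContinuousAt, map_zero]
    refine squeeze_zero_norm hle ?_
    have h1 : Continuous fun ψ => ‖T ψ‖ * ‖G‖ := by fun_prop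
    have h2 := h1.tendsto 0
    rwa [map_zero, norm_zero, zero_mul] at h2
  exact continuous_of_continuousAt_zero Φ h0

/-- Every element of the frequency space is the Fourier transform of a distribution. -/
theorem exists_hasFourierDensity (hφ : ClassM φ) {s : ℝ} (G : FreqSpace d s φ) :
    ∃ w : 𝓢'(E d, ℂ), HasFourierDensity w G := by
  let Φ : 𝓢(E d, ℂ) →L[ℂ] ℂ :=
    { toFun := fun ψ => ∫ ξ, ψ ξ * G ξ
      map_add' := fun ψ ψ' => by
        rw [← integral_add (integrable_mul_freq hφ s ψ G) (integrable_mul_freq hφ s ψ' G)]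
        refine integral_congr_ae (Eventually.of_forall fun ξ => ?_)
        simp [add_mul]
      map_smul' := fun c ψ => by
        rw [RingHom.id_apply, smul_eq_mul, ← integral_const_mul]
        refine integral_congr_ae (Eventually.of_forall fun ξ => ?_)
        simp [mul_assoc]
      cont := continuous_integral_mul_freq hφ G }
  let w : 𝓢'(E d, ℂ) := ContinuousLinearMap.toPointwiseConvergenceCLM _ _ _ _ Φ
  refine ⟨𝓕⁻ w, locallyIntegrable_freq hφ G, fun ψ => ?_⟩
  rw [FourierTransform.fourier_fourierInv_eq]
  rfl

end FrequencySpace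

/-! ### Compatible Hilbert space realizations of pairs of seminorms -/

/-- Realization of two squared Hilbert seminorms on `C^∞` by maps to Hilbert spaces, the second of
which is continuously embedded in the first. -/
structure HilbertRealization (n : ℕ) (A₀ A₁ : smoothFn n → ℝ≥0∞) where
  G₀ : Type
  G₁ : Type
  [nacg₀ : NormedAddCommGroup G₀]
  [ips₀ : InnerProductSpace ℂ G₀]
  [cs₀ : CompleteSpace G₀]
  [nacg₁ : NormedAddCommGroup G₁]
  [ips₁ : InnerProductSpace ℂ G₁]
  [cs₁ : CompleteSpace G₁]
  j₀ : smoothFn n →ₗ[ℂ] G₀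
  j₁ : smoothFn n →ₗ[ℂ] G₁
  ι : G₁ →L[ℂ] G₀
  inj : Function.Injective ι
  comm : ∀ u, ι (j₁ u) = j₀ u
  norm_j₀ : ∀ u, ‖j₀ u‖ₑ ^ 2 = A₀ u
  norm_j₁ : ∀ u, ‖j₁ u‖ₑ ^ 2 = A₁ u

attribute [instance] HilbertRealization.nacg₀ HilbertRealization.ips₀ HilbertRealization.cs₀
  HilbertRealization.nacg₁ HilbertRealization.ips₁ HilbertRealization.cs₁

section Realization

variable {n : ℕ}

theorem enorm_sq_eq_ofReal {X : Type*} [NormedAddCommGroup X] (x : X) :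
    ‖x‖ₑ ^ 2 = ENNReal.ofReal (‖x‖ ^ 2) := by
  rw [ENNReal.ofReal_pow (norm_nonneg x), ofReal_norm]

theorem enorm_sq_prod {X X' : Type*} [NormedAddCommGroup X] [NormedAddCommGroup X']
    (x : WithLp 2 (X × X')) : ‖x‖ₑ ^ 2 = ‖x.fst‖ₑ ^ 2 + ‖x.snd‖ₑ ^ 2 := by
  rw [enorm_sq_eq_ofReal, enorm_sq_eq_ofReal, enorm_sq_eq_ofReal, WithLp.prod_norm_sq_eq_of_L2,
    ENNReal.ofReal_add (sq_nonneg _) (sq_nonneg _)]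

/-- The realization of the zero seminorms. -/
def HilbertRealization.zero : HilbertRealization n (fun _ => 0) (fun _ => 0) where
  G₀ := EuclideanSpace ℂ (Fin 0)
  G₁ := EuclideanSpace ℂ (Fin 0)
  j₀ := 0
  j₁ := 0
  ι := ContinuousLinearMap.id ℂ _
  inj := Function.injective_id
  comm _ := rfl
  norm_j₀ _ := by simp
  norm_j₁ _ := by simp

/-- The realization of the sums of squared seminorms. -/
def HilbertRealization.add {A₀ A₁ B₀ B₁ : smoothFn n → ℝ≥0∞} (H : HilbertRealization n A₀ A₁)
    (K : HilbertRealization n B₀ B₁) :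
    HilbertRealization n (fun u => A₀ u + B₀ u) (fun u => A₁ u + B₁ u) where
  G₀ := WithLp 2 (H.G₀ × K.G₀)
  G₁ := WithLp 2 (H.G₁ × K.G₁)
  j₀ := (WithLp.linearEquiv 2 ℂ (H.G₀ × K.G₀)).symm.toLinearMap ∘ₗ H.j₀.prod K.j₀
  j₁ := (WithLp.linearEquiv 2 ℂ (H.G₁ × K.G₁)).symm.toLinearMap ∘ₗ H.j₁.prod K.j₁
  ι := (WithLp.prodContinuousLinearEquiv 2 ℂ H.G₀ K.G₀).symm.toContinuousLinearMap ∘L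
    (H.ι.prodMap K.ι) ∘L (WithLp.prodContinuousLinearEquiv 2 ℂ H.G₁ K.G₁).toContinuousLinearMap
  inj := by
    intro x y hxy
    have h1 := congrArg WithLp.fst hxy
    have h2 := congrArg WithLp.snd hxy
    have h3 : x.fst = y.fst := H.inj h1
    have h4 : x.snd = y.snd := K.inj h2
    exact WithLp.ofLp_injective 2 (Prod.ext h3 h4)
  comm u := WithLp.ofLp_injective 2 (Prod.ext (H.comm u) (K.comm u))
  norm_j₀ u := by
    rw [enorm_sq_prod, ← H.norm_j₀, ← K.norm_j₀]
    rfl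
  norm_j₁ u := by
    rw [enorm_sq_prod, ← H.norm_j₁, ← K.norm_j₁]
    rfl

theorem nonempty_realization_sum {κ : Type*} (J : Finset κ) {A₀ A₁ : κ → smoothFn n → ℝ≥0∞}
    (h : ∀ i ∈ J, Nonempty (HilbertRealization n (A₀ i) (A₁ i))) :
    Nonempty (HilbertRealization n (fun u => ∑ i ∈ J, A₀ i u) (fun u => ∑ i ∈ J, A₁ i u)) := by
  classical
  induction J using Finset.induction_on with
  | empty => exact ⟨HilbertRealization.zero⟩
  | insert a J ha ih =>
    obtain ⟨H⟩ := h a (Finset.mem_insert_self a J)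
    obtain ⟨K⟩ := ih fun i hi => h i (Finset.mem_insert_of_mem hi)
    simp only [Finset.sum_insert ha]
    exact ⟨H.add K⟩

end Realization

/-! ### The quotient norm of H^{s,φ}(U) as the norm of an orthogonal projection. -/

section QuotientNorm

variable {d : ℕ} {φ : ℝ → ℝ}

/-- The orthogonal complement, on the frequency side, of the distributions that vanish in `U`. -/
def visibleSpace (hφ : ClassM φ) (s : ℝ) (U : Set (E d)) : Submodule ℂ (FreqSpace d s φ) :=
  (Submodule.span ℂ {e | ∃ ψ : 𝓢(E d, ℂ), tsupport ψ ⊆ U ∧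
    e = pairVec hφ s (𝓕⁻ ψ)}).topologicalClosure

instance (hφ : ClassM φ) (s : ℝ) (U : Set (E d)) : CompleteSpace (visibleSpace hφ s U) :=
  (Submodule.isClosed_topologicalClosure _).completeSpace_coe

theorem pairVec_mem_visibleSpace (hφ : ClassM φ) (s : ℝ) {U : Set (E d)} {ψ : 𝓢(E d, ℂ)}
    (hψ : tsupport ψ ⊆ U) : pairVec hφ s (𝓕⁻ ψ) ∈ visibleSpace hφ s U :=
  Submodule.le_topologicalClosure _ (Submodule.subset_span ⟨ψ, hψ, rfl⟩)

/-- By Parseval, orthogonality to the generators means that the distribution with transform G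
vanishes on test functions supported in U. The criterion does not involve s, which makes the visible
spaces of different orders compatible. -/
theorem mem_orthogonal_visibleSpace_iff (hφ : ClassM φ) (s : ℝ) {U : Set (E d)}
    {G : FreqSpace d s φ} : G ∈ (visibleSpace hφ s U)ᗮ ↔
      ∀ ψ : 𝓢(E d, ℂ), tsupport ψ ⊆ U → ∫ ξ, (𝓕⁻ ψ : 𝓢(E d, ℂ)) ξ * G ξ = 0 := by
  constructor
  · intro hG ψ hψ
    rw [← inner_pairVec hφ]
    exact Submodule.inner_right_of_mem_orthogonal (pairVec_mem_visibleSpace hφ s hψ) hG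
  · intro h
    rw [visibleSpace, Submodule.orthogonal_closure, Submodule.mem_orthogonal]
    intro e he
    induction he using Submodule.span_induction with
    | mem e he =>
      obtain ⟨ψ, hψ, rfl⟩ := he
      rw [inner_pairVec, h ψ hψ]
    | zero => exact inner_zero_left _
    | add x y _ _ hx hy => rw [inner_add_left, hx, hy, add_zero]
    | smul c x _ hx => rw [inner_smul_left, hx, mul_zero]

theorem integral_fourierInv_mul_density {w : 𝓢'(E d, ℂ)} {g : E d → ℂ} (h : HasFourierDensity w g)
    (ψ : 𝓢(E d, ℂ)) : ∫ ξ, (𝓕⁻ ψ : 𝓢(E d, ℂ)) ξ * g ξ = w ψ := by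
  rw [← h.2, TemperedDistribution.fourier_apply, FourierTransform.fourier_fourierInv_eq]

theorem integral_fourierInv_mul_freqOfSchwartz (hφ : ClassM φ) (s : ℝ) (ψ f : 𝓢(E d, ℂ)) :
    ∫ ξ, (𝓕⁻ ψ : 𝓢(E d, ℂ)) ξ * freqOfSchwartz hφ s f ξ = (f : 𝓢'(E d, ℂ)) ψ := by
  rw [← integral_fourierInv_mul_density (hasFourierDensity_coe f) ψ]
  refine integral_congr_ae ((coeFn_freqOfSchwartz hφ s f).mono fun ξ hξ => ?_)
  simp only [hξ]

/-- The norm in `H^{s,φ}(U)` is the norm of the projection to the visible space. -/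
theorem enorm_projection_eq_hNormOn (hφ : ClassM φ) (s : ℝ) {U : Set (E d)} {f : 𝓢(E d, ℂ)}
    {g : E d → ℂ} (hfg : AgreesOn U (f : 𝓢'(E d, ℂ)) g) :
    ‖(visibleSpace hφ s U).orthogonalProjectionOnto (freqOfSchwartz hφ s f)‖ₑ
      = hNormOn U s φ g := by
  set M := visibleSpace hφ s U with hM
  set G := freqOfSchwartz hφ s f with hG
  apply le_antisymm
  · refine le_iInf₂ fun w hw => le_iInf₂ fun g' hg' => ?_
    change _ ≤ freqNorm s φ g'
    rcases eq_or_ne (freqNorm s φ g') ⊤ with htop | htop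
    · rw [htop]; exact le_top
    have hg'm : AEStronglyMeasurable g' volume := hg'.1.aestronglyMeasurable
    set G' := freqMk hφ s g' hg'm (lt_top_iff_ne_top.2 htop) with hG'
    -- Two extensions of the same function differ by a distribution that vanishes in U, so they have
    -- the same projection, whose norm is at most that of either extension.
    have h1 : G - G' ∈ Mᗮ := by
      rw [mem_orthogonal_visibleSpace_iff]
      intro ψ hψ
      have h2 : ∫ ξ, (𝓕⁻ ψ : 𝓢(E d, ℂ)) ξ * G' ξ = w ψ := by
        rw [← integral_fourierInv_mul_density hg' ψ]
        refine integral_congr_ae ((coeFn_freqMk hφ hg'm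
          (lt_top_iff_ne_top.2 htop)).mono fun ξ hξ => ?_)
        simp only [hG', hξ]
      rw [← inner_pairVec hφ, inner_sub_right, inner_pairVec, inner_pairVec, h2,
        integral_fourierInv_mul_freqOfSchwartz, hfg ψ hψ, hw ψ hψ, sub_self]
    have h3 : M.orthogonalProjectionOnto G = M.orthogonalProjectionOnto G' := by
      rw [← sub_eq_zero, ← map_sub]
      exact Submodule.orthogonalProjectionOnto_apply_of_mem_orthogonal h1
    rw [h3, ← enorm_freqMk hφ hg'm (lt_top_iff_ne_top.2 htop), ← hG']
    have h4 := M.norm_orthogonalProjectionOnto_apply_le G'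
    rw [enorm_eq_nnnorm, enorm_eq_nnnorm]
    exact_mod_cast h4
  -- The projection is itself the transform of an extension, since its pairings with test functions
  -- in U are unchanged. Hence the infimum is attained.
  · set PG : FreqSpace d s φ := (M.orthogonalProjectionOnto G : FreqSpace d s φ) with hPG
    obtain ⟨w, hw⟩ := exists_hasFourierDensity hφ PG
    have h1 : AgreesOn U w g := by
      intro ψ hψ
      have h2 : (inner ℂ (pairVec hφ s (𝓕⁻ ψ)) PG : ℂ) = inner ℂ (pairVec hφ s (𝓕⁻ ψ)) G := by
        have h3 := Submodule.inner_orthogonalProjectionOnto_eq_of_mem_left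
          (⟨_, pairVec_mem_visibleSpace hφ s hψ⟩ : M) G
        rw [← h3]
        rfl
      rw [← integral_fourierInv_mul_density hw ψ, ← inner_pairVec hφ, h2, inner_pairVec,
        integral_fourierInv_mul_freqOfSchwartz, hfg ψ hψ]
    have h2 : hNormOn U s φ g ≤ hNorm s φ w := iInf₂_le w h1
    refine h2.trans ((hNorm_le_freqNorm s φ hw).trans (le_of_eq ?_))
    rw [← FreqSpace.enorm_eq hφ]
    rfl

/-- The norms in `H^{s,φ}(U)` and `H^{t,φ}(U)`, `t ≤ s`, of functions that are given by a linear
family of Schwartz functions. -/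
theorem nonempty_realization_hNormOn {n : ℕ} (hφ : ClassM φ) {s t : ℝ} (hts : t ≤ s)
    (U : Set (E d)) (L : smoothFn n →ₗ[ℂ] 𝓢(E d, ℂ)) (g : smoothFn n → E d → ℂ)
    (hL : ∀ u, AgreesOn U (L u : 𝓢'(E d, ℂ)) (g u)) :
    Nonempty (HilbertRealization n (fun u => hNormOn U t φ (g u) ^ 2)
      (fun u => hNormOn U s φ (g u) ^ 2)) := by
  set M₀ := visibleSpace hφ t U with hM₀
  set M₁ := visibleSpace hφ s U with hM₁
  have hpair : ∀ (ψ : 𝓢(E d, ℂ)) (G : FreqSpace d s φ),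
      ∫ ξ, (𝓕⁻ ψ : 𝓢(E d, ℂ)) ξ * freqIncl hφ hts G ξ = ∫ ξ, (𝓕⁻ ψ : 𝓢(E d, ℂ)) ξ * G ξ := by
    intro ψ G
    refine integral_congr_ae ((coeFn_freqIncl hφ hts G).mono fun ξ hξ => ?_)
    simp only [hξ]
  -- Vanishing in U does not depend on the order. This gives both injectivity of the induced map (an
  -- element of M₁ sent to 0 lies in M₁ and in M₁ᗮ) and its compatibility with the projections.
  have horth : ∀ G : FreqSpace d s φ, freqIncl hφ hts G ∈ M₀ᗮ ↔ G ∈ M₁ᗮ := by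
    intro G
    rw [mem_orthogonal_visibleSpace_iff, mem_orthogonal_visibleSpace_iff]
    simp only [hpair]
  have hincl : ∀ f : 𝓢(E d, ℂ), freqIncl hφ hts (freqOfSchwartz hφ s f)
      = freqOfSchwartz hφ t f := fun f => by
    refine FreqSpace.ext_ae ?_
    filter_upwards [coeFn_freqIncl hφ hts (freqOfSchwartz hφ s f), coeFn_freqOfSchwartz hφ s f,
      coeFn_freqOfSchwartz hφ t f] with ξ h1 h2 h3
    rw [h1, h2, h3]
  refine ⟨{
    G₀ := M₀
    G₁ := M₁
    j₀ := M₀.orthogonalProjectionOnto.toLinearMap ∘ₗ freqOfSchwartz hφ t ∘ₗ L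
    j₁ := M₁.orthogonalProjectionOnto.toLinearMap ∘ₗ freqOfSchwartz hφ s ∘ₗ L
    ι := M₀.orthogonalProjectionOnto ∘L freqIncl hφ hts ∘L M₁.subtypeL
    inj := ?_
    comm := ?_
    norm_j₀ := fun u => ?_
    norm_j₁ := fun u => ?_ }⟩
  · rw [injective_iff_map_eq_zero]
    intro x hx
    have h1 : freqIncl hφ hts (x : FreqSpace d s φ) ∈ M₀ᗮ :=
      Submodule.orthogonalProjectionOnto_eq_zero_iff.1 hx
    rw [horth] at h1
    have h2 : (inner ℂ (x : FreqSpace d s φ) (x : FreqSpace d s φ) : ℂ) = 0 :=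
      Submodule.inner_right_of_mem_orthogonal x.2 h1
    exact Subtype.ext (inner_self_eq_zero.1 h2)
  · intro u
    change M₀.orthogonalProjectionOnto (freqIncl hφ hts
      (M₁.orthogonalProjectionOnto (freqOfSchwartz hφ s (L u)) : FreqSpace d s φ))
      = M₀.orthogonalProjectionOnto (freqOfSchwartz hφ t (L u))
    rw [← hincl, ← sub_eq_zero, ← map_sub, ← map_sub]
    refine Submodule.orthogonalProjectionOnto_apply_of_mem_orthogonal ?_
    rw [horth, ← neg_mem_iff, neg_sub]
    exact Submodule.sub_starProjection_mem_orthogonal _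
  · rw [← enorm_projection_eq_hNormOn hφ t (hL u)]
    rfl
  · rw [← enorm_projection_eq_hNormOn hφ s (hL u)]
    rfl

end QuotientNorm

/-! ### Smoothness of the field of normals -/

section Normals

variable {n : ℕ}

/-- The inner product is the derivative of t ↦ ρ(x + t v) at 0, and this function starts from the
value 0. -/
theorem eventually_pos_of_inner_gradient_pos {ρ : E n → ℝ} (hρ : ContDiff ℝ ∞ ρ) {x : E n}
    (hx : ρ x = 0) {v : E n} (hv : 0 < inner ℝ (gradient ρ x) v) :
    ∀ᶠ t : ℝ in 𝓝[>] 0, 0 < ρ (x + t • v) := by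
  have hd : DifferentiableAt ℝ ρ x := hρ.contDiffAt.differentiableAt (by simp)
  have h1 : HasDerivAt (fun t : ℝ => ρ (x + t • v)) (inner ℝ (gradient ρ x) v) 0 := by
    have h2 : HasDerivAt (fun t : ℝ => x + t • v) v 0 := by
      simpa using ((hasDerivAt_id (0 : ℝ)).smul_const v).const_add x
    have h3 : HasFDerivAt ρ (fderiv ℝ ρ x) (x + (0 : ℝ) • v) := by
      simpa using hd.hasFDerivAt
    have h4 := h3.comp_hasDerivAt (0 : ℝ) h2
    rw [gradient, InnerProductSpace.toDual_symm_apply]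
    exact h4
  have h5 := (hasDerivWithinAt_iff_tendsto_slope' (s := Ioi (0 : ℝ)) (by simp)).1
    h1.hasDerivWithinAt
  filter_upwards [h5.eventually (lt_mem_nhds hv), self_mem_nhdsWithin] with t ht ht0
  rw [slope_def_field] at ht
  simp only [zero_smul, add_zero, hx, sub_zero] at ht
  exact (div_pos_iff_of_pos_right ht0).1 ht

/-- If the unit gradients a', b' differed, then along v = a' - b' the function ρ₁ would increase and
ρ₂ decrease to first order. A short move along v would lie in Ω according to ρ₁ and outside it
according to ρ₂. -/
theorem unit_gradient_eq {Ω : Set (E n)} {x : E n} (hx : x ∈ frontier Ω) {ρ₁ ρ₂ : E n → ℝ}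
    (h₁ : IsLocalDefiningFunction Ω x ρ₁) (h₂ : IsLocalDefiningFunction Ω x ρ₂) :
    ‖gradient ρ₁ x‖⁻¹ • gradient ρ₁ x = ‖gradient ρ₂ x‖⁻¹ • gradient ρ₂ x := by
  obtain ⟨hs₁, hg₁, he₁⟩ := h₁
  obtain ⟨hs₂, hg₂, he₂⟩ := h₂
  set a := gradient ρ₁ x
  set b := gradient ρ₂ x
  have ha : 0 < ‖a‖ := norm_pos_iff.2 hg₁
  have hb : 0 < ‖b‖ := norm_pos_iff.2 hg₂
  by_contra hne
  set v := ‖a‖⁻¹ • a - ‖b‖⁻¹ • b with hv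
  have hna : ‖‖a‖⁻¹ • a‖ = 1 := norm_smul_inv_norm (𝕜 := ℝ) hg₁
  have hnb : ‖‖b‖⁻¹ • b‖ = 1 := norm_smul_inv_norm (𝕜 := ℝ) hg₂
  have hlt : inner ℝ (‖a‖⁻¹ • a) (‖b‖⁻¹ • b) < 1 := (inner_lt_one_iff_real_of_norm_eq_one hna hnb).2 hne
  have hav : 0 < inner ℝ a v := by
    have h1 : inner ℝ (‖a‖⁻¹ • a) v = ‖a‖⁻¹ * inner ℝ a v := real_inner_smul_left _ _ _
    have h2 : inner ℝ (‖a‖⁻¹ • a) v = 1 - inner ℝ (‖a‖⁻¹ • a) (‖b‖⁻¹ • b) := by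
      rw [hv, inner_sub_right, real_inner_self_eq_norm_sq, hna, one_pow]
    have h3 : 0 < ‖a‖⁻¹ * inner ℝ a v := by rw [← h1, h2]; linarith
    exact (mul_pos_iff_of_pos_left (inv_pos.2 ha)).1 h3
  have hbv : 0 < inner ℝ b (-v) := by
    have h1 : inner ℝ (‖b‖⁻¹ • b) (-v) = ‖b‖⁻¹ * inner ℝ b (-v) := real_inner_smul_left _ _ _
    have h2 : inner ℝ (‖b‖⁻¹ • b) (-v) = 1 - inner ℝ (‖a‖⁻¹ • a) (‖b‖⁻¹ • b) := by
      rw [hv, neg_sub, inner_sub_right, real_inner_self_eq_norm_sq, hnb, one_pow, real_inner_comm]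
    have h3 : 0 < ‖b‖⁻¹ * inner ℝ b (-v) := by rw [← h1, h2]; linarith
    exact (mul_pos_iff_of_pos_left (inv_pos.2 hb)).1 h3
  have hneg : ContDiff ℝ ∞ fun y => -ρ₂ y := hs₂.neg
  have hx₁ : ρ₁ x = 0 := he₁.self_of_nhds.2.1 hx
  have hx₂ : ρ₂ x = 0 := he₂.self_of_nhds.2.1 hx
  have hgn : gradient (fun y => -ρ₂ y) x = -b := by
    rw [gradient, fderiv_fun_neg, map_neg]
    rfl
  have e1 := eventually_pos_of_inner_gradient_pos hs₁ hx₁ hav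
  have e2 := eventually_pos_of_inner_gradient_pos hneg (by rw [hx₂, neg_zero]) (v := v) (by
    rw [hgn, inner_neg_left, ← inner_neg_right]; exact hbv)
  have hlim : Tendsto (fun t : ℝ => x + t • v) (𝓝[>] 0) (𝓝 x) := by
    have h1 : Continuous fun t : ℝ => x + t • v := by fun_prop
    have h2 := (h1.tendsto 0).mono_left (nhdsWithin_le_nhds (s := Ioi 0))
    simpa using h2
  obtain ⟨t, ht1, ht2, ht3, ht4⟩ :=
    (e1.and (e2.and ((hlim.eventually he₁).and (hlim.eventually he₂)))).exists
  have h3 : 0 < ρ₂ (x + t • v) := ht4.1.1 (ht3.1.2 ht1)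
  linarith

variable {Ω : SmoothDomain n}

theorem normal_eq {x : E n} (hx : x ∈ Ω.bdry) {ρ : E n → ℝ}
    (h : IsLocalDefiningFunction Ω.carrier x ρ) :
    Ω.normal x = ‖gradient ρ x‖⁻¹ • gradient ρ x := by
  have hx' : x ∈ frontier Ω.carrier := hx
  rw [SmoothDomain.normal, dif_pos hx']
  exact unit_gradient_eq hx' (Ω.smooth_boundary x hx').choose_spec h

theorem contDiff_gradient {ρ : E n → ℝ} (hρ : ContDiff ℝ ∞ ρ) : ContDiff ℝ ∞ (gradient ρ) := by
  have h1 : ContDiff ℝ ∞ (fderiv ℝ ρ) := hρ.fderiv_right (by simp)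
  exact (InnerProductSpace.toDual ℝ (E n)).symm.toContinuousLinearEquiv.contDiff.comp h1

/-- One local defining function serves all boundary points near a given one, and the normal is
independent of the choice. So near each point the normal is a normalized smooth gradient. -/
theorem contDiff_normal_comp (𝒜 : BoundaryAtlas Ω) (j : Fin 𝒜.κ) :
    ContDiff ℝ ∞ fun y => Ω.normal (𝒜.α j y) := by
  rw [contDiff_iff_contDiffAt]
  intro y
  have hy : 𝒜.α j y ∈ frontier Ω.carrier := mem_bdry_α 𝒜 j y
  obtain ⟨ρ, hρ⟩ := Ω.smooth_boundary _ hy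
  have hg := contDiff_gradient hρ.1
  have hev : ∀ᶠ x in 𝓝 (𝒜.α j y), x ∈ Ω.bdry →
      Ω.normal x = ‖gradient ρ x‖⁻¹ • gradient ρ x := by
    filter_upwards [hρ.2.2.eventually_nhds,
      hg.continuous.continuousAt.eventually_ne hρ.2.1] with x h1 h2 hx
    exact normal_eq hx ⟨hρ.1, h2, h1⟩
  have hα := (𝒜.smooth_α j).continuous.continuousAt (x := y)
  have h3 : (fun y => Ω.normal (𝒜.α j y)) =ᶠ[𝓝 y]
      fun y => ‖gradient ρ (𝒜.α j y)‖⁻¹ • gradient ρ (𝒜.α j y) := by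
    filter_upwards [hα.eventually hev] with z hz
    exact hz (mem_bdry_α 𝒜 j z)
  refine ContDiffAt.congr_of_eventuallyEq ?_ h3
  have h4 : ContDiffAt ℝ ∞ (fun y => gradient ρ (𝒜.α j y)) y :=
    (hg.comp (𝒜.smooth_α j)).contDiffAt
  exact ((h4.norm ℝ hρ.2.1).inv (norm_ne_zero_iff.2 hρ.2.1)).smul h4

/-- Expanding v(y) in the standard basis turns the evaluation into a finite sum of products of
smooth functions. -/
theorem contDiff_multilinear_apply {d k : ℕ}
    {f : E d → ContinuousMultilinearMap ℝ (fun _ : Fin k => E n) ℂ} (hf : ContDiff ℝ ∞ f)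
    {v : E d → E n} (hv : ContDiff ℝ ∞ v) : ContDiff ℝ ∞ fun y => f y fun _ => v y := by
  have h1 : ∀ y, (f y fun _ => v y) = ∑ r : Fin k → Fin n,
      (∏ i, v y (r i)) • f y fun i => EuclideanSpace.single (r i) (1 : ℝ) := fun y => by
    have h2 : v y = ∑ i, v y i • EuclideanSpace.single i (1 : ℝ) := by
      have h3 := (EuclideanSpace.basisFun (Fin n) ℝ).sum_repr (v y)
      simpa using h3.symm
    conv_lhs => rw [h2]
    rw [ContinuousMultilinearMap.map_sum]
    exact Finset.sum_congr rfl fun r _ => (f y).map_smul_univ _ _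
  simp only [h1]
  refine ContDiff.sum fun r _ => ?_
  have h4 : ContDiff ℝ ∞ fun y => ∏ i, v y (r i) :=
    contDiff_prod fun i _ => (contDiff_euclidean.1 hv) (r i)
  have h5 : ContDiff ℝ ∞ fun y => f y fun i => EuclideanSpace.single (r i) (1 : ℝ) :=
    (ContinuousMultilinearMap.apply ℝ (fun _ : Fin k => E n) ℂ
      fun i => EuclideanSpace.single (r i) (1 : ℝ)).contDiff.comp hf
  exact h4.smul h5

theorem contDiff_localRep_normalDeriv (𝒜 : BoundaryAtlas Ω) (j : Fin 𝒜.κ) (k : ℕ) {u : E n → ℂ}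
    (hu : ContDiff ℝ ∞ u) : ContDiff ℝ ∞ (𝒜.localRep j (normalDeriv Ω k u)) := by
  have h1 : ContDiff ℝ ∞ (iteratedFDeriv ℝ k u) :=
    hu.iteratedFDeriv_right (m := ∞) (i := k) le_rfl
  have h2 := contDiff_multilinear_apply (h1.comp (𝒜.smooth_α j)) (contDiff_normal_comp 𝒜 j)
  have h3 : ContDiff ℝ ∞ fun y => (𝒜.χ j (𝒜.α j y) : ℂ) :=
    Complex.ofRealCLM.contDiff.comp ((𝒜.smooth_χ j).comp (𝒜.smooth_α j))
  exact h3.mul (contDiff_const.mul h2)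

theorem isCompact_closure (Ω : SmoothDomain n) : IsCompact (closure Ω.carrier) :=
  Metric.isCompact_of_isClosed_isBounded isClosed_closure Ω.isBounded.closure

/-- The support of χ_j on Γ is compact and lies in the range of the embedding α_j, so its preimage
is compact. Together with smoothness this makes local representations of traces Schwartz functions.
-/
theorem hasCompactSupport_localRep (𝒜 : BoundaryAtlas Ω) (j : Fin 𝒜.κ) (h : E n → ℂ) :
    HasCompactSupport (𝒜.localRep j h) := by
  have hb : closure (Ω.bdry ∩ Function.support (𝒜.χ j)) ⊆ closure Ω.carrier :=
    closure_minimal (inter_subset_left.trans frontier_subset_closure) isClosed_closure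
  have h1 : IsCompact (closure (Ω.bdry ∩ Function.support (𝒜.χ j))) :=
    (isCompact_closure Ω).of_isClosed_subset isClosed_closure hb
  have h2 := ((𝒜.embedding j).isInducing.isCompact_preimage_iff (𝒜.supp_χ j)).2 h1
  refine HasCompactSupport.intro h2 fun y hy => ?_
  have h3 : 𝒜.χ j (𝒜.α j y) = 0 := by
    by_contra hne
    exact hy (subset_closure ⟨mem_bdry_α 𝒜 j y, hne⟩)
  rw [BoundaryAtlas.localRep, h3, Complex.ofReal_zero, zero_mul]

end Normals

/-! ### Realization of the norms `directNorm` -/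

section DirectRealization

variable {n : ℕ} {Ω : SmoothDomain n} {φ : ℝ → ℝ}

/-- A linear family of test functions as a linear map to the Schwartz space. -/
def toSchwartzLinear {d : ℕ} (M : smoothFn n →ₗ[ℂ] (E d → ℂ)) (hs : ∀ u, ContDiff ℝ ∞ (M u))
    (hc : ∀ u, HasCompactSupport (M u)) : smoothFn n →ₗ[ℂ] 𝓢(E d, ℂ) where
  toFun u := (hc u).toSchwartzMap (hs u)
  map_add' u v := by
    ext y
    exact congrFun (map_add M u v) y
  map_smul' c u := by
    ext y
    exact congrFun (map_smul M c u) y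

theorem iteratedFDeriv_coe_add (k : ℕ) (u v : smoothFn n) (x : E n) :
    iteratedFDeriv ℝ k (u + v : E n → ℂ) x
      = iteratedFDeriv ℝ k (u : E n → ℂ) x + iteratedFDeriv ℝ k (v : E n → ℂ) x := by
  have hu : ContDiff ℝ ∞ (u : E n → ℂ) := u.2
  have hv : ContDiff ℝ ∞ (v : E n → ℂ) := v.2
  exact iteratedFDeriv_add_apply (hu.contDiffAt.of_le (by exact_mod_cast le_top))
    (hv.contDiffAt.of_le (by exact_mod_cast le_top))

theorem iteratedFDeriv_coe_smul (k : ℕ) (c : ℂ) (u : smoothFn n) (x : E n) :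
    iteratedFDeriv ℝ k (c • (u : E n → ℂ)) x = c • iteratedFDeriv ℝ k (u : E n → ℂ) x := by
  have hu : ContDiff ℝ ∞ (u : E n → ℂ) := u.2
  exact iteratedFDeriv_const_smul_apply (hu.contDiffAt.of_le (by exact_mod_cast le_top))

/-- The local representation of a normal derivative, as a linear map. -/
def localRepNormalDeriv (𝒜 : BoundaryAtlas Ω) (j : Fin 𝒜.κ) (k : ℕ) :
    smoothFn n →ₗ[ℂ] (E (n - 1) → ℂ) where
  toFun u := 𝒜.localRep j (normalDeriv Ω k u)
  map_add' u v := by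
    funext y
    simp only [BoundaryAtlas.localRep, normalDeriv, Pi.add_apply, Submodule.coe_add,
      iteratedFDeriv_coe_add, add_apply]
    ring
  map_smul' c u := by
    funext y
    simp only [BoundaryAtlas.localRep, normalDeriv, Pi.smul_apply, Submodule.coe_smul,
      iteratedFDeriv_coe_smul, smul_apply, smul_eq_mul, RingHom.id_apply]
    ring

theorem exists_cutoff {U K : Set (E n)} (hK : IsCompact K) (hU : IsOpen U) (hKU : K ⊆ U) :
    ∃ η : E n → ℂ, ContDiff ℝ ∞ η ∧ HasCompactSupport η ∧ tsupport η ⊆ U ∧ ∀ x ∈ K, η x = 1 := by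
  obtain ⟨K', hK', hKK', hK'U⟩ := exists_compact_between hK hU hKU
  obtain ⟨f, hf, _, hfs, hf1⟩ := exists_contMDiff_support_eq_eq_one_iff
    (modelWithCornersSelf ℝ (E n)) (n := ⊤) (isOpen_interior (s := K')) hK.isClosed hKK'
  have hts : tsupport (fun x => (f x : ℂ)) ⊆ K' := by
    refine closure_minimal (fun x hx => ?_) hK'.isClosed
    have hx' : x ∈ Function.support f := fun h => hx (by simp [h])
    rw [hfs] at hx'
    exact interior_subset hx'
  refine ⟨fun x => f x, Complex.ofRealCLM.contDiff.comp hf.contDiff,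
    hK'.of_isClosed_subset (isClosed_tsupport _) hts, hts.trans hK'U, fun x hx => ?_⟩
  simp only [(hf1 x).1 hx, Complex.ofReal_one]

/-- The pair of norms `directNorm` of neighbouring orders is realized in Hilbert spaces. -/
theorem nonempty_realization_directNorm (𝒜 : BoundaryAtlas Ω) (hφ : ClassM φ) {s t : ℝ}
    (ht : 0 ≤ t) (hts : t ≤ s) (k : ℕ) :
    Nonempty (HilbertRealization n (fun u => directNorm 𝒜 t φ k u ^ 2)
      (fun u => directNorm 𝒜 s φ k u ^ 2)) := by
  have hsq : ∀ a : ℝ≥0∞, (a ^ (1 / 2 : ℝ)) ^ 2 = a := fun a => by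
    rw [← ENNReal.rpow_natCast, ← ENNReal.rpow_mul]; simp
  have hs : 0 ≤ s := ht.trans hts
  -- Both orders are nonnegative, so the interior norms are quotient norms and not negative norms.
  simp only [directNorm, hsq, zeroNorm, if_pos ht, if_pos hs, bdryNorm]
  -- Multiplication by a test function equal to 1 on the closure of Ω is a linear choice of Schwartz
  -- extensions for all smooth functions.
  obtain ⟨η, hη, hηc, -, hη1⟩ := exists_cutoff (isCompact_closure Ω) isOpen_univ (subset_univ _)
  let M : smoothFn n →ₗ[ℂ] (E n → ℂ) :=
    { toFun := fun u x => η x * (u : E n → ℂ) x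
      map_add' := fun u v => funext fun x => mul_add _ _ _
      map_smul' := fun c u => funext fun x => mul_left_comm _ _ _ }
  have hMs : ∀ u, ContDiff ℝ ∞ (M u) := fun u => by
    have hu : ContDiff ℝ ∞ (u : E n → ℂ) := u.2
    exact hη.mul hu
  have hMc : ∀ u, HasCompactSupport (M u) := fun u => hηc.mul_right
  obtain ⟨H⟩ := nonempty_realization_hNormOn (n := n) hφ hts Ω.carrier (toSchwartzLinear M hMs hMc)
    (fun u => (u : E n → ℂ)) (fun u => agreesOn_coe Ω.isOpen.measurableSet fun x hx => by
      change η x * (u : E n → ℂ) x = _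
      rw [hη1 x (subset_closure hx), one_mul])
  obtain ⟨K⟩ := nonempty_realization_sum (n := n) (Finset.range k)
    (A₀ := fun j u => ∑ i, hNormOn univ (t - (j + 1) + 1 / 2) φ
      (𝒜.localRep i (normalDeriv Ω j u)) ^ 2)
    (A₁ := fun j u => ∑ i, hNormOn univ (s - (j + 1) + 1 / 2) φ
      (𝒜.localRep i (normalDeriv Ω j u)) ^ 2)
    (fun j _ => nonempty_realization_sum Finset.univ fun i _ =>
      nonempty_realization_hNormOn hφ (by linarith) univ
        (toSchwartzLinear (localRepNormalDeriv 𝒜 i j)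
          (fun u => contDiff_localRep_normalDeriv 𝒜 i j u.2)
          (fun u => hasCompactSupport_localRep 𝒜 i _)) _
        (fun u => agreesOn_coe MeasurableSet.univ fun x _ => rfl))
  exact ⟨H.add K⟩

end DirectRealization

/-! ### The interpolation norms of functions with support in `Ω` -/

section Interpolation

variable {n : ℕ}

/-- A realization in Hilbert spaces yields compatible completions. -/
theorem HilbertRealization.exists_completions {N₀ N₁ : (E n → ℂ) → ℝ≥0∞}
    (H : HilbertRealization n (fun u => N₀ u ^ 2) (fun u => N₁ u ^ 2)) :
    ∃ (X₀ : HilbertCompletion N₀) (X₁ : HilbertCompletion N₁) (ι : X₁.X →L[ℂ] X₀.X),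
      Function.Injective ι ∧ ∀ v, ι (X₁.j v) = X₀.j v := by
  have hsq : ∀ a b : ℝ≥0∞, a ^ 2 = b ^ 2 → a = b := fun a b h =>
    le_antisymm (sq_le_sq_iff_ennreal.1 h.le) (sq_le_sq_iff_ennreal.1 h.ge)
  have hd : ∀ {G : Type} [NormedAddCommGroup G] [InnerProductSpace ℂ G]
      (j : smoothFn n →ₗ[ℂ] G), DenseRange (j.codRestrict (LinearMap.range j).topologicalClosure
        fun u => Submodule.le_topologicalClosure _ (LinearMap.mem_range_self j u)) := by
    intro G _ _ j x
    rw [closure_subtype, ← range_comp]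
    exact x.2
  let X₀ : HilbertCompletion N₀ :=
    { X := (LinearMap.range H.j₀).topologicalClosure
      completeSpace := (Submodule.isClosed_topologicalClosure _).completeSpace_coe
      j := H.j₀.codRestrict _
        fun u => Submodule.le_topologicalClosure _ (LinearMap.mem_range_self H.j₀ u)
      dense := hd H.j₀
      norm_j := fun u => hsq _ _ (H.norm_j₀ u) }
  let X₁ : HilbertCompletion N₁ :=
    { X := (LinearMap.range H.j₁).topologicalClosure
      completeSpace := (Submodule.isClosed_topologicalClosure _).completeSpace_coe
      j := H.j₁.codRestrict _
        fun u => Submodule.le_topologicalClosure _ (LinearMap.mem_range_self H.j₁ u)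
      dense := hd H.j₁
      norm_j := fun u => hsq _ _ (H.norm_j₁ u) }
  have hmem : ∀ x : (LinearMap.range H.j₁).topologicalClosure,
      (H.ι ∘L (LinearMap.range H.j₁).topologicalClosure.subtypeL) x
        ∈ (LinearMap.range H.j₀).topologicalClosure := by
    rintro ⟨x, hx⟩
    have hmaps : MapsTo H.ι (LinearMap.range H.j₁ : Set _) (LinearMap.range H.j₀ : Set _) := by
      rintro _ ⟨u, rfl⟩
      exact ⟨u, (H.comm u).symm⟩
    have hcl := map_mem_closure H.ι.continuous hx hmaps
    exact hcl
  let ι : X₁.X →L[ℂ] X₀.X :=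
    (H.ι ∘L (LinearMap.range H.j₁).topologicalClosure.subtypeL).codRestrict _ hmem
  refine ⟨X₀, X₁, ι, fun x y hxy => ?_, fun v => Subtype.ext (H.comm v)⟩
  exact Subtype.ext (H.inj (congrArg Subtype.val hxy))

variable {d : ℕ} {φ : ℝ → ℝ}

theorem isSelfAdjoint_freqMul (hφ : ClassM φ) {s : ℝ} {a : E d → ℝ}
    (ha : Measurable fun ξ => (a ξ : ℂ)) {C : NNReal}
    (h : ∀ ξ, weight s φ ξ * ‖(a ξ : ℂ)‖ ≤ C * weight s φ ξ) :
    IsSelfAdjoint (freqMul hφ (fun ξ => (a ξ : ℂ)) ha C h) := by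
  rw [ContinuousLinearMap.isSelfAdjoint_iff_isSymmetric]
  intro x y
  change (inner ℂ (freqMul hφ _ ha C h x) y : ℂ) = inner ℂ x (freqMul hφ _ ha C h y)
  rw [L2.inner_def, L2.inner_def]
  refine integral_congr_ae ((freqMeasure_ac_volume s φ).ae_le ?_)
  filter_upwards [coeFn_freqMul hφ ha h x, coeFn_freqMul hφ ha h y] with ξ h1 h2
  simp only [h1, h2, RCLike.inner_apply, map_mul, Complex.conj_ofReal]
  ring

theorem measurable_bracket_rpow (r : ℝ) : Measurable fun ξ : E d => ((bracket ξ ^ r : ℝ) : ℂ) :=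
  Complex.measurable_ofReal.comp (continuous_bracket.measurable.pow_const r)

theorem weight_mul_norm_bracket (s r : ℝ) (φ : ℝ → ℝ) (ξ : E d) :
    weight s φ ξ * ‖((bracket ξ ^ r : ℝ) : ℂ)‖ = weight (s + r) φ ξ := by
  rw [Complex.norm_real, Real.norm_of_nonneg (Real.rpow_nonneg (bracket_pos ξ).le r), weight_add,
    mul_comm]

theorem bracket_rpow_mul (r r' : ℝ) (ξ : E d) :
    ((bracket ξ ^ r : ℝ) : ℂ) * ((bracket ξ ^ r' : ℝ) : ℂ) = ((bracket ξ ^ (r + r') : ℝ) : ℂ) := by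
  rw [← Complex.ofReal_mul, ← Real.rpow_add (bracket_pos ξ)]

theorem toReal_enorm_le {X X' : Type*} [NormedAddCommGroup X] [NormedAddCommGroup X'] {x : X}
    {y : X'} {C : NNReal} (h : ‖x‖ₑ ≤ C * ‖y‖ₑ) : ‖x‖ ≤ C * ‖y‖ := by
  rw [enorm_eq_nnnorm, enorm_eq_nnnorm] at h
  exact_mod_cast h

/-- Multiplication by a test function in `Ω` maps `H^{s,φ}(ℝⁿ)` to the interpolation space. -/
theorem exists_halfInterpNorm_mul_le {Ω : SmoothDomain n} (𝒜 : BoundaryAtlas Ω) (hφ : ClassM φ)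
    {s : ℝ} (hs : 1 / 2 ≤ s) (k : ℕ) (θ : 𝓢(E n, ℂ)) (hθ : tsupport θ ⊆ Ω.carrier) :
    ∃ C : NNReal, ∀ f : 𝓢(E n, ℂ),
      halfInterpNorm (directNorm 𝒜 (s - 1 / 2) φ k) (directNorm 𝒜 (s + 1 / 2) φ k)
        (SchwartzMap.smulLeftCLM ℂ θ f) ≤ C * schwartzNorm s φ f := by
  set t := s - 1 / 2 with ht
  set s' := s + 1 / 2 with hs'
  have hts : t ≤ s' := by linarith
  obtain ⟨H⟩ := nonempty_realization_directNorm 𝒜 hφ (show 0 ≤ t by linarith) hts k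
  obtain ⟨X₀, X₁, ι, hinj, hι⟩ := H.exists_completions
  have hιd : DenseRange ι := by
    refine DenseRange.of_comp (g := X₁.j) ?_
    have : ι ∘ X₁.j = X₀.j := funext hι
    rw [this]
    exact X₀.dense
  obtain ⟨Q, U, hQ, hgen, hQU⟩ := exists_inverseGeneratingOperator ι hinj hιd
  let S : 𝓢(E n, ℂ) →ₗ[ℂ] smoothFn n :=
    { toFun := fun f => ⟨SchwartzMap.smulLeftCLM ℂ θ f, SchwartzMap.smooth _ ⊤⟩
      map_add' := fun f g => Subtype.ext (by simp)
      map_smul' := fun c f => Subtype.ext (by simp) }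
  have hSsupp : ∀ f, tsupport (SchwartzMap.smulLeftCLM ℂ θ f) ⊆ Ω.carrier := fun f =>
    (SchwartzMap.tsupport_smulLeftCLM_subset (θ : E n → ℂ) f).trans (inter_subset_right.trans hθ)
  obtain ⟨C₀, hC₀⟩ := hasOrder_mul θ t φ hφ
  obtain ⟨C₁, hC₁⟩ := hasOrder_mul θ s' φ hφ
  rw [sub_zero] at hC₀ hC₁
  have hb₀ : ∀ f, ‖(X₀.j ∘ₗ S) f‖ ≤ C₀ * ‖freqOfSchwartz hφ t f‖ := fun f => toReal_enorm_le (by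
    rw [LinearMap.comp_apply, X₀.norm_j, enorm_freqOfSchwartz]
    exact (directNorm_le_schwartzNorm 𝒜 hφ t k (hSsupp f)).trans (hC₀ f))
  have hb₁ : ∀ f, ‖(X₁.j ∘ₗ S) f‖ ≤ C₁ * ‖freqOfSchwartz hφ s' f‖ := fun f => toReal_enorm_le (by
    rw [LinearMap.comp_apply, X₁.norm_j, enorm_freqOfSchwartz]
    exact (directNorm_le_schwartzNorm 𝒜 hφ s' k (hSsupp f)).trans (hC₁ f))
  set T₀ := (X₀.j ∘ₗ S).extendOfNorm (freqOfSchwartz hφ t) with hT₀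
  set T₁ := (X₁.j ∘ₗ S).extendOfNorm (freqOfSchwartz hφ s') with hT₁
  have hT₀f : ∀ f, T₀ (freqOfSchwartz hφ t f) = X₀.j (S f) := fun f =>
    LinearMap.extendOfNorm_eq (denseRange_freqOfSchwartz hφ t) ⟨C₀, hb₀⟩ f
  have hT₁f : ∀ f, T₁ (freqOfSchwartz hφ s' f) = X₁.j (S f) := fun f =>
    LinearMap.extendOfNorm_eq (denseRange_freqOfSchwartz hφ s') ⟨C₁, hb₁⟩ f
  have hincl : ∀ f : 𝓢(E n, ℂ), freqIncl hφ hts (freqOfSchwartz hφ s' f)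
      = freqOfSchwartz hφ t f := fun f => by
    refine FreqSpace.ext_ae ?_
    filter_upwards [coeFn_freqIncl hφ hts (freqOfSchwartz hφ s' f), coeFn_freqOfSchwartz hφ s' f,
      coeFn_freqOfSchwartz hφ t f] with ξ h1 h2 h3
    rw [h1, h2, h3]
  have hcomm : ∀ w, T₀ (freqIncl hφ hts w) = ι (T₁ w) := by
    intro w
    refine (denseRange_freqOfSchwartz hφ s').induction_on
      (p := fun w => T₀ (freqIncl hφ hts w) = ι (T₁ w)) w
      (isClosed_eq (by fun_prop) (by fun_prop)) fun f => ?_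
    rw [hincl, hT₀f, hT₁f, hι]
  -- On the space of order t = s - 1/2 let K be multiplication by ⟨2πξ⟩^{-1/2}. Then K² is the
  -- isometry V onto the space of order t + 1 = s + 1/2 followed by the embedding, so the range of K
  -- is the space of the middle order s. The operator J inverts V.
  have hK : ∀ ξ : E n, weight t φ ξ * ‖((bracket ξ ^ (-(1 / 2) : ℝ) : ℝ) : ℂ)‖
      ≤ (1 : NNReal) * weight t φ ξ := fun ξ => by
    rw [weight_mul_norm_bracket, NNReal.coe_one, one_mul]
    exact weight_mono hφ (by linarith) ξ
  have hV : ∀ ξ : E n, weight s' φ ξ * ‖((bracket ξ ^ (-1 : ℝ) : ℝ) : ℂ)‖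
      ≤ (1 : NNReal) * weight t φ ξ := fun ξ => by
    rw [weight_mul_norm_bracket, NNReal.coe_one, one_mul]
    exact weight_mono hφ (by linarith) ξ
  have hJ : ∀ ξ : E n, weight t φ ξ * ‖((bracket ξ ^ (1 : ℝ) : ℝ) : ℂ)‖
      ≤ (1 : NNReal) * weight s' φ ξ := fun ξ => by
    rw [weight_mul_norm_bracket, NNReal.coe_one, one_mul]
    exact weight_mono hφ (by linarith) ξ
  set K := freqMul hφ _ (measurable_bracket_rpow (-(1 / 2))) 1 hK with hKdef
  set V := freqMul hφ _ (measurable_bracket_rpow (-1)) 1 hV with hVdef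
  set J := freqMul hφ _ (measurable_bracket_rpow 1) 1 hJ with hJdef
  have hKK : ∀ z, K (K z) = freqIncl hφ hts (V z) := fun z => by
    refine FreqSpace.ext_ae ?_
    filter_upwards [coeFn_freqMul hφ (measurable_bracket_rpow (-(1 / 2))) hK (K z),
      coeFn_freqMul hφ (measurable_bracket_rpow (-(1 / 2))) hK z,
      coeFn_freqIncl hφ hts (V z), coeFn_freqMul hφ (measurable_bracket_rpow (-1)) hV z]
      with ξ h1 h2 h3 h4
    rw [h1, h2, h3, h4, ← mul_assoc, bracket_rpow_mul]
    norm_num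
  have hmain := norm_sqrt_apply_sq_le ι Q U hQ hQU K (isSelfAdjoint_freqMul hφ _ _) T₀ (T₁ ∘L V)
    (fun z => by rw [hKK, hcomm]; rfl)
  refine ⟨(Real.sqrt (‖T₀‖ * ‖T₁ ∘L V‖)).toNNReal, fun f => ?_⟩
  -- This z satisfies V z = 𝓕f, so T₁ V z is the class of θ f, and K z = ⟨2πξ⟩^{1/2} 𝓕f has in order
  -- s - 1/2 exactly the norm of f in order s.
  set z := J (freqOfSchwartz hφ s' f) with hz
  have hVz : V z = freqOfSchwartz hφ s' f := by
    refine FreqSpace.ext_ae ?_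
    filter_upwards [coeFn_freqMul hφ (measurable_bracket_rpow (-1)) hV z,
      coeFn_freqMul hφ (measurable_bracket_rpow 1) hJ (freqOfSchwartz hφ s' f)] with ξ h1 h2
    rw [h1, h2, ← mul_assoc, bracket_rpow_mul]
    norm_num
  have hKz : ‖K z‖ₑ = schwartzNorm s φ f := by
    rw [FreqSpace.enorm_eq hφ, schwartzNorm]
    have h1 : (K z : E n → ℂ) =ᵐ[volume]
        fun ξ => ((bracket ξ ^ (1 / 2 : ℝ) : ℝ) : ℂ) * (𝓕 f : 𝓢(E n, ℂ)) ξ := by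
      filter_upwards [coeFn_freqMul hφ (measurable_bracket_rpow (-(1 / 2))) hK z,
        coeFn_freqMul hφ (measurable_bracket_rpow 1) hJ (freqOfSchwartz hφ s' f),
        coeFn_freqOfSchwartz hφ s' f] with ξ h1 h2 h3
      rw [h1, h2, h3, ← mul_assoc, bracket_rpow_mul]
      norm_num
    rw [freqNorm_congr h1]
    unfold freqNorm
    congr 1
    refine lintegral_congr fun ξ => ?_
    have h2 : weight s φ ξ = bracket ξ ^ (1 / 2 : ℝ) * weight t φ ξ := by
      rw [← weight_add, ht, sub_add_cancel]
    have h3 : ‖((bracket ξ ^ (1 / 2 : ℝ) : ℝ) : ℂ)‖ₑ ^ 2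
        = ENNReal.ofReal ((bracket ξ ^ (1 / 2 : ℝ)) ^ 2) := by
      rw [enorm_sq_eq_ofReal, Complex.norm_real, Real.norm_eq_abs, sq_abs]
    rw [enorm_mul, mul_pow, ← mul_assoc, h2, h3, mul_pow,
      ← ENNReal.ofReal_mul (sq_nonneg _), mul_comm (weight t φ ξ ^ 2)]
  have hz' := hmain z
  have hTz : (T₁ ∘L V) z = X₁.j (S f) := by
    rw [ContinuousLinearMap.comp_apply, hVz, hT₁f]
  rw [hTz] at hz'
  set y := Q (U (X₁.j (S f))) with hy
  have hy1 : ‖y‖ₑ ≤ ((Real.sqrt (‖T₀‖ * ‖T₁ ∘L V‖)).toNNReal : ℝ≥0∞) * ‖K z‖ₑ := by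
    have h1 : ‖y‖ ≤ Real.sqrt (‖T₀‖ * ‖T₁ ∘L V‖) * ‖K z‖ := by
      refine le_of_sq_le_sq ?_ (by positivity)
      rw [mul_pow, Real.sq_sqrt (by positivity)]
      exact hz'
    rw [← ofReal_norm, ← ofReal_norm, ← ENNReal.ofReal, ← ENNReal.ofReal_mul (Real.sqrt_nonneg _)]
    exact ENNReal.ofReal_le_ofReal h1
  rw [hKz] at hy1
  -- The interpolation norm is an infimum over all admissible completions and operators, so the
  -- realization constructed here suffices. The vector y is a preimage under Q because Q² U = ι.
  refine le_trans (sInf_le ?_) hy1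
  refine ⟨X₀, X₁, ι, Q, hι, hQ, hgen, (S f).2, y, ?_, rfl⟩
  rw [hy, hQU, hι]
  rfl

open Classical in
/-- Multiplication by a test function in `Ω` maps `H^{s,φ}(ℝⁿ)` to `H^{s,φ,(k)}(Ω)`. -/
theorem exists_roitbergNorm_mul_le {Ω : SmoothDomain n} (𝒜 : BoundaryAtlas Ω) (hφ : ClassM φ)
    (s : ℝ) (k : ℕ) (θ : 𝓢(E n, ℂ)) (hθ : tsupport θ ⊆ Ω.carrier) :
    ∃ C : NNReal, ∀ f : 𝓢(E n, ℂ),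
      roitbergNorm 𝒜 s φ k (SchwartzMap.smulLeftCLM ℂ θ f) ≤ C * schwartzNorm s φ f := by
  unfold roitbergNorm
  split_ifs with hexc
  -- Exceptional orders are at least 1/2, so both neighbouring orders are nonnegative.
  · obtain ⟨j, hj1, -, hj⟩ := hexc
    refine exists_halfInterpNorm_mul_le 𝒜 hφ ?_ k θ hθ
    have : (1 : ℝ) ≤ j := by exact_mod_cast hj1
    linarith
  · obtain ⟨C, hC⟩ := hasOrder_mul θ s φ hφ
    rw [sub_zero] at hC
    refine ⟨C, fun f => (directNorm_le_schwartzNorm 𝒜 hφ s k ?_).trans (hC f)⟩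
    exact (SchwartzMap.tsupport_smulLeftCLM_subset (θ : E n → ℂ) f).trans
      (inter_subset_right.trans hθ)

end Interpolation

/-! ### Reduction to a pairing -/

section Pairing

variable {n d : ℕ} {φ : ℝ → ℝ}

/-- `f` is a Cauchy sequence in `H^{s,φ}(ℝᵈ)`. -/
def IsSchwartzCauchy (s : ℝ) (φ : ℝ → ℝ) (f : ℕ → 𝓢(E d, ℂ)) : Prop :=
  ∀ ε : ℝ≥0∞, 0 < ε → ∃ M, ∀ m l, M ≤ m → M ≤ l → schwartzNorm s φ (f m - f l) < ε

theorem exists_pos_coe_mul_lt (C : NNReal) {ε : ℝ≥0∞} (hε : 0 < ε) :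
    ∃ ε' : ℝ≥0∞, 0 < ε' ∧ ∀ a, a < ε' → C * a < ε := by
  have h1 : Tendsto (fun a : ℝ≥0∞ => C * a) (𝓝 0) (𝓝 (C * 0)) :=
    ENNReal.Tendsto.const_mul tendsto_id (Or.inr ENNReal.coe_ne_top)
  rw [mul_zero] at h1
  obtain ⟨b, hb, hb'⟩ := ENNReal.nhds_zero_basis.eventually_iff.1 (h1.eventually_lt_const hε)
  exact ⟨b, hb, fun a ha => hb' ha⟩

theorem IsSchwartzCauchy.map {s t : ℝ} {f : ℕ → 𝓢(E d, ℂ)} (hf : IsSchwartzCauchy s φ f)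
    (hφ : ClassM φ) {T : 𝓢(E d, ℂ) →ₗ[ℂ] 𝓢(E d, ℂ)} (hT : HasOrder t T) :
    IsSchwartzCauchy (s - t) φ fun m => T (f m) := by
  intro ε hε
  obtain ⟨C, hC⟩ := hT s φ hφ
  obtain ⟨ε', hε', h⟩ := exists_pos_coe_mul_lt C hε
  obtain ⟨M, hM⟩ := hf ε' hε'
  refine ⟨M, fun m l hm hl => ?_⟩
  rw [← map_sub]
  exact (hC _).trans_lt (h _ (hM m l hm hl))

theorem isSchwartzCauchy_of_tendsto (hφ : ClassM φ) {s : ℝ} {f : ℕ → 𝓢(E d, ℂ)}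
    {G : FreqSpace d s φ} (h : Tendsto (fun m => freqOfSchwartz hφ s (f m)) atTop (𝓝 G)) :
    IsSchwartzCauchy s φ f := by
  intro ε hε
  obtain ⟨M, hM⟩ := EMetric.cauchySeq_iff.1 h.cauchySeq ε hε
  refine ⟨M, fun m l hm hl => ?_⟩
  rw [← enorm_freqOfSchwartz hφ, map_sub, ← edist_eq_enorm_sub]
  exact hM m hm l hl

variable {Ω : SmoothDomain n} (𝒜 : BoundaryAtlas Ω)

theorem IsSchwartzCauchy.isRoitbergCauchy {s : ℝ} {f : ℕ → 𝓢(E n, ℂ)}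
    (hf : IsSchwartzCauchy s φ f) (hφ : ClassM φ) (k : ℕ) {θ : 𝓢(E n, ℂ)}
    (hθ : tsupport θ ⊆ Ω.carrier) :
    IsRoitbergCauchy 𝒜 s φ k fun m => SchwartzMap.smulLeftCLM ℂ θ (f m) := by
  refine ⟨fun m => SchwartzMap.smooth _ ⊤, fun ε hε => ?_⟩
  obtain ⟨C, hC⟩ := exists_roitbergNorm_mul_le 𝒜 hφ s k θ hθ
  obtain ⟨ε', hε', h⟩ := exists_pos_coe_mul_lt C hε
  obtain ⟨M, hM⟩ := hf ε' hε'
  refine ⟨M, fun m l hm hl => ?_⟩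
  have h1 : (⇑(SchwartzMap.smulLeftCLM ℂ θ (f m)) - ⇑(SchwartzMap.smulLeftCLM ℂ θ (f l)))
      = ⇑(SchwartzMap.smulLeftCLM ℂ θ (f m - f l)) := by
    rw [map_sub]
    rfl
  rw [h1]
  exact (hC _).trans_lt (h _ (hM m l hm hl))

/-- Only the norm of the zero function matters; the multiplication estimate with θ = 0 and f = 0
shows that it is 0. -/
theorem sameElement_refl (hφ : ClassM φ) (k : ℕ) (u : ℕ → E n → ℂ) : SameElement 𝒜 k u u := by
  refine ⟨0, φ, hφ, ?_⟩
  obtain ⟨C, hC⟩ := exists_roitbergNorm_mul_le 𝒜 hφ 0 k 0 (by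
    have h1 : tsupport (⇑(0 : 𝓢(E n, ℂ))) = ∅ := tsupport_eq_empty_iff.2 rfl
    rw [h1]
    exact empty_subset _)
  have h2 := hC 0
  rw [schwartzNorm_zero, mul_zero, map_zero] at h2
  have h3 : ∀ m, roitbergNorm 𝒜 0 φ k (u m - u m) = 0 := fun m => by
    rw [sub_self]
    exact le_antisymm h2 bot_le
  simp only [h3, tendsto_const_nhds]

theorem memBdry_of_eq_zero (s : ℝ) (φ : ℝ → ℝ) {h : ℕ → E n → ℂ}
    (hh : ∀ m, ∀ x ∈ Ω.bdry, h m x = 0) : MemBdry 𝒜 s φ h := by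
  intro j
  refine ⟨((0 : 𝓢(E (n - 1), ℂ)) : 𝓢'(E (n - 1), ℂ)), ?_, fun ψ => ?_⟩
  · refine (hNorm_coe_le s φ 0).trans_lt ?_
    rw [schwartzNorm_zero]
    exact ENNReal.zero_lt_top
  · simp [localRep_eq_zero 𝒜 j (hh _)]

theorem tsupport_mul_subset (η f : 𝓢(E n, ℂ)) :
    tsupport (SchwartzMap.smulLeftCLM ℂ η f) ⊆ tsupport η :=
  (SchwartzMap.tsupport_smulLeftCLM_subset (η : E n → ℂ) f).trans inter_subset_right

theorem mul_apply (η f : 𝓢(E n, ℂ)) (x : E n) : SchwartzMap.smulLeftCLM ℂ η f x = η x * f x := by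
  rw [SchwartzMap.smulLeftCLM_apply_apply η.hasTemperateGrowth, smul_eq_mul]

/-- A function from `H^{s,φ}(ℝⁿ)`, multiplied by a test function in `Ω₀`, has data in the local
space. -/
theorem memDataLoc_mul (hφ : ClassM φ) {q : ℕ} (P : BoundaryProblem n q) {V : Set (E n)}
    {s : ℝ} {f : ℕ → 𝓢(E n, ℂ)} (hf : IsSchwartzCauchy s φ f) {η θ : 𝓢(E n, ℂ)}
    (hθc : HasCompactSupport θ) (hθ : tsupport θ ⊆ Ω.carrier)
    (hηθ : ∀ x ∈ tsupport η, θ x = 1) :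
    P.MemDataLoc 𝒜 V s φ fun m => SchwartzMap.smulLeftCLM ℂ η (f m) := by
  have hηs : tsupport η ⊆ Ω.carrier := fun x hx => hθ (subset_tsupport _ (by
    rw [Function.mem_support, hηθ x hx]
    exact one_ne_zero))
  refine ⟨fun χ hχ => ?_, fun j χ _ => ?_⟩
  -- As θ = 1 on the support of η, the data χ A(η f) equal θ · (θ χ A)(η f). The inner θ gives the
  -- operator compactly supported coefficients; the outer one puts the result in the form required
  -- by the estimate of the norms on Ω.
  · obtain ⟨T, hT, hTx⟩ := exists_hasOrder_diffOp (2 * q) P.smooth_a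
      (θ := fun x => θ x * χ x) ((θ.smooth ⊤).mul hχ.1) hθc.mul_right
    have h1 : cutoffMul χ (fun l => P.opA (SchwartzMap.smulLeftCLM ℂ η (f l)))
        = fun m => ⇑(SchwartzMap.smulLeftCLM ℂ θ (T (SchwartzMap.smulLeftCLM ℂ η (f m)))) := by
      funext m x
      rw [mul_apply, hTx, cutoffMul, BoundaryProblem.opA]
      by_cases hx : x ∈ tsupport η
      · rw [hηθ x hx]
        ring
      · rw [diffOp_eq_zero_of_notMem_tsupport _ _ fun h => hx (tsupport_mul_subset η _ h)]
        ring
    rw [h1]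
    refine ⟨_, ?_, sameElement_refl 𝒜 hφ _ _⟩
    have h2 := (hf.map hφ (hasOrder_mul η)).map hφ hT
    have h3 : s - 0 - ((2 * q : ℕ) : ℝ) = s - 2 * q := by push_cast; ring
    rw [h3] at h2
    exact h2.isRoitbergCauchy 𝒜 hφ _ hθ
  -- The functions vanish near Γ, hence so do all boundary data.
  · refine memBdry_of_eq_zero 𝒜 _ φ fun m x hx => ?_
    rw [cutoffMul, BoundaryProblem.opB, diffOp_eq_zero_of_notMem_tsupport _ _ fun h =>
      bdry_subset_compl Ω hx (hηs (tsupport_mul_subset η _ h)), mul_zero]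

open Classical in
-- Whether or not Γ₀ is empty, the definition supplies a function of class C^p in the open set Ω
-- that represents the distributional limit. Nothing else from it is needed.
theorem MemCp.exists_distribLimit {V : Set (E n)} {r p : ℕ} {u : ℕ → E n → ℂ}
    (h : MemCp 𝒜 V r p u) {χ : E n → ℂ} (hχ : IsCutoff Ω V χ) :
    ∃ f, ContDiffOn ℝ p f Ω.carrier ∧ IsDistribLimit Ω (cutoffMul χ u) f := by
  unfold MemCp at h
  split_ifs at h
  · obtain ⟨-, f, hf, hl⟩ := h χ hχ
    exact ⟨f, hf.1, hl⟩
  · exact (h χ hχ).2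

/-- If the regularity assertion holds, all elements of `H^{s,φ}(ℝⁿ)` are of class `C^p` in a ball. -/
theorem exists_contDiffOn_pairing (hφ : ClassM φ) {q : ℕ} (P : BoundaryProblem n q)
    {V : Set (E n)} (hV : IsOpen V) (hVΩ : (Ω.carrier ∩ V).Nonempty) {p : ℕ} {s : ℝ}
    (himp : ∀ u : ℕ → E n → ℂ, MemNegInfty 𝒜 P.r u → P.MemDataLoc 𝒜 V s φ u →
      MemCp 𝒜 V P.r p u) :
    ∃ (x₀ : E n) (δ : ℝ), 0 < δ ∧ ∀ G : FreqSpace n s φ, ∃ f : E n → ℂ,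
      ContDiffOn ℝ p f (Metric.ball x₀ δ) ∧ ∀ ψ : 𝓢(E n, ℂ), tsupport ψ ⊆ Metric.ball x₀ δ →
        (inner ℂ (pairVec hφ s (𝓕⁻ ψ)) G : ℂ) = ∫ x, ψ x * f x := by
  obtain ⟨x₀, hx₀⟩ := hVΩ
  have hU : IsOpen (Ω.carrier ∩ V) := Ω.isOpen.inter hV
  obtain ⟨δ, hδ, hball⟩ := Metric.nhds_basis_closedBall.mem_iff.1 (hU.mem_nhds hx₀)
  -- Nested cut-offs inside Ω ∩ V: η is 1 on the closed ball, and θ is 1 on the support of η.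
  obtain ⟨η', hη's, hη'c, hη't, hη'1⟩ := exists_cutoff (isCompact_closedBall x₀ δ) hU hball
  obtain ⟨θ', hθ's, hθ'c, hθ't, hθ'1⟩ := exists_cutoff hη'c.isCompact hU hη't
  set η : 𝓢(E n, ℂ) := hη'c.toSchwartzMap hη's with hη
  set θ : 𝓢(E n, ℂ) := hθ'c.toSchwartzMap hθ's with hθ
  have hηV : tsupport η ⊆ Ω.carrier ∩ V := hη't
  have hη1 : ∀ x ∈ Metric.closedBall x₀ δ, η x = 1 := hη'1
  refine ⟨x₀, δ, hδ, fun G => ?_⟩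
  obtain ⟨g, hg, hgG⟩ := mem_closure_iff_seq_limit.1 (denseRange_freqOfSchwartz hφ s G)
  choose f hf using hg
  have hlim : Tendsto (fun m => freqOfSchwartz hφ s (f m)) atTop (𝓝 G) := by
    simpa only [hf] using hgG
  have hC := isSchwartzCauchy_of_tendsto hφ hlim
  have hCp := himp (fun m => SchwartzMap.smulLeftCLM ℂ η (f m))
    ⟨s, φ, hφ, hC.isRoitbergCauchy 𝒜 hφ _ (hηV.trans inter_subset_left)⟩
    (memDataLoc_mul 𝒜 hφ P hC (θ := θ) hθ'c (hθ't.trans inter_subset_left) hθ'1)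
  -- The cut-off of the regularity assertion is taken to be η as well. The tested sequence is then
  -- η² f_m, which equals f_m on the ball.
  obtain ⟨F, hF, hFl⟩ := hCp.exists_distribLimit 𝒜 (χ := η) ⟨η.smooth ⊤,
    (closure_mono inter_subset_right).trans (hηV.trans subset_union_left)⟩
  have hbΩ : Metric.ball x₀ δ ⊆ Ω.carrier :=
    Metric.ball_subset_closedBall.trans (hball.trans inter_subset_left)
  refine ⟨F, hF.mono hbΩ, fun ψ hψ => ?_⟩
  have hset : ∀ h : E n → ℂ, ∫ x in Ω.carrier, ψ x * h x = ∫ x, ψ x * h x := fun h =>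
    setIntegral_eq_integral_of_forall_compl_eq_zero fun x hx => by
      rw [image_eq_zero_of_notMem_tsupport fun hx' => hx (hbΩ (hψ hx')), zero_mul]
  have h1 := hFl ψ (hψ.trans hbΩ)
  simp only [hset] at h1
  have h2 : ∀ m, ∫ x, ψ x * cutoffMul η (fun m => SchwartzMap.smulLeftCLM ℂ η (f m)) m x
      = inner ℂ (pairVec hφ s (𝓕⁻ ψ)) (freqOfSchwartz hφ s (f m)) := fun m => by
    rw [inner_pairVec, integral_fourierInv_mul_freqOfSchwartz, SchwartzMap.coe_apply]
    refine integral_congr_ae (Eventually.of_forall fun x => ?_)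
    by_cases hx : x ∈ tsupport ψ
    · simp only [cutoffMul, mul_apply, hη1 x (Metric.ball_subset_closedBall (hψ hx)), one_mul,
        smul_eq_mul]
    · simp only [image_eq_zero_of_notMem_tsupport hx, zero_mul, zero_smul]
  simp only [h2] at h1
  exact tendsto_nhds_unique (Tendsto.inner tendsto_const_nhds hlim) h1

end Pairing

/-! ### The integral condition on the frequency side -/

section Frequency

variable {d : ℕ} {φ : ℝ → ℝ}

/-- Integration by parts `p` times. -/
theorem exists_norm_integral_lineDeriv_mul_le (e : E d) (p : ℕ) :
    ∀ F : E d → ℂ, ContDiff ℝ p F → HasCompactSupport F →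
      ∃ C : ℝ, ∀ ρ : 𝓢(E d, ℂ),
        ‖∫ x, (LineDeriv.lineDerivOp e)^[p] ρ x * F x‖ ≤ C * ∫ x, ‖ρ x‖ := by
  induction p with
  | zero =>
    intro F hF hFc
    obtain ⟨C, hC⟩ := hF.continuous.bounded_above_of_compact_support hFc
    refine ⟨C, fun ρ => ?_⟩
    rw [← integral_const_mul]
    refine norm_integral_le_of_norm_le (ρ.integrable.norm.const_mul C)
      (Eventually.of_forall fun x => ?_)
    rw [Function.iterate_zero, id, norm_mul, mul_comm]
    gcongr
    exact hC x
  | succ p ih =>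
    intro F hF hFc
    have hF1 : ContDiff ℝ 1 F := hF.of_le (by exact_mod_cast Nat.le_add_left 1 p)
    have hF' : ContDiff ℝ p fun x => fderiv ℝ F x e :=
      (hF.fderiv_right (m := p) (by norm_cast)).clm_apply contDiff_const
    have hF'c : HasCompactSupport fun x => fderiv ℝ F x e := hFc.fderiv_apply ℝ e
    obtain ⟨C, hC⟩ := ih _ hF' hF'c
    refine ⟨C, fun ρ => ?_⟩
    refine le_trans (le_of_eq ?_) (hC ρ)
    rw [Function.iterate_succ', ← norm_neg]
    congr 1
    set g := (LineDeriv.lineDerivOp e)^[p] ρ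
    have h1 := integral_mul_fderiv_eq_neg_fderiv_mul_of_integrable (μ := volume)
      (f := fun x => g x) (g := F) (v := e) ?_ ?_ ?_ (fun x _ => g.differentiableAt)
      (fun x _ => hF1.differentiable one_ne_zero x)
    · rw [h1]
      rfl
    · exact ((LineDeriv.lineDerivOp e g).continuous.mul hF.continuous).integrable_of_hasCompactSupport
        hFc.mul_left
    · exact (g.continuous.mul hF'.continuous).integrable_of_hasCompactSupport hF'c.mul_left
    · exact (g.continuous.mul hF.continuous).integrable_of_hasCompactSupport hFc.mul_left

theorem enorm_fourierInv_iterate_lineDeriv (e : E d) (p : ℕ) (ρ : 𝓢(E d, ℂ)) (ξ : E d) :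
    ‖(𝓕⁻ ((LineDeriv.lineDerivOp e)^[p] ρ) : 𝓢(E d, ℂ)) ξ‖ₑ
      = ENNReal.ofReal (2 * Real.pi * |inner ℝ ξ e|) ^ p * ‖(𝓕⁻ ρ : 𝓢(E d, ℂ)) ξ‖ₑ := by
  induction p with
  | zero => simp
  | succ p ih =>
    have htg : (inner ℝ · e : E d → ℝ).HasTemperateGrowth := by fun_prop
    have h3 : ‖(2 * Real.pi * Complex.I : ℂ)‖ = 2 * Real.pi := by
      simp [abs_of_pos Real.pi_pos]
    have h1 : ∀ f : 𝓢(E d, ℂ), ‖(𝓕⁻ (LineDeriv.lineDerivOp e f) : 𝓢(E d, ℂ)) ξ‖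
        = 2 * Real.pi * |inner ℝ ξ e| * ‖(𝓕⁻ f : 𝓢(E d, ℂ)) ξ‖ := fun f => by
      rw [SchwartzMap.fourierInv_lineDerivOp_eq, smul_apply, norm_smul,
        SchwartzMap.smulLeftCLM_apply_apply htg, norm_smul, norm_neg, h3, Real.norm_eq_abs,
        ← mul_assoc]
    rw [Function.iterate_succ', Function.comp_apply, ← ofReal_norm, h1,
      ENNReal.ofReal_mul (by positivity), ofReal_norm, ih, pow_succ']
    ring

/-- Smooth functions of mass one that are concentrated near a point. -/
theorem exists_approx_delta (x₀ : E d) {δ : ℝ} (hδ : 0 < δ) :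
    ∃ ρ : ℕ → 𝓢(E d, ℂ), (∀ k, tsupport (ρ k) ⊆ Metric.closedBall x₀ δ) ∧
      (∀ k, ∫ x, ‖ρ k x‖ = 1) ∧
      ∀ ξ, Tendsto (fun k => ‖(𝓕⁻ (ρ k) : 𝓢(E d, ℂ)) ξ‖ₑ) atTop (𝓝 1) := by
  have hpos : ∀ k : ℕ, 0 < δ / (k + 1) := fun k => by positivity
  let b : ℕ → ContDiffBump x₀ := fun k =>
    ⟨δ / (k + 1) / 2, δ / (k + 1), half_pos (hpos k), half_lt_self (hpos k)⟩
  have hbs : ∀ k, ContDiff ℝ ∞ fun x => ((b k).normed volume x : ℂ) := fun k =>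
    Complex.ofRealCLM.contDiff.comp (b k).contDiff_normed
  have hbc : ∀ k, HasCompactSupport fun x => ((b k).normed volume x : ℂ) := fun k =>
    (b k).hasCompactSupport_normed.comp_left (g := fun t : ℝ => (t : ℂ)) Complex.ofReal_zero
  have hsupp : ∀ k x, (b k).normed volume x ≠ 0 → x ∈ Metric.ball x₀ (δ / (k + 1)) :=
    fun k x hx => by
      have : x ∈ Function.support ((b k).normed volume) := hx
      rwa [ContDiffBump.support_normed_eq] at this
  have hle : ∀ k : ℕ, δ / (k + 1) ≤ δ := fun k =>
    div_le_self hδ.le (by linarith [(Nat.cast_nonneg k : (0 : ℝ) ≤ k)])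
  refine ⟨fun k => (hbc k).toSchwartzMap (hbs k), fun k => ?_, fun k => ?_, fun ξ => ?_⟩
  · refine closure_minimal (fun x hx => ?_) Metric.isClosed_closedBall
    have hx' : (b k).normed volume x ≠ 0 := fun h => hx (by
      change ((b k).normed volume x : ℂ) = 0
      rw [h, Complex.ofReal_zero])
    exact Metric.closedBall_subset_closedBall (hle k)
      (Metric.ball_subset_closedBall (hsupp k x hx'))
  · rw [← (b k).integral_normed (μ := volume)]
    refine integral_congr_ae (Eventually.of_forall fun x => ?_)
    change ‖((b k).normed volume x : ℂ)‖ = _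
    rw [Complex.norm_real, Real.norm_of_nonneg ((b k).nonneg_normed x)]
  -- The inverse transforms are averages of this character over balls that shrink to x₀, so they
  -- tend to its unimodular value at x₀.
  · set g : E d → ℂ := fun x => Complex.exp (↑(2 * Real.pi * inner ℝ x ξ) * Complex.I) with hg
    have hgc : Continuous g := by fun_prop
    have h1 : Tendsto (fun k => (𝓕⁻ ((hbc k).toSchwartzMap (hbs k)) : 𝓢(E d, ℂ)) ξ) atTop
        (𝓝 (g x₀)) := by
      rw [Metric.tendsto_atTop]
      intro ε hε
      obtain ⟨r, hr, hrg⟩ := Metric.continuous_iff.1 hgc x₀ (ε / 2) (half_pos hε)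
      obtain ⟨N, hN⟩ := exists_nat_gt (δ / r)
      refine ⟨N, fun k hk => ?_⟩
      have hkr : δ / (k + 1) < r := by
        have h2 : (N : ℝ) ≤ k := by exact_mod_cast hk
        rw [div_lt_iff₀ hr] at hN
        rw [div_lt_iff₀ (by positivity)]
        nlinarith
      have h3 : (𝓕⁻ ((hbc k).toSchwartzMap (hbs k)) : 𝓢(E d, ℂ)) ξ - g x₀
          = ∫ x, (b k).normed volume x • (g x - g x₀) := by
        have hi : Integrable fun x => (b k).normed volume x • g x :=
          ((b k).continuous_normed.smul hgc).integrable_of_hasCompactSupport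
            (b k).hasCompactSupport_normed.smul_right
        have hi' : Integrable fun x => (b k).normed volume x • g x₀ :=
          (b k).integrable_normed.smul_const _
        simp only [smul_sub]
        rw [integral_sub hi hi', ContDiffBump.integral_normed_smul, SchwartzMap.fourierInv_coe,
          Real.fourierInv_eq']
        congr 1
        refine integral_congr_ae (Eventually.of_forall fun x => ?_)
        simp only [smul_eq_mul, Complex.real_smul, hg]
        rw [mul_comm]
        rfl
      rw [dist_eq_norm, h3]
      refine lt_of_le_of_lt ?_ (half_lt_self hε)
      rw [← mul_one (ε / 2), ← (b k).integral_normed (μ := volume), ← integral_const_mul]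
      refine norm_integral_le_of_norm_le ((b k).integrable_normed.const_mul _)
        (Eventually.of_forall fun x => ?_)
      rw [norm_smul, Real.norm_of_nonneg ((b k).nonneg_normed x), mul_comm]
      by_cases hx : (b k).normed volume x = 0
      · simp [hx]
      · refine mul_le_mul_of_nonneg_right ?_ ((b k).nonneg_normed x)
        rw [← dist_eq_norm]
        exact (hrg x ((Metric.mem_ball.1 (hsupp k x hx)).trans hkr)).le
    have h4 : ‖g x₀‖ₑ = 1 := by
      rw [← ofReal_norm, hg, Complex.norm_exp_ofReal_mul_I, ENNReal.ofReal_one]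
    rw [← h4]
    exact h1.enorm

/-- If all elements of `H^{s,φ}(ℝᵈ)` are of class `C^p` in a ball, then `|ξ·e|^{2p}/w(ξ)²` is
integrable, `w` the weight. -/
theorem lintegral_inner_pow_lt_top (hφ : ClassM φ) {p : ℕ} {s : ℝ} {x₀ : E d} {δ : ℝ} (hδ : 0 < δ)
    (h : ∀ G : FreqSpace d s φ, ∃ f : E d → ℂ, ContDiffOn ℝ p f (Metric.ball x₀ δ) ∧
      ∀ ψ : 𝓢(E d, ℂ), tsupport ψ ⊆ Metric.ball x₀ δ →
        (inner ℂ (pairVec hφ s (𝓕⁻ ψ)) G : ℂ) = ∫ x, ψ x * f x) (e : E d) :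
    ∫⁻ ξ : E d, ENNReal.ofReal ((weight s φ ξ)⁻¹ ^ 2) *
      ENNReal.ofReal (|inner ℝ ξ e| ^ (2 * p)) < ⊤ := by
  obtain ⟨ρ, hρs, hρ1, hρl⟩ := exists_approx_delta x₀ (half_pos hδ)
  have hsub : Metric.closedBall x₀ (δ / 2) ⊆ Metric.ball x₀ δ :=
    Metric.closedBall_subset_ball (half_lt_self hδ)
  set ψ : ℕ → 𝓢(E d, ℂ) := fun k => (LineDeriv.lineDerivOp e)^[p] (ρ k) with hψ
  have hψs : ∀ k, tsupport (ψ k) ⊆ Metric.closedBall x₀ (δ / 2) := fun k => by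
    have h1 : ∀ m : ℕ, tsupport ((LineDeriv.lineDerivOp e)^[m] (ρ k) : 𝓢(E d, ℂ))
        ⊆ tsupport (ρ k) := by
      intro m
      induction m with
      | zero => exact subset_rfl
      | succ m ih =>
        rw [Function.iterate_succ', Function.comp_apply]
        exact (SchwartzMap.tsupport_lineDerivOp_subset e _).trans ih
    exact (h1 p).trans (hρs k)
  -- For fixed G the function f is of class C^p near the supports of all ψ_k. After p integrations
  -- by parts the pairing is bounded by a supremum of the p-th derivative of η f, times ‖ρ_k‖_{L₁} =
  -- 1.
  have hbdd : ∀ G : FreqSpace d s φ, ∃ C : ℝ, ∀ k,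
      ‖innerSL ℂ (pairVec hφ s (𝓕⁻ (ψ k))) G‖ ≤ C := by
    intro G
    obtain ⟨f, hf, hfψ⟩ := h G
    obtain ⟨η, hη, hηc, hηs, hη1⟩ := exists_cutoff (isCompact_closedBall x₀ (δ / 2))
      Metric.isOpen_ball hsub
    have hF : ContDiff ℝ p fun x => η x * f x := by
      rw [contDiff_iff_contDiffAt]
      intro x
      by_cases hx : x ∈ tsupport η
      · exact (hη.contDiffAt.of_le (by exact_mod_cast le_top)).mul
          (hf.contDiffAt (Metric.isOpen_ball.mem_nhds (hηs hx)))
      · refine contDiffAt_const (c := (0 : ℂ)) |>.congr_of_eventuallyEq ?_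
        filter_upwards [(isClosed_tsupport η).isOpen_compl.mem_nhds hx] with y hy
        rw [image_eq_zero_of_notMem_tsupport hy, zero_mul]
    obtain ⟨C, hC⟩ := exists_norm_integral_lineDeriv_mul_le e p _ hF hηc.mul_right
    refine ⟨C, fun k => ?_⟩
    have h1 := hC (ρ k)
    rw [hρ1, mul_one] at h1
    rw [innerSL_apply_apply, hfψ _ ((hψs k).trans hsub)]
    refine le_trans (le_of_eq ?_) h1
    congr 1
    refine integral_congr_ae (Eventually.of_forall fun x => ?_)
    by_cases hx : x ∈ tsupport (ψ k)
    · simp only [hη1 x (hψs k hx), one_mul, hψ]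
    · have h2 : (ψ k) x = 0 := image_eq_zero_of_notMem_tsupport hx
      simp only [hψ] at h2
      simp only [hψ, h2, zero_mul]
  -- Pointwise boundedness on a Banach space gives bounded functional norms, and these are L₂ norms
  -- with weight 1/w of the transforms of ψ_k.
  obtain ⟨C, hC⟩ := banach_steinhaus hbdd
  simp only [innerSL_apply_norm] at hC
  have hlint : ∀ k, ∫⁻ ξ : E d, ENNReal.ofReal ((weight s φ ξ)⁻¹ ^ 2) *
      (ENNReal.ofReal (2 * Real.pi * |inner ℝ ξ e|) ^ p * ‖(𝓕⁻ (ρ k) : 𝓢(E d, ℂ)) ξ‖ₑ) ^ 2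
      ≤ ENNReal.ofReal C ^ 2 := fun k => by
    have h1 : ‖pairVec hφ s (𝓕⁻ (ψ k))‖ₑ ^ 2 ≤ ENNReal.ofReal C ^ 2 := by
      rw [← ofReal_norm]
      gcongr
      exact hC k
    rw [enorm_pairVec, freqNorm_sq] at h1
    simpa only [weight_neg_inv, hψ, enorm_fourierInv_iterate_lineDeriv] using h1
  -- Since |𝓕⁻ρ_k(ξ)| → 1 at each ξ, Fatou's lemma removes the mollifiers from the bound.
  have hFatou : ∫⁻ ξ : E d, ENNReal.ofReal ((weight s φ ξ)⁻¹ ^ 2) *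
      (ENNReal.ofReal (2 * Real.pi * |inner ℝ ξ e|) ^ p) ^ 2 ≤ ENNReal.ofReal C ^ 2 := by
    have hlim : ∀ ξ : E d, Tendsto (fun k => ENNReal.ofReal ((weight s φ ξ)⁻¹ ^ 2) *
        (ENNReal.ofReal (2 * Real.pi * |inner ℝ ξ e|) ^ p * ‖(𝓕⁻ (ρ k) : 𝓢(E d, ℂ)) ξ‖ₑ) ^ 2)
        atTop (𝓝 (ENNReal.ofReal ((weight s φ ξ)⁻¹ ^ 2) *
          (ENNReal.ofReal (2 * Real.pi * |inner ℝ ξ e|) ^ p) ^ 2)) := fun ξ => by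
      have h1 := ENNReal.Tendsto.const_mul (a := ENNReal.ofReal (2 * Real.pi * |inner ℝ ξ e|) ^ p)
        (hρl ξ) (Or.inr (ENNReal.pow_ne_top ENNReal.ofReal_ne_top))
      rw [mul_one] at h1
      exact ENNReal.Tendsto.const_mul (ENNReal.Tendsto.pow (n := 2) h1) (Or.inr ENNReal.ofReal_ne_top)
    calc _ = ∫⁻ ξ : E d, liminf (fun k => ENNReal.ofReal ((weight s φ ξ)⁻¹ ^ 2) *
          (ENNReal.ofReal (2 * Real.pi * |inner ℝ ξ e|) ^ p *
            ‖(𝓕⁻ (ρ k) : 𝓢(E d, ℂ)) ξ‖ₑ) ^ 2) atTop :=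
          lintegral_congr fun ξ => (hlim ξ).liminf_eq.symm
      _ ≤ liminf (fun k => ∫⁻ ξ : E d, ENNReal.ofReal ((weight s φ ξ)⁻¹ ^ 2) *
          (ENNReal.ofReal (2 * Real.pi * |inner ℝ ξ e|) ^ p *
            ‖(𝓕⁻ (ρ k) : 𝓢(E d, ℂ)) ξ‖ₑ) ^ 2) atTop := by
          refine lintegral_liminf_le fun k => ?_
          have h1 := measurable_weight (d := d) hφ s
          have h2 := (𝓕⁻ (ρ k) : 𝓢(E d, ℂ)).continuous.measurable
          fun_prop
      _ ≤ _ := liminf_le_of_le (by isBoundedDefault) fun b hb => by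
          obtain ⟨k, hk⟩ := hb.exists
          exact hk.trans (hlint k)
  refine lt_of_le_of_lt (lintegral_mono fun ξ => ?_)
    (hFatou.trans_lt (ENNReal.pow_lt_top ENNReal.ofReal_lt_top))
  refine mul_le_mul_right ?_ _
  rw [← pow_mul, ← ENNReal.ofReal_pow (by positivity), mul_comm p 2]
  refine ENNReal.ofReal_le_ofReal (pow_le_pow_left₀ (abs_nonneg _) ?_ _)
  have := Real.pi_gt_three
  nlinarith [abs_nonneg (inner ℝ ξ e)]

/-- If `|ξ·e|^{2p}/w(ξ)²` is integrable for all `e`, so is `|ξ|^{2p}/w(ξ)²`. -/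
theorem lintegral_norm_pow_lt_top [NeZero d] (hφ : ClassM φ) {p : ℕ} {s : ℝ}
    (h : ∀ e : E d, ∫⁻ ξ : E d, ENNReal.ofReal ((weight s φ ξ)⁻¹ ^ 2) *
      ENNReal.ofReal (|inner ℝ ξ e| ^ (2 * p)) < ⊤) :
    ∫⁻ ξ : E d, ENNReal.ofReal ((weight s φ ξ)⁻¹ ^ 2) * ENNReal.ofReal (‖ξ‖ ^ (2 * p)) < ⊤ := by
  have hpt : ∀ ξ : E d, ENNReal.ofReal (‖ξ‖ ^ (2 * p)) ≤ ∑ i : Fin d, ENNReal.ofReal ((d : ℝ) ^ p)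
      * ENNReal.ofReal (|inner ℝ ξ (EuclideanSpace.single i (1 : ℝ))| ^ (2 * p)) := by
    intro ξ
    -- The largest coordinate satisfies |ξ|² ≤ d ξ_i², which is the source of the factor d^p.
    obtain ⟨i, -, hi⟩ := Finset.exists_max_image Finset.univ (fun i => ξ i ^ 2)
      Finset.univ_nonempty
    have h1 : ‖ξ‖ ^ 2 ≤ d * ξ i ^ 2 := by
      rw [EuclideanSpace.real_norm_sq_eq]
      refine (Finset.sum_le_card_nsmul _ _ _ hi).trans (le_of_eq ?_)
      simp
    refine le_trans ?_ (Finset.single_le_sum (fun _ _ => zero_le) (Finset.mem_univ i))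
    rw [← ENNReal.ofReal_mul (by positivity)]
    refine ENNReal.ofReal_le_ofReal ?_
    rw [pow_mul, pow_mul, sq_abs, ← mul_pow]
    refine pow_le_pow_left₀ (by positivity) (h1.trans (le_of_eq ?_)) p
    simp [EuclideanSpace.inner_single_right]
  have hm := measurable_weight (d := d) hφ s
  calc _ ≤ ∫⁻ ξ : E d, ∑ i : Fin d, ENNReal.ofReal ((d : ℝ) ^ p) *
        (ENNReal.ofReal ((weight s φ ξ)⁻¹ ^ 2) *
        ENNReal.ofReal (|inner ℝ ξ (EuclideanSpace.single i (1 : ℝ))| ^ (2 * p))) := by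
        refine lintegral_mono fun ξ => (mul_le_mul_right (hpt ξ) _).trans (le_of_eq ?_)
        rw [Finset.mul_sum]
        exact Finset.sum_congr rfl fun i _ => mul_left_comm _ _ _
    _ = ∑ i : Fin d, ENNReal.ofReal ((d : ℝ) ^ p) *
        ∫⁻ ξ : E d, ENNReal.ofReal ((weight s φ ξ)⁻¹ ^ 2) *
        ENNReal.ofReal (|inner ℝ ξ (EuclideanSpace.single i (1 : ℝ))| ^ (2 * p)) := by
        rw [lintegral_finsetSum _ fun i _ => by fun_prop]
        exact Finset.sum_congr rfl fun i _ => lintegral_const_mul _ (by fun_prop)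
    _ < ⊤ := ENNReal.sum_lt_top.2 fun i _ => ENNReal.mul_lt_top ENNReal.ofReal_lt_top (h _)

end Frequency

/-! ### Radial integration -/

section Radial

variable {n : ℕ} {φ : ℝ → ℝ}

theorem ClassM.measurable_max (hφ : ClassM φ) : Measurable fun t => φ (max 1 t) :=
  hφ.measurable.comp ((measurable_const.max measurable_id).subtype_mk
    (h := fun t => le_max_left (1 : ℝ) t))

/-- Covers the bounded range of t that the change of variables below does not reach; 1/φ is bounded
there. -/
theorem ClassM.integrableOn_Ioc (hφ : ClassM φ) (b : ℝ) :
    IntegrableOn (fun t : ℝ => 1 / (t * φ (max 1 t) ^ 2)) (Ioc 1 b) := by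
  obtain ⟨C, hC⟩ := hφ.bounded (max b 2) (by simp)
  have hm := hφ.measurable_max
  refine Measure.integrableOn_of_bounded (M := C ^ 2) (by simp)
    ((measurable_id.mul (hm.pow_const 2)).const_div 1).aestronglyMeasurable ?_
  refine (ae_restrict_iff' measurableSet_Ioc).2 (Eventually.of_forall fun t ht => ?_)
  have h1 : max 1 t = t := max_eq_right ht.1.le
  have h2 := hφ.pos t ht.1.le
  have h3 := (hC t ⟨ht.1.le, ht.2.trans (le_max_left _ _)⟩).2
  have h4 : 0 < (φ t)⁻¹ := inv_pos.2 h2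
  have ht0 : 0 < t := zero_lt_one.trans ht.1
  rw [h1, Real.norm_of_nonneg (by positivity), one_div, mul_inv, ← inv_pow]
  calc t⁻¹ * (φ t)⁻¹ ^ 2 ≤ 1 * C ^ 2 := by
        gcongr
        exact inv_le_one_of_one_le₀ ht.1.le
    _ = C ^ 2 := one_mul _

/-- The order p + n/2 doubles to the integer 2p + n. This exponent is the critical one: against
|ξ|^{2p} and the polar factor r^{n-1} it leaves just 1/r. -/
theorem weight_sq_eq (φ : ℝ → ℝ) (p : ℕ) (ξ : E n) :
    weight ((p : ℝ) + (n : ℝ) / 2) φ ξ ^ 2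
      = bracket ξ ^ (2 * p + n) * φ (max 1 (bracket ξ)) ^ 2 := by
  rw [weight, mul_pow, max_eq_right (one_le_bracket ξ), ← Real.rpow_natCast (_ ^ _) 2,
    ← Real.rpow_mul (bracket_pos ξ).le, ← Real.rpow_natCast (bracket ξ) (2 * p + n)]
  congr 2
  push_cast
  ring

/-- In polar coordinates with the new variable `t = ⟨2πξ⟩`, the integral of `|ξ|^{2p}/w(ξ)²` is,
up to a factor bounded from above and below, the integral of `1/(t φ(t)²)`. -/
theorem integrableOn_of_lintegral_norm_pow_lt_top (hn : 2 ≤ n) (hφ : ClassM φ) {p : ℕ}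
    (h : ∫⁻ ξ : E n, ENNReal.ofReal ((weight ((p : ℝ) + (n : ℝ) / 2) φ ξ)⁻¹ ^ 2) *
      ENNReal.ofReal (‖ξ‖ ^ (2 * p)) < ⊤) :
    IntegrableOn (fun t : ℝ => 1 / (t * φ t ^ 2)) (Ioi 1) := by
  have hne : Nonempty (Fin n) := ⟨⟨0, by omega⟩⟩
  set b : ℝ → ℝ := fun r => Real.sqrt (1 + (2 * Real.pi * r) ^ 2) with hb
  set Φ : ℝ → ℝ := fun t => φ (max 1 t) with hΦ
  have hΦm : Measurable Φ := hφ.measurable_max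
  have hΦpos : ∀ t, 0 < Φ t := fun t => hφ.pos _ (le_max_left 1 t)
  have hbc : Continuous b := by fun_prop
  have hbpos : ∀ r, 0 < b r := fun r => Real.sqrt_pos.2 (by positivity)
  have hbsq : ∀ r, b r ^ 2 = 1 + (2 * Real.pi * r) ^ 2 := fun r => Real.sq_sqrt (by positivity)
  set F : ℝ → ℝ := fun r => r ^ (2 * p) * (b r ^ (2 * p + n) * Φ (b r) ^ 2)⁻¹ with hF
  have hbm := hbc.measurable
  have hFm : Measurable F := by fun_prop
  have hint : Integrable fun ξ : E n => F ‖ξ‖ := by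
    refine ⟨(hFm.comp measurable_norm).aestronglyMeasurable, ?_⟩
    rw [hasFiniteIntegral_iff_ofReal (Eventually.of_forall fun ξ => by
      have := hbpos ‖ξ‖
      have := hΦpos (b ‖ξ‖)
      positivity)]
    refine lt_of_le_of_lt (le_of_eq ?_) h
    refine lintegral_congr fun ξ => ?_
    rw [← ENNReal.ofReal_mul (by positivity), inv_pow, weight_sq_eq, mul_comm]
    rfl
  -- Polar coordinates: integrability of a radial function on ℝⁿ becomes integrability on (0,∞) with
  -- the factor r^{n-1}.
  rw [integrable_fun_norm_addHaar] at hint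
  simp only [finrank_euclideanSpace, Fintype.card_fin, smul_eq_mul] at hint
  set g : ℝ → ℝ := fun t => 1 / (t * Φ t ^ 2) with hg
  have hbderiv : ∀ r, HasDerivAt b ((2 * Real.pi) ^ 2 * r / b r) r := fun r => by
    have h1 : HasDerivAt (fun r => 1 + (2 * Real.pi * r) ^ 2) (2 * (2 * Real.pi) ^ 2 * r) r := by
      have h2 := (((hasDerivAt_id r).const_mul (2 * Real.pi)).pow 2).const_add 1
      refine h2.congr_deriv ?_
      simp only [id]
      ring
    refine (h1.sqrt (by positivity)).congr_deriv ?_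
    have := (hbpos r).ne'
    change 2 * (2 * Real.pi) ^ 2 * r / (2 * b r) = _
    field_simp
  have hinj : InjOn b (Ioi 1) := by
    intro r hr r' hr' hrr
    have h1 : (2 * Real.pi * r) ^ 2 = (2 * Real.pi * r') ^ 2 := by
      linarith [hbsq r, hbsq r', congrArg (· ^ 2) hrr]
    have h2 : 0 < 2 * Real.pi := by positivity
    have hr0 : 0 < r := zero_lt_one.trans hr
    have hr0' : 0 < r' := zero_lt_one.trans hr'
    exact mul_left_cancel₀ h2.ne' ((pow_left_inj₀ (by positivity) (by positivity) two_ne_zero).1 h1)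
  -- Substitution t = b(r) for r > 1, where dt = (2π)² r dr / b(r). The constant below combines
  -- (2π)² from this derivative with a power of 8 from b(r) ≤ 8r.
  have himage : IntegrableOn g (b '' Ioi 1) := by
    rw [integrableOn_image_iff_integrableOn_abs_deriv_smul measurableSet_Ioi
      (fun r _ => (hbderiv r).hasDerivWithinAt) hinj]
    have hint' := (hint.mono_set (Ioi_subset_Ioi zero_le_one)).const_mul
      ((2 * Real.pi) ^ 2 * 8 ^ (2 * p + (n - 2)))
    refine Integrable.mono' hint' (Measurable.aestronglyMeasurable (by fun_prop)) ?_
    refine (ae_restrict_iff' measurableSet_Ioi).2 (Eventually.of_forall fun r hr => ?_)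
    have hr1 : 1 < r := hr
    have hr0 : 0 < r := zero_lt_one.trans hr1
    have hB := hbpos r
    have hP := hΦpos (b r)
    -- For r > 1 one has 1 + 4π² r² ≤ 41 r² ≤ 64 r².
    have hle : b r ≤ 8 * r := by
      refine le_of_sq_le_sq ?_ (by positivity)
      rw [hbsq]
      have := Real.pi_lt_d2
      have h3 : Real.pi ^ 2 ≤ 10 := by nlinarith [Real.pi_pos]
      nlinarith
    have h4 : b r ^ (2 * p + (n - 2)) ≤ 8 ^ (2 * p + (n - 2)) * r ^ (2 * p + (n - 2)) := by
      rw [← mul_pow]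
      exact pow_le_pow_left₀ hB.le hle _
    have h5 : b r ^ (2 * p + n) = b r ^ 2 * b r ^ (2 * p + (n - 2)) := by
      rw [← pow_add]
      congr 1
      omega
    have h6 : r ^ (n - 1) * r ^ (2 * p) = r * r ^ (2 * p + (n - 2)) := by
      rw [← pow_add, ← pow_succ']
      congr 1
      omega
    have h7 : (2 * Real.pi) ^ 2 * 8 ^ (2 * p + (n - 2)) * (r ^ (n - 1) * F r)
        = (2 * Real.pi) ^ 2 * r / (b r ^ 2 * Φ (b r) ^ 2) *
          (8 ^ (2 * p + (n - 2)) * r ^ (2 * p + (n - 2)) / b r ^ (2 * p + (n - 2))) := by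
      simp only [hF, h5]
      rw [← mul_assoc (r ^ (n - 1)), h6]
      field_simp
    rw [h7, Real.norm_of_nonneg (by positivity), abs_of_nonneg (by positivity), smul_eq_mul]
    calc (2 * Real.pi) ^ 2 * r / b r * g (b r)
        = (2 * Real.pi) ^ 2 * r / (b r ^ 2 * Φ (b r) ^ 2) * 1 := by
          simp only [hg]
          field_simp
      _ ≤ _ := by
          refine mul_le_mul_of_nonneg_left ?_ (by positivity)
          rwa [one_le_div (by positivity)]
  -- Solving t = b(r) for r shows that the substitution reaches every t > b(1); the interval (1,
  -- b(1)] is handled by boundedness.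
  have hsub : Ioi (b 1) ⊆ b '' Ioi 1 := by
    intro t ht
    have ht' : b 1 < t := ht
    have ht0 : 0 < t := (hbpos 1).trans ht'
    have ht2 : b 1 ^ 2 < t ^ 2 := pow_lt_pow_left₀ ht' (hbpos 1).le two_ne_zero
    rw [hbsq] at ht2
    have hπ : 0 < 2 * Real.pi := by positivity
    refine ⟨Real.sqrt (t ^ 2 - 1) / (2 * Real.pi), ?_, ?_⟩
    · rw [mem_Ioi, lt_div_iff₀ hπ, one_mul]
      refine Real.lt_sqrt_of_sq_lt ?_
      linarith
    · simp only [hb]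
      rw [mul_div_cancel₀ _ hπ.ne', Real.sq_sqrt (by nlinarith), add_sub_cancel, Real.sqrt_sq ht0.le]
  have hb1 : 1 ≤ b 1 := Real.one_le_sqrt.2 (by nlinarith [sq_nonneg (2 * Real.pi * 1)])
  have htotal : IntegrableOn g (Ioi 1) := by
    rw [← Ioc_union_Ioi_eq_Ioi hb1]
    exact (hφ.integrableOn_Ioc (b 1)).union (himage.mono_set hsub)
  refine htotal.congr_fun (fun t ht => ?_) measurableSet_Ioi
  simp only [hg, hΦ, max_eq_right (le_of_lt (mem_Ioi.1 ht))]

end Radial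

end HormanderRoitberg

end

theorem mainTheorem8 (n : ℕ) (hn : 2 ≤ n) (Ω : SmoothDomain n) (𝒜 : BoundaryAtlas Ω)
    (q : ℕ) (hq : 1 ≤ q) (P : BoundaryProblem n q) (hP : P.IsElliptic Ω) (hm : 2 * q ≤ P.m)
    (V : Set (E n)) (hV : IsOpen V) (hVΩ : (Ω.carrier ∩ V).Nonempty)
    (p : ℕ) (φ : ℝ → ℝ) (hφ : ClassM φ)
    (himp : ∀ u : ℕ → E n → ℂ, MemNegInfty 𝒜 P.r u →
      P.MemDataLoc 𝒜 V ((p : ℝ) + (n : ℝ) / 2) φ u → MemCp 𝒜 V P.r p u) :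
    IntegrableOn (fun t : ℝ => 1 / (t * φ t ^ 2)) (Ioi 1) := by
  obtain ⟨x₀, δ, hδ, h⟩ := exists_contDiffOn_pairing 𝒜 hφ P hV hVΩ himp
  have : NeZero n := ⟨by omega⟩
  exact integrableOn_of_lintegral_norm_pow_lt_top hn hφ
    (lintegral_norm_pow_lt_top hφ (lintegral_inner_pow_lt_top hφ hδ h))
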